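/- Let $\Bbbk$ be a field, let $\mathcal V=(\mathcal V(n))_{n\ge 1}$ be a collection of $\Bbbk$-vector spaces with a fixed basis, and let $\mathcal F_{\mathcal V}$ be the free shuffle operad generated by $\mathcal V$. Its basis in arity $n$ consists of the tree monomials: rooted trees with $n$ leaves labelled bijectively by $1,\dots,n$, with each vertex with $r$ inputs decorated by a basis element of $\mathcal V(r)$, and with the inputs of each vertex ordered by the smallest leaves that can be reached through them. Fix an admissible ordering of tree monomials which is a well-ordering. (Admissible means: a total ordering such that monomials of smaller arity are smaller, and such that $\alpha\le\alpha'$ in arity $n$ and $\beta\le\beta'$ in arity $m$ imply $\alpha\circ_{i,\sigma}\beta\le\alpha'\circ_{i,\sigma}\beta'$ for all elementary shuffle compositions $\circ_{i,\sigma}$.) For $f\ne0$ write $\mathrm{lt}(f)$ for the leading term of $f$ and $c_f$ for its coefficient. A tree monomial $\alpha$ is divisible by $\beta$ if $\beta$ corresponds to a subtree of $\alpha$ (leaves of the subtree being numbered according to their smallest descendants in $\alpha$); $m_{\alpha,\beta}$ denotes the operation, extended linearly to elements of the same arity as $\beta$, which replaces this subtree by another monomial. For homogeneous $f,g$ (that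 is, all monomials of each have the same arity): * if $\mathrm{lt}(f)$ is divisible by $\mathrm{lt}(g)$, the corresponding reduction of $f$ modulo $g$ is $f-\frac{c_f}{c_g}m_{\mathrm{lt}(f),\mathrm{lt}(g)}(g)$; * if a tree monomial $\gamma$ is divisible by both $\mathrm{lt}(f)$ and $\mathrm{lt}(g)$ and has fewer vertices than $\mathrm{lt}(f)$ and $\mathrm{lt}(g)$ have in total, the corresponding $S$-polynomial is $m_{\gamma,\mathrm{lt}(f)}(f)-\frac{c_f}{c_g}m_{\gamma,\mathrm{lt}(g)}(g)$. (There is one reduction or $S$-polynomial for each choice of the subtrees involved.) A set $\mathcal G$ of homogeneous elements is a Gröbner basis of an operadic ideal $\mathcal M$ if it generates $\mathcal M$ and the leading term of every nonzero $f\in\mathcal M$ is divisible by the leading term of some nonzero element of $\mathcal G$. Buchberger's algorithm takes a set $\mathcal K$ of homogeneous elements and repeats the following step: form all reductions of elements of $\mathcal K$ modulo each other and all $S$-polynomials of pairs of elements of $\mathcal K$; reduce each of them modulo $\mathcal K$ until its leading term can no longer be cancelled (reducing nonleading terms in the same way is permitted as well, and any choice of the reductions made is allowed); join the nonzero results to $\mathcal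 K$. The algorithm stops when no nonzero elements are joined. Its output is the union of all the sets obtained (which is the last one if it stops). **Theorem.** 1. Let $\mathcal K$ be a set of homogeneous elements generating the operadic ideal $\mathcal M$ of the free shuffle operad $\mathcal F_{\mathcal V}$. Then the algorithm with the input $\mathcal K$ can be carried out, and each of its (possibly infinite) outputs is a Gröbner basis of $\mathcal M$. 2. Let moreover $\mathcal V$ be a symmetric collection, so that $\mathcal F_{\mathcal V}$ also is the free symmetric operad generated by $\mathcal V$, and let $\mathcal K$ be a set of homogeneous elements generating the symmetric operadic ideal $\mathcal M$. Extend $\mathcal K$ by all the results of the symmetric group actions on its elements. Then the algorithm with this extended input can be carried out, and each of its (possibly infinite) outputs is a Gröbner basis of $\mathcal M$, regarded as an ideal of the shuffle operad. -/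

import Mathlib

/-- Planar rooted trees with leaves labelled by natural numbers and with every vertex having
`n + 1` inputs (`n : ℕ`) decorated by an element of `X (n + 1)`.  Here `X n`, `n ≥ 1`, is a basis of
the component `V(n)` of the collection of generators (`X 0` is not used: `V(n)` is considered for
`n ≥ 1` only).  A `leaf` alone is the degenerate tree. -/
inductive OpTree (X : ℕ → Type*)
  | leaf (l : ℕ) : OpTree X
  | node {n : ℕ} (x : X (n + 1)) (c : Fin (n + 1) → OpTree X) : OpTree X

namespace OpTree

variable {X : ℕ → Type*}

/-- The labels of the leaves, from left to right. -/
def leaves : OpTree X → List ℕ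
  | leaf l => [l]
  | node _ c => (List.ofFn fun j => (c j).leaves).flatten

/-- The number of leaves. -/
def arity (t : OpTree X) : ℕ := t.leaves.length

/-- The number of vertices. -/
def size : OpTree X → ℕ
  | leaf _ => 0
  | node _ c => 1 + ∑ j, (c j).size

/-- The smallest leaf label. -/
def minLeaf : OpTree X → ℕ
  | leaf l => l
  | node _ c => Finset.univ.inf' Finset.univ_nonempty fun j => (c j).minLeaf

/-- Substitution of the trees `s l` for the leaves labelled `l`. -/
def graft : OpTree X → (ℕ → OpTree X) → OpTree X
  | leaf l, s => s l
  | node x c, s => node x fun j => (c j).graft s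

/-- Relabelling of the leaves. -/
def relabel (φ : ℕ → ℕ) (t : OpTree X) : OpTree X := t.graft fun l => leaf (φ l)

/-- The planar structure is the canonical one: the inputs of each vertex are ordered by the smallest
leaves that can be reached through them. -/
def IsShuffle : OpTree X → Prop
  | leaf _ => True
  | node _ c => (∀ j, (c j).IsShuffle) ∧ StrictMono fun j => (c j).minLeaf

/-- Tree monomials: canonical planar representatives of decorated trees whose leaves are labelled
bijectively by `1, …, n`. -/
def IsMonomial (t : OpTree X) : Prop :=
  t.IsShuffle ∧ t.leaves.Perm (List.range' 1 t.arity)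

/-- `σ` permutes `{1, …, n}` (and is extended by the identity). -/
def IsPermOf (n : ℕ) (σ : Equiv.Perm ℕ) : Prop := ∀ j, j ∉ Finset.Icc 1 n → σ j = j

/-- `1 ≤ i ≤ n`, and `σ` is an `(m - 1, n - i)`-shuffle: a permutation of
`{i + 1, …, n + m - 1}`, increasing on `{i + 1, …, i + m - 1}` and on `{i + m, …, n + m - 1}`. -/
def IsShufflePerm (n m i : ℕ) (σ : Equiv.Perm ℕ) : Prop :=
  1 ≤ i ∧ i ≤ n ∧ (∀ j, j ∉ Finset.Ico (i + 1) (n + m) → σ j = j) ∧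
    StrictMonoOn σ (Set.Ico (i + 1) (i + m)) ∧ StrictMonoOn σ (Set.Ico (i + m) (n + m))

/-- The elementary composition of trees: if `α` has `n` leaves and `β` has `m` leaves, this is
`α(x_{σ(1)}, …, x_{σ(i-1)}, β(x_{σ(i)}, …, x_{σ(i+m-1)}), x_{σ(i+m)}, …, x_{σ(n+m-1)})`. -/
def comp (i : ℕ) (σ : Equiv.Perm ℕ) (α β : OpTree X) : OpTree X :=
  α.graft fun j =>
    if j < i then leaf (σ j)
    else if j = i then β.relabel fun l => σ (i + l - 1)
    else leaf (σ (j + β.arity - 1))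

/-- Insertion of `γ` into the context formed by the tree `C`, whose leaf `0` is a hole, and the
trees `s 1, s 2, …` that are grafted on the leaves `1, 2, …` of `γ`. -/
def plug (C : OpTree X) (s : ℕ → OpTree X) (γ : OpTree X) : OpTree X :=
  C.graft fun l => if l = 0 then γ.graft s else leaf l

/-- The context `(C, s)` exhibits an occurrence of the tree monomial `β` in the tree monomial `α`:
`α` is obtained by grafting `β` into the only hole of `C`, and `s 1, …, s n` on the leaves of `β`,
where the smallest leaves of `s 1, …, s n` increase.  So `β` is the monomial that corresponds to the
subtree of `α` which remains after `C` and the `s j` are cut off, its leaves being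
numbered according to their smallest descendants.  The operation `m_{α,β}` of replacing this subtree
is then `plug C s`. -/
structure IsOccurrence (β α C : OpTree X) (s : ℕ → OpTree X) : Prop where
  left : β.IsMonomial
  right : α.IsMonomial
  hole : C.leaves.count 0 = 1
  mono : StrictMonoOn (fun j => (s j).minLeaf) (Set.Icc 1 β.arity)
  eq : plug C s β = α

/-- `α` is divisible by `β`. -/
def Divides (β α : OpTree X) : Prop := ∃ C s, IsOccurrence β α C s

/-- Admissible orderings `lt` of the tree monomials: total orderings such that monomials of smaller
arity are smaller, and which are compatible with elementary shuffle compositions. (The values of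
`lt` on trees which are not tree monomials are irrelevant.) -/
structure IsAdmissible (lt : OpTree X → OpTree X → Prop) : Prop where
  irrefl : ∀ α, IsMonomial α → ¬ lt α α
  trans : ∀ α β γ, IsMonomial α → IsMonomial β → IsMonomial γ → lt α β → lt β γ → lt α γ
  total : ∀ α β, IsMonomial α → IsMonomial β → lt α β ∨ α = β ∨ lt β α
  arity : ∀ α β, IsMonomial α → IsMonomial β → α.arity < β.arity → lt α β
  comp : ∀ α α' β β', IsMonomial α → IsMonomial α' → IsMonomial β → IsMonomial β' →
    α.arity = α'.arity → β.arity = β'.arity → (lt α α' ∨ α = α') → (lt β β' ∨ β = β') →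
    ∀ i σ, IsShufflePerm α.arity β.arity i σ →
      lt (comp i σ α β) (comp i σ α' β') ∨ comp i σ α β = comp i σ α' β'

end OpTree

namespace ShuffleOperad

open OpTree

variable {k : Type*} [Field k] {X : ℕ → Type*}

/-- The component `F_V(n)` of the free shuffle operad: linear combinations of tree monomials with
`n` leaves.  The components are realised as subspaces of the space of all formal linear combinations
of trees. -/
def free (k : Type*) [Field k] (X : ℕ → Type*) (n : ℕ) : Submodule k (OpTree X →₀ k) :=
  Finsupp.supported k k {t | IsMonomial t ∧ t.arity = n}

/-- A set of homogeneous elements of the free operad. -/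
def IsHomogeneousSet (K : Set (OpTree X →₀ k)) : Prop := ∀ f ∈ K, ∃ n, f ∈ free k X n

/-- Bilinear extension of the elementary composition. -/
noncomputable def compLin (i : ℕ) (σ : Equiv.Perm ℕ) (f g : OpTree X →₀ k) : OpTree X →₀ k :=
  f.sum fun α a => g.sum fun β b => Finsupp.single (comp i σ α β) (a * b)

/-- Operadic (shuffle) ideals of the free shuffle operad. -/
structure IsShuffleIdeal (M : ℕ → Submodule k (OpTree X →₀ k)) : Prop where
  le_free : ∀ n, M n ≤ free k X n
  comp_left : ∀ n m i σ, IsShufflePerm n m i σ → ∀ f ∈ M n, ∀ g ∈ free k X m,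
    compLin i σ f g ∈ M (n + m - 1)
  comp_right : ∀ n m i σ, IsShufflePerm n m i σ → ∀ f ∈ free k X n, ∀ g ∈ M m,
    compLin i σ f g ∈ M (n + m - 1)

/-- `M` contains the set `K` of homogeneous elements. -/
def ContainsSet (M : ℕ → Submodule k (OpTree X →₀ k)) (K : Set (OpTree X →₀ k)) : Prop :=
  ∀ n, ∀ f ∈ K, f ∈ free k X n → f ∈ M n

/-- `M` is the shuffle ideal generated by `K`: the smallest shuffle ideal containing `K`. -/
def GeneratesShuffleIdeal (K : Set (OpTree X →₀ k)) (M : ℕ → Submodule k (OpTree X →₀ k)) : Prop :=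
  IsLeast {N : ℕ → Submodule k (OpTree X →₀ k) | IsShuffleIdeal N ∧ ContainsSet N K} M

/-- `α` is the leading term of `f`. (Zero has none.) -/
def IsLeadingTerm (lt : OpTree X → OpTree X → Prop) (f : OpTree X →₀ k) (α : OpTree X) : Prop :=
  α ∈ f.support ∧ ∀ β ∈ f.support, β ≠ α → lt β α

/-- `G` is a Gröbner basis of the ideal `M`: a system of homogeneous generators of `M` such that the
leading term of every nonzero `f ∈ M = ⨁ M(n)` is divisible by the leading term of an element of
`G`. -/
structure IsGroebnerBasis (lt : OpTree X → OpTree X → Prop)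
    (M : ℕ → Submodule k (OpTree X →₀ k)) (G : Set (OpTree X →₀ k)) : Prop where
  homogeneous : IsHomogeneousSet G
  generates : GeneratesShuffleIdeal G M
  divides : ∀ f ∈ ⨆ n, M n, f ≠ 0 →
    ∃ α, IsLeadingTerm lt f α ∧ ∃ g ∈ G, ∃ β, IsLeadingTerm lt g β ∧ Divides β α

/-- `h` is obtained from `f` by cancelling the term of `f` at the tree monomial `α` by means of a
multiple of `g`: `h = f - (c/c_g) m_{α,lt(g)}(g)` with `c` the coefficient of `α` in `f`. -/
def CancelsAt (lt : OpTree X → OpTree X → Prop) (g f : OpTree X →₀ k) (α : OpTree X)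
    (h : OpTree X →₀ k) : Prop :=
  α ∈ f.support ∧ ∃ β, IsLeadingTerm lt g β ∧ ∃ C s, IsOccurrence β α C s ∧
    h = f - (f α / g β) • Finsupp.mapDomain (plug C s) g

/-- `h` is a reduction `r_g(f)` of `f` modulo `g`: the leading term of `f` is cancelled. -/
def IsReduction (lt : OpTree X → OpTree X → Prop) (g f h : OpTree X →₀ k) : Prop :=
  ∃ α, IsLeadingTerm lt f α ∧ CancelsAt lt g f α h

/-- `h` is an `S`-polynomial `s_γ(f,g)`, for a small common multiple `γ` of the leading terms. -/
def IsSPolynomial (lt : OpTree X → OpTree X → Prop) (f g h : OpTree X →₀ k) : Prop :=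
  ∃ α β γ, IsLeadingTerm lt f α ∧ IsLeadingTerm lt g β ∧ γ.size < α.size + β.size ∧
    ∃ C s D t, IsOccurrence α γ C s ∧ IsOccurrence β γ D t ∧
      h = Finsupp.mapDomain (plug C s) f - (f α / g β) • Finsupp.mapDomain (plug D t) g

/-- All reductions of elements of `K` modulo elements of `K`, and all their `S`-polynomials. -/
def critical (lt : OpTree X → OpTree X → Prop) (K : Set (OpTree X →₀ k)) : Set (OpTree X →₀ k) :=
  {h | ∃ f ∈ K, ∃ g ∈ K, IsReduction lt g f h ∨ IsSPolynomial lt f g h}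

/-- `h` is a reduced form of `f` modulo `K`: it is obtained from `f` by finitely many reductions
modulo elements of `K`, and it has no further reductions modulo elements of `K`.  In
the course of the computation it is allowed, but not required, to reduce nonleading terms as well. -/
def IsReducedForm (lt : OpTree X → OpTree X → Prop) (K : Set (OpTree X →₀ k))
    (f h : OpTree X →₀ k) : Prop :=
  Relation.ReflTransGen (fun p q => ∃ g ∈ K, ∃ α, CancelsAt lt g p α q) f h ∧
    ¬ ∃ g ∈ K, ∃ q, IsReduction lt g h q

/-- One round of Buchberger's algorithm: a set `R` is computed which consists of reduced forms
modulo `K` of the reductions and `S`-polynomials of `K`, at least one for each of them; the nonzero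
elements of `R` are joined to `K`. -/
def IsBuchbergerStep (lt : OpTree X → OpTree X → Prop) (K K' : Set (OpTree X →₀ k)) : Prop :=
  ∃ R : Set (OpTree X →₀ k),
    (∀ f ∈ critical lt K, ∃ h ∈ R, IsReducedForm lt K f h) ∧
    (∀ h ∈ R, ∃ f ∈ critical lt K, IsReducedForm lt K f h) ∧
    K' = K ∪ (R \ {0})

/-- `G` is a (possibly infinite) output of Buchberger's algorithm with the input `K`: the union of
the sets obtained by repeating the step.  If some round joins no nonzero element, the same set can
be repeated for ever, so that outputs of runs which halt are included. -/
def IsBuchbergerOutput (lt : OpTree X → OpTree X → Prop) (K G : Set (OpTree X →₀ k)) : Prop :=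
  ∃ S : ℕ → Set (OpTree X →₀ k), S 0 = K ∧ (∀ i, IsBuchbergerStep lt (S i) (S (i + 1))) ∧
    G = ⋃ i, S i

/-! ### Symmetric operads

`ρ` is the structure of a symmetric collection on `V`, given in the bases `X`; `ρ σ μ` is the
operation `(a_1, …, a_n) ↦ μ(a_{σ(1)}, …, a_{σ(n)})`.  The free symmetric operad generated
by `V` is realised on the tree monomials. -/

/-- The expansion of an arbitrary decorated planar tree with distinct leaf labels through trees in
canonical planar form: the inputs of each vertex are sorted, at the expense of
acting on its decoration. -/
noncomputable def shuffleForm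
    (ρ : ∀ n : ℕ, Representation k (Equiv.Perm (Fin (n + 1))) (X (n + 1) →₀ k)) :
    OpTree X → (OpTree X →₀ k)
  | leaf l => Finsupp.single (leaf l) 1
  | @node _ n x c =>
    let τ : Equiv.Perm (Fin (n + 1)) := Tuple.sort fun j => (c j).minLeaf
    (ρ n τ⁻¹ (Finsupp.single x 1)).sum fun y a =>
      ∑ u ∈ Fintype.piFinset fun j => (shuffleForm ρ (c (τ j))).support,
        Finsupp.single (node y u) (a * ∏ j, shuffleForm ρ (c (τ j)) (u j))

/-- The action of a permutation on the free symmetric operad: the operation `f(a_1, …, a_n)` is sent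
to `f(a_{σ(1)}, …, a_{σ(n)})`. -/
noncomputable def symAct
    (ρ : ∀ n : ℕ, Representation k (Equiv.Perm (Fin (n + 1))) (X (n + 1) →₀ k))
    (σ : Equiv.Perm ℕ) (f : OpTree X →₀ k) : OpTree X →₀ k :=
  f.sum fun t a => a • shuffleForm ρ (t.relabel σ)

/-- The elementary symmetric composition in the free symmetric operad. -/
noncomputable def symComp
    (ρ : ∀ n : ℕ, Representation k (Equiv.Perm (Fin (n + 1))) (X (n + 1) →₀ k))
    (i : ℕ) (σ : Equiv.Perm ℕ) (f g : OpTree X →₀ k) : OpTree X →₀ k :=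
  f.sum fun α a => g.sum fun β b => (a * b) • shuffleForm ρ (comp i σ α β)

/-- Operadic ideals of the free symmetric operad. -/
structure IsSymmetricIdeal
    (ρ : ∀ n : ℕ, Representation k (Equiv.Perm (Fin (n + 1))) (X (n + 1) →₀ k))
    (M : ℕ → Submodule k (OpTree X →₀ k)) : Prop where
  le_free : ∀ n, M n ≤ free k X n
  act : ∀ n σ, IsPermOf n σ → ∀ f ∈ M n, symAct ρ σ f ∈ M n
  comp_left : ∀ n m i σ, 1 ≤ i → i ≤ n → IsPermOf (n + m - 1) σ →
    ∀ f ∈ M n, ∀ g ∈ free k X m, symComp ρ i σ f g ∈ M (n + m - 1)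
  comp_right : ∀ n m i σ, 1 ≤ i → i ≤ n → IsPermOf (n + m - 1) σ →
    ∀ f ∈ free k X n, ∀ g ∈ M m, symComp ρ i σ f g ∈ M (n + m - 1)

/-- `M` is the symmetric operadic ideal generated by `K`. -/
def GeneratesSymmetricIdeal
    (ρ : ∀ n : ℕ, Representation k (Equiv.Perm (Fin (n + 1))) (X (n + 1) →₀ k))
    (K : Set (OpTree X →₀ k)) (M : ℕ → Submodule k (OpTree X →₀ k)) : Prop :=
  IsLeast {N : ℕ → Submodule k (OpTree X →₀ k) | IsSymmetricIdeal ρ N ∧ ContainsSet N K} M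

/-- `K` extended by all the results of the symmetric group actions on its elements. -/
def symExtend
    (ρ : ∀ n : ℕ, Representation k (Equiv.Perm (Fin (n + 1))) (X (n + 1) →₀ k))
    (K : Set (OpTree X →₀ k)) : Set (OpTree X →₀ k) :=
  K ∪ {h | ∃ n, ∃ f ∈ K, f ∈ free k X n ∧ ∃ σ, IsPermOf n σ ∧ h = symAct ρ σ f}

end ShuffleOperad

/-! For a set `G` of homogeneous elements, the replacements of `lt(g)` by `g` inside a tree monomial
`δ`, with `g` in `G`, are the multiples with leading monomial `δ` (`IsMultiple`). They span a
shuffle ideal containing `G` (`isShuffleIdeal_multSpan`), because composing with a tree monomial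
only enlarges the context. Conversely, replacement in a context is built from elementary
compositions and increasing renamings of leaves (`isOperation_plug`). Hence ideals are closed under
it, and admissibility together with injectivity makes it strictly increasing
(`IsOccurrence.plug_lt`).

The core is Buchberger's criterion. Two multiples with the same leading monomial `γ` agree, up to a
scalar, modulo multiples with leading monomials below `γ` (`IsMultiple.sub_mem`). Indeed, two
subtrees of `γ` either share a vertex or can be replaced independently (`overlap_or_independent`).
If they share a vertex, their union has fewer vertices than the two have in total, and the
difference is an S-polynomial placed in a context. Otherwise a double sum, evaluated in two orders,
gives the claim (`independent_sub_mem`). Now let `f ≠ 0` be a combination of multiples with leading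
monomials at most `γ`: either `γ` is the leading monomial of `f` and of a multiple, or the bound can
be lowered. Well-foundedness ends this descent (`exists_multiple_at_leadingTerm`). A leading term
without vertices is exceptional, but it divides every monomial. A reduction modulo an element with
any other leading term is an S-polynomial with `γ = lt(f)`, so the criterion only involves
S-polynomials.

As for the algorithm, reducing leading terms terminates by well-foundedness, and no step leaves a
shuffle ideal that contains the input. Any two elements of the output occur in a common round, and
the next round contains a reduced form of each of their S-polynomials, unless this form is zero. So
the criterion applies to the union.

In the symmetric case, `M` is the shuffle ideal generated by the extended input. Every symmetric
composition is a shuffle composition of images of the factors under symmetric groups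
(`exists_symComp_eq`). Hence, if a shuffle ideal `N` contains the extended input, the elements all
of whose images lie in `N` form a symmetric ideal (`isSymmetricIdeal_symCore`), and this ideal
contains `M`. -/

namespace OpTree

/-! ### Leaves, grafting and shuffle trees -/

variable {X : ℕ → Type*}

theorem mem_leaves_node {n : ℕ} {x : X (n + 1)} {c : Fin (n + 1) → OpTree X} {l : ℕ} :
    l ∈ (node x c).leaves ↔ ∃ j, l ∈ (c j).leaves := by
  simp only [leaves, List.mem_flatten, List.mem_ofFn]
  constructor
  · rintro ⟨_, ⟨j, rfl⟩, h⟩; exact ⟨j, h⟩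
  · rintro ⟨j, h⟩; exact ⟨_, ⟨j, rfl⟩, h⟩

@[simp] theorem mem_leaves_leaf {l m : ℕ} : l ∈ (leaf m : OpTree X).leaves ↔ l = m := by
  simp [leaves]

theorem coe_leaves_node {n : ℕ} (x : X (n + 1)) (c : Fin (n + 1) → OpTree X) :
    ((node x c).leaves : Multiset ℕ) = ∑ j, ((c j).leaves : Multiset ℕ) := by
  have key : ∀ L : List (List ℕ), ((L.flatten : List ℕ) : Multiset ℕ) =
      (L.map fun l : List ℕ => (l : Multiset ℕ)).sum := by
    intro L
    induction L with
    | nil => rfl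
    | cons a L ih => rw [List.flatten_cons, ← Multiset.coe_add, ih, List.map_cons, List.sum_cons]
  rw [leaves, key, List.map_ofFn, List.sum_ofFn]
  rfl

theorem count_leaves_node {n : ℕ} (x : X (n + 1)) (c : Fin (n + 1) → OpTree X) (a : ℕ) :
    (node x c).leaves.count a = ∑ j, (c j).leaves.count a := by
  rw [← Multiset.coe_count, coe_leaves_node, Multiset.count_sum']
  simp

theorem graft_congr {t : OpTree X} {s s' : ℕ → OpTree X} (h : ∀ l ∈ t.leaves, s l = s' l) :
    t.graft s = t.graft s' := by
  induction t with
  | leaf l => exact h l (by simp)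
  | node x c ih =>
    simp only [graft]
    congr 1
    funext j
    exact ih j fun l hl => h l (mem_leaves_node.2 ⟨j, hl⟩)

theorem graft_graft (t : OpTree X) (s w : ℕ → OpTree X) :
    (t.graft s).graft w = t.graft fun l => (s l).graft w := by
  induction t with
  | leaf l => rfl
  | node x c ih => simp only [graft, ih]

@[simp] theorem graft_leaf (t : OpTree X) : t.graft leaf = t := by
  induction t with
  | leaf l => rfl
  | node x c ih => simp only [graft, ih]

theorem graft_inj_on {t : OpTree X} {s s' : ℕ → OpTree X} (h : t.graft s = t.graft s') :
    ∀ l ∈ t.leaves, s l = s' l := by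
  induction t with
  | leaf m => intro l hl; rw [mem_leaves_leaf] at hl; subst hl; exact h
  | node x c ih =>
    intro l hl
    obtain ⟨j, hj⟩ := mem_leaves_node.1 hl
    simp only [graft, node.injEq, heq_eq_eq, true_and] at h
    exact ih j (congrFun h j) l hj

theorem coe_leaves_graft (t : OpTree X) (s : ℕ → OpTree X) :
    ((t.graft s).leaves : Multiset ℕ) =
      (t.leaves : Multiset ℕ).bind fun l => ((s l).leaves : Multiset ℕ) := by
  induction t with
  | leaf l => simp [graft, leaves]
  | node x c ih =>
    rw [graft, coe_leaves_node, coe_leaves_node]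
    simp only [ih]
    have : ∀ S : Finset (Fin _), ∑ j ∈ S, ((c j).leaves : Multiset ℕ).bind
        (fun l => ((s l).leaves : Multiset ℕ)) =
        (∑ j ∈ S, ((c j).leaves : Multiset ℕ)).bind fun l => ((s l).leaves : Multiset ℕ) := by
      intro S
      induction S using Finset.induction_on with
      | empty => simp
      | insert a S ha ih => rw [Finset.sum_insert ha, Finset.sum_insert ha, Multiset.add_bind, ih]
    exact this _

theorem mem_leaves_graft {t : OpTree X} {s : ℕ → OpTree X} {l : ℕ} :
    l ∈ (t.graft s).leaves ↔ ∃ m ∈ t.leaves, l ∈ (s m).leaves := by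
  rw [← Multiset.mem_coe, coe_leaves_graft, Multiset.mem_bind]
  simp

theorem minLeaf_isLeast (t : OpTree X) : IsLeast {l | l ∈ t.leaves} t.minLeaf := by
  induction t with
  | leaf l => simp [minLeaf, IsLeast, lowerBounds]
  | node x c ih =>
    constructor
    · obtain ⟨j, -, hj⟩ := Finset.exists_mem_eq_inf' Finset.univ_nonempty fun j => (c j).minLeaf
      simp only [Set.mem_ofPred_eq, minLeaf]
      rw [hj]
      exact mem_leaves_node.2 ⟨j, (ih j).1⟩
    · intro l hl
      obtain ⟨j, hj⟩ := mem_leaves_node.1 hl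
      exact (Finset.inf'_le _ (Finset.mem_univ j)).trans ((ih j).2 hj)

theorem minLeaf_mem (t : OpTree X) : t.minLeaf ∈ t.leaves := (minLeaf_isLeast t).1

theorem minLeaf_le {t : OpTree X} {l : ℕ} (h : l ∈ t.leaves) : t.minLeaf ≤ l :=
  (minLeaf_isLeast t).2 h

theorem minLeaf_congr {t t' : OpTree X} (h : (t.leaves : Multiset ℕ) = t'.leaves) :
    t.minLeaf = t'.minLeaf := by
  have h' : {l | l ∈ t.leaves} = {l | l ∈ t'.leaves} := by
    ext l
    rw [Set.mem_ofPred_eq, Set.mem_ofPred_eq, ← Multiset.mem_coe, h, Multiset.mem_coe]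
  have h1 := minLeaf_isLeast t
  rw [h'] at h1
  exact h1.unique (minLeaf_isLeast t')

/-- Of each grafted tree only the smallest leaf matters, so questions about minima in a graft reduce
to relabellings. -/
theorem minLeaf_graft (t : OpTree X) (s : ℕ → OpTree X) :
    (t.graft s).minLeaf = (t.relabel fun l => (s l).minLeaf).minLeaf := by
  unfold relabel
  induction t with
  | leaf l => rfl
  | node x c ih => simp only [graft, minLeaf, ih]

theorem minLeaf_graft_of_monotoneOn {t : OpTree X} {s : ℕ → OpTree X}
    (h : MonotoneOn (fun l => (s l).minLeaf) {l | l ∈ t.leaves}) :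
    (t.graft s).minLeaf = (s t.minLeaf).minLeaf := by
  apply le_antisymm
  · exact minLeaf_le (mem_leaves_graft.2 ⟨_, minLeaf_mem t, minLeaf_mem _⟩)
  · obtain ⟨m, hm, hl⟩ := mem_leaves_graft.1 (minLeaf_mem (t.graft s))
    exact (h (minLeaf_mem t) hm (minLeaf_le hm)).trans (minLeaf_le hl)

theorem minLeaf_graft_of_eq {t : OpTree X} {s : ℕ → OpTree X}
    (h : ∀ l ∈ t.leaves, (s l).minLeaf = l) : (t.graft s).minLeaf = t.minLeaf := by
  rw [minLeaf_graft_of_monotoneOn, h _ (minLeaf_mem t)]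
  intro a ha b hb hab
  simpa only [h a ha, h b hb] using hab

theorem minLeaf_relabel {t : OpTree X} {φ : ℕ → ℕ} (h : MonotoneOn φ {l | l ∈ t.leaves}) :
    (t.relabel φ).minLeaf = φ t.minLeaf :=
  minLeaf_graft_of_monotoneOn h

/-- The condition at a vertex of `t` only sees the minima of the grafted trees; the remaining
conditions concern vertices inside these trees. -/
theorem isShuffle_graft {t : OpTree X} {s : ℕ → OpTree X} :
    (t.graft s).IsShuffle ↔
      (t.relabel fun l => (s l).minLeaf).IsShuffle ∧ ∀ l ∈ t.leaves, (s l).IsShuffle := by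
  induction t with
  | leaf l => simp [relabel, graft, IsShuffle, leaves]
  | node x c ih =>
    have e : ∀ j, ((c j).graft s).minLeaf =
        ((c j).graft fun l => leaf ((s l).minLeaf) : OpTree X).minLeaf := fun j => minLeaf_graft _ _
    simp only [relabel, graft, IsShuffle, mem_leaves_node] at ih ⊢
    simp only [ih, e]
    constructor
    · rintro ⟨h1, h2⟩
      exact ⟨⟨fun j => (h1 j).1, h2⟩, fun l ⟨j, hl⟩ => (h1 j).2 l hl⟩
    · rintro ⟨⟨h1, h2⟩, h3⟩
      exact ⟨fun j => ⟨h1 j, fun l hl => h3 l ⟨j, hl⟩⟩, h2⟩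

theorem isShuffle_relabel {t : OpTree X} {φ : ℕ → ℕ} (h : StrictMonoOn φ {l | l ∈ t.leaves}) :
    (t.relabel φ).IsShuffle ↔ t.IsShuffle := by
  induction t with
  | leaf l => simp [relabel, graft, IsShuffle]
  | node x c ih =>
    have hj : ∀ j, StrictMonoOn φ {l | l ∈ (c j).leaves} := fun j =>
      h.mono fun l hl => mem_leaves_node.2 ⟨j, hl⟩
    have e : ∀ j, ((c j).graft fun l => leaf (φ l) : OpTree X).minLeaf = φ (c j).minLeaf := fun j =>
      minLeaf_relabel (hj j).monotoneOn
    have ih' : ∀ j, ((c j).graft fun l => leaf (φ l) : OpTree X).IsShuffle ↔ (c j).IsShuffle :=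
      fun j => ih j (hj j)
    simp only [relabel, graft, IsShuffle, ih', e]
    refine and_congr_right fun _ => ?_
    have hm : ∀ j, (c j).minLeaf ∈ {l | l ∈ (node x c).leaves} := fun j =>
      mem_leaves_node.2 ⟨j, minLeaf_mem _⟩
    exact ⟨fun H i j hij => (h.lt_iff_lt (hm i) (hm j)).1 (H hij),
      fun H i j hij => (h.lt_iff_lt (hm i) (hm j)).2 (H hij)⟩

theorem relabel_relabel (t : OpTree X) (φ ψ : ℕ → ℕ) :
    (t.relabel φ).relabel ψ = t.relabel (ψ ∘ φ) := graft_graft _ _ _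

theorem relabel_congr {t : OpTree X} {φ ψ : ℕ → ℕ} (h : ∀ l ∈ t.leaves, φ l = ψ l) :
    t.relabel φ = t.relabel ψ := graft_congr fun l hl => by rw [h l hl]

theorem relabel_eq_self {t : OpTree X} {φ : ℕ → ℕ} (h : ∀ l ∈ t.leaves, φ l = l) :
    t.relabel φ = t := by
  rw [relabel, graft_congr (s' := leaf) fun l hl => by rw [h l hl], graft_leaf]

theorem coe_leaves_relabel (t : OpTree X) (φ : ℕ → ℕ) :
    ((t.relabel φ).leaves : Multiset ℕ) = (t.leaves : Multiset ℕ).map φ := by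
  rw [relabel, coe_leaves_graft]
  simp only [leaves, Multiset.coe_singleton, Multiset.bind_singleton]

theorem mem_leaves_relabel {t : OpTree X} {φ : ℕ → ℕ} {l : ℕ} :
    l ∈ (t.relabel φ).leaves ↔ ∃ m ∈ t.leaves, φ m = l := by
  rw [relabel, mem_leaves_graft]
  simp [eq_comm]

theorem size_relabel (t : OpTree X) (φ : ℕ → ℕ) : (t.relabel φ).size = t.size := by
  unfold relabel
  induction t with
  | leaf l => rfl
  | node x c ih => simp only [graft, size, ih]

theorem size_le_graft (t : OpTree X) (s : ℕ → OpTree X) : t.size ≤ (t.graft s).size := by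
  induction t with
  | leaf m => simp [size]
  | node x c ih =>
    simp only [graft, size]
    have := Finset.sum_le_sum fun j (_ : j ∈ Finset.univ) => ih j
    omega

theorem size_add_size_le_graft {t : OpTree X} {s : ℕ → OpTree X} {l : ℕ} (h : l ∈ t.leaves) :
    t.size + (s l).size ≤ (t.graft s).size := by
  induction t with
  | leaf m => rw [mem_leaves_leaf] at h; subst h; simp [graft, size]
  | node x c ih =>
    obtain ⟨j, hj⟩ := mem_leaves_node.1 h
    simp only [graft, size]
    rw [add_assoc]
    gcongr
    rw [← Finset.add_sum_erase _ _ (Finset.mem_univ j),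
      ← Finset.add_sum_erase _ (fun i => ((c i).graft s).size) (Finset.mem_univ j)]
    have h1 := ih j hj
    have h2 : ∑ i ∈ Finset.univ.erase j, (c i).size ≤
      ∑ i ∈ Finset.univ.erase j, ((c i).graft s).size :=
        Finset.sum_le_sum fun i _ => size_le_graft _ _
    omega

theorem size_eq_zero_iff {t : OpTree X} : t.size = 0 ↔ ∃ l, t = leaf l := by
  cases t <;> simp [size]

/-- The only danger is that a leaf `l` of one tree faces a larger part `u` of the other, with `s l =
u.graft s`. Disjointness forces all leaves of `u` to be `l`, and counting vertices then leaves none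
for `u`. -/
theorem graft_left_injective {t t' : OpTree X} {s : ℕ → OpTree X}
    (hd : ∀ l ∈ t.leaves, ∀ l' ∈ t'.leaves, l ≠ l' → List.Disjoint (s l).leaves (s l').leaves)
    (h : t.graft s = t'.graft s) : t = t' := by
  have key : ∀ (l : ℕ) (u : OpTree X),
      (∀ l' ∈ u.leaves, l ≠ l' → List.Disjoint (s l).leaves (s l').leaves) →
      s l = u.graft s → u = leaf l := by
    intro l u hd h
    have hl : ∀ l' ∈ u.leaves, l' = l := by
      intro l' hl'
      by_contra hne
      refine hd l' hl' (Ne.symm hne) ?_ (minLeaf_mem (s l'))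
      rw [h]
      exact mem_leaves_graft.2 ⟨l', hl', minLeaf_mem _⟩
    have h1 := hl _ (minLeaf_mem u)
    have h2 := size_add_size_le_graft (s := s) (minLeaf_mem u)
    rw [h1, ← h] at h2
    obtain ⟨m, rfl⟩ := size_eq_zero_iff.1 (show u.size = 0 by omega)
    rw [hl m (by simp)]
  induction t generalizing t' with
  | leaf l => exact (key l t' (fun l' hl' => hd l (by simp) l' hl') h).symm
  | @node n x c ih =>
    cases t' with
    | leaf l' =>
      refine key l' _ (fun l hl hne => (hd l hl l' (by simp) hne.symm).symm) h.symm
    | @node n' x' c' =>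
      simp only [graft, node.injEq] at h
      obtain ⟨rfl, hx, hc⟩ := h
      simp only [heq_eq_eq] at hx hc
      subst hx
      congr 1
      funext j
      refine ih j (fun l hl l' hl' => hd l (mem_leaves_node.2 ⟨j, hl⟩) l'
        (mem_leaves_node.2 ⟨j, hl'⟩)) (congrFun hc j)

/-- Shuffle trees whose leaves are labelled bijectively by the elements of `B`. -/
def IsTreeOn (B : Finset ℕ) (t : OpTree X) : Prop :=
  t.IsShuffle ∧ (t.leaves : Multiset ℕ) = B.val

theorem IsTreeOn.mem_iff {B : Finset ℕ} {t : OpTree X} (h : IsTreeOn B t) {l : ℕ} :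
    l ∈ t.leaves ↔ l ∈ B := by
  rw [← Multiset.mem_coe, h.2]; rfl

theorem IsTreeOn.setOf_eq {B : Finset ℕ} {t : OpTree X} (h : IsTreeOn B t) :
    {l | l ∈ t.leaves} = B := by
  ext l; exact h.mem_iff

theorem IsTreeOn.nodup {B : Finset ℕ} {t : OpTree X} (h : IsTreeOn B t) : t.leaves.Nodup := by
  rw [← Multiset.coe_nodup, h.2]; exact B.nodup

theorem IsTreeOn.arity_eq {B : Finset ℕ} {t : OpTree X} (h : IsTreeOn B t) :
    t.arity = B.card := by
  have := congrArg Multiset.card h.2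
  simpa [OpTree.arity] using this

theorem isTreeOn_toFinset {t : OpTree X} (h : t.IsShuffle) (hn : t.leaves.Nodup) :
    IsTreeOn t.leaves.toFinset t := by
  refine ⟨h, ?_⟩
  rw [List.toFinset_val, hn.dedup]

theorem isMonomial_and_arity_iff {n : ℕ} {t : OpTree X} :
    IsMonomial t ∧ t.arity = n ↔ IsTreeOn (Finset.Icc 1 n) t := by
  constructor
  · rintro ⟨⟨h1, h2⟩, rfl⟩
    exact ⟨h1, Multiset.coe_eq_coe.2 h2⟩
  · intro h
    have ha : t.arity = n := by simpa using h.arity_eq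
    refine ⟨⟨h.1, ?_⟩, ha⟩
    rw [ha]
    exact Multiset.coe_eq_coe.1 h.2

theorem IsMonomial.isTreeOn {t : OpTree X} (h : IsMonomial t) :
    IsTreeOn (Finset.Icc 1 t.arity) t := isMonomial_and_arity_iff.1 ⟨h, rfl⟩

theorem IsTreeOn.isMonomial {n : ℕ} {t : OpTree X} (h : IsTreeOn (Finset.Icc 1 n) t) :
    IsMonomial t := (isMonomial_and_arity_iff.2 h).1

theorem IsTreeOn.arity {n : ℕ} {t : OpTree X} (h : IsTreeOn (Finset.Icc 1 n) t) :
    t.arity = n := (isMonomial_and_arity_iff.2 h).2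

theorem isTreeOn_graft {B : Finset ℕ} {t : OpTree X} {s : ℕ → OpTree X} (ht : IsTreeOn B t)
    (hm : StrictMonoOn (fun l => (s l).minLeaf) B) (hs : ∀ l ∈ B, (s l).IsShuffle)
    (hn : ∀ l ∈ B, (s l).leaves.Nodup)
    (hd : ∀ l ∈ B, ∀ l' ∈ B, l ≠ l' → List.Disjoint (s l).leaves (s l').leaves) :
    IsTreeOn (B.biUnion fun l => (s l).leaves.toFinset) (t.graft s) := by
  refine ⟨isShuffle_graft.2 ⟨(isShuffle_relabel ?_).2 ht.1, fun l hl => hs l (ht.mem_iff.1 hl)⟩, ?_⟩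
  · rw [ht.setOf_eq]; exact hm
  · rw [coe_leaves_graft, ht.2]
    refine (Multiset.Nodup.ext ?_ (Finset.nodup _)).2 ?_
    · rw [Multiset.nodup_bind]
      refine ⟨fun l hl => Multiset.coe_nodup.2 (hn l hl), ?_⟩
      refine Multiset.Nodup.pairwise ?_ B.nodup
      intro a ha b hb hab
      exact Multiset.coe_disjoint _ _ |>.2 (hd a ha b hb hab)
    · intro a
      simp

theorem isTreeOn_relabel {B : Finset ℕ} {t : OpTree X} {φ : ℕ → ℕ} (ht : IsTreeOn B t)
    (hm : StrictMonoOn φ B) : IsTreeOn (B.image φ) (t.relabel φ) := by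
  refine ⟨(isShuffle_relabel (by rwa [ht.setOf_eq])).2 ht.1, ?_⟩
  rw [coe_leaves_relabel, ht.2, Finset.image_val_of_injOn hm.injOn]

end OpTree

/-! ### Standardisation of labels and elementary compositions -/

namespace OpTree

variable {X : ℕ → Type*}

/-- The position of `l` in the increasing enumeration of `A`, starting from `1`. -/
def rank (A : Finset ℕ) (l : ℕ) : ℕ := Nat.count (· ∈ A) l + 1

/-- The `j`-th element of `A`, counting from `1`. -/
noncomputable def unrank (A : Finset ℕ) (j : ℕ) : ℕ := Nat.nth (· ∈ A) (j - 1)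

theorem unrank_rank {A : Finset ℕ} {l : ℕ} (h : l ∈ A) : unrank A (rank A l) = l := by
  simp [unrank, rank, Nat.nth_count (p := (· ∈ A)) h]

theorem lt_card_of_mem_Icc {A : Finset ℕ} {j : ℕ} (h : j ∈ Finset.Icc 1 A.card) :
    ∀ hf : (Set.ofPred (· ∈ A)).Finite, j - 1 < hf.toFinset.card := by
  intro hf
  have : hf.toFinset = A := by ext; rw [Set.Finite.mem_toFinset]; rfl
  rw [this]
  rw [Finset.mem_Icc] at h
  omega

theorem unrank_mem {A : Finset ℕ} {j : ℕ} (h : j ∈ Finset.Icc 1 A.card) : unrank A j ∈ A :=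
  Nat.nth_mem (p := (· ∈ A)) _ (lt_card_of_mem_Icc h)

theorem rank_unrank {A : Finset ℕ} {j : ℕ} (h : j ∈ Finset.Icc 1 A.card) :
    rank A (unrank A j) = j := by
  rw [rank, unrank, Nat.count_nth (lt_card_of_mem_Icc h)]
  rw [Finset.mem_Icc] at h
  omega

theorem rank_strictMonoOn (A : Finset ℕ) : StrictMonoOn (rank A) A := by
  intro a ha b _ hab
  exact Nat.succ_lt_succ (Nat.count_strict_mono (p := (· ∈ A)) ha hab)

theorem unrank_strictMonoOn (A : Finset ℕ) : StrictMonoOn (unrank A) (Finset.Icc 1 A.card) := by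
  intro a ha b hb hab
  have h := (rank_strictMonoOn A).lt_iff_lt (unrank_mem ha) (unrank_mem hb)
  rw [rank_unrank ha, rank_unrank hb] at h
  exact h.1 hab

theorem rank_mem {A : Finset ℕ} {l : ℕ} (h : l ∈ A) : rank A l ∈ Finset.Icc 1 A.card := by
  rw [Finset.mem_Icc, rank]
  refine ⟨by omega, ?_⟩
  have := Nat.count_lt_card (p := (· ∈ A)) A.finite_toSet h
  simpa using this

theorem image_rank (A : Finset ℕ) : A.image (rank A) = Finset.Icc 1 A.card := by
  ext j
  rw [Finset.mem_image]
  exact ⟨fun ⟨l, hl, e⟩ => e ▸ rank_mem hl, fun h => ⟨_, unrank_mem h, rank_unrank h⟩⟩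

theorem image_unrank (A : Finset ℕ) : (Finset.Icc 1 A.card).image (unrank A) = A := by
  ext j
  rw [Finset.mem_image]
  exact ⟨fun ⟨l, hl, e⟩ => e ▸ unrank_mem hl, fun h => ⟨_, rank_mem h, unrank_rank h⟩⟩

theorem rank_Icc {n l : ℕ} (h : l ∈ Finset.Icc 1 n) : rank (Finset.Icc 1 n) l = l := by
  rw [Finset.mem_Icc] at h
  rw [rank, Nat.count_eq_card_filter_range]
  have : (Finset.range l).filter (· ∈ Finset.Icc 1 n) = Finset.Ico 1 l := by
    ext a; simp only [Finset.mem_filter, Finset.mem_range, Finset.mem_Icc, Finset.mem_Ico]; omega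
  rw [this, Nat.card_Ico]
  omega

theorem isTreeOn_relabel_rank {A : Finset ℕ} {t : OpTree X} (h : IsTreeOn A t) :
    IsTreeOn (Finset.Icc 1 A.card) (t.relabel (rank A)) := by
  rw [← image_rank]; exact isTreeOn_relabel h (rank_strictMonoOn A)

theorem isTreeOn_relabel_unrank {A : Finset ℕ} {t : OpTree X}
    (h : IsTreeOn (Finset.Icc 1 A.card) t) : IsTreeOn A (t.relabel (unrank A)) := by
  have := isTreeOn_relabel h (unrank_strictMonoOn A)
  rwa [image_unrank] at this

theorem relabel_rank_Icc {n : ℕ} {t : OpTree X} (h : IsTreeOn (Finset.Icc 1 n) t) :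
    t.relabel (rank (Finset.Icc 1 n)) = t :=
  relabel_eq_self fun _ hl => rank_Icc (h.mem_iff.1 hl)

theorem one_le_card {A : Finset ℕ} {t : OpTree X} (h : IsTreeOn A t) : 1 ≤ A.card :=
  Finset.card_pos.2 ⟨_, h.mem_iff.1 (minLeaf_mem t)⟩

theorem IsTreeOn.minLeaf_Icc {n : ℕ} {t : OpTree X} (h : IsTreeOn (Finset.Icc 1 n) t) :
    t.minLeaf = 1 := by
  have hn := one_le_card h
  rw [Nat.card_Icc] at hn
  refine (minLeaf_isLeast t).unique ⟨h.mem_iff.2 (Finset.mem_Icc.2 ⟨le_rfl, by omega⟩), ?_⟩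
  intro l hl
  exact (Finset.mem_Icc.1 (h.mem_iff.1 hl)).1

theorem IsShufflePerm.lt {n m i : ℕ} {σ : Equiv.Perm ℕ} (h : IsShufflePerm n m i σ) {j : ℕ}
    (h1 : i < j) (h2 : j < n + m) : i < σ j ∧ σ j < n + m := by
  -- Otherwise `σ` fixes `σ j`, hence `j` by injectivity, and `j` itself would lie outside the
  -- interval.
  by_contra hc
  have h3 := h.2.2.1 (σ j) (by rw [Finset.mem_Ico]; omega)
  rw [σ.injective h3] at hc
  exact hc ⟨h1, h2⟩

theorem IsShufflePerm.eq_of_le {n m i : ℕ} {σ : Equiv.Perm ℕ} (h : IsShufflePerm n m i σ) {j : ℕ}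
    (h1 : j ≤ i) : σ j = j := h.2.2.1 j (by rw [Finset.mem_Ico]; omega)

theorem IsShufflePerm.isPermOf {n m i : ℕ} {σ : Equiv.Perm ℕ} (h : IsShufflePerm n m i σ) :
    IsPermOf (n + m - 1) σ := by
  intro j hj
  have := h.1
  refine h.2.2.1 j ?_
  rw [Finset.mem_Icc] at hj
  rw [Finset.mem_Ico]
  omega

theorem IsPermOf.mem_iff {n : ℕ} {σ : Equiv.Perm ℕ} (h : IsPermOf n σ) {j : ℕ} :
    σ j ∈ Finset.Icc 1 n ↔ j ∈ Finset.Icc 1 n := by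
  constructor
  · intro h1
    by_contra hj
    rw [h j hj] at h1
    exact hj h1
  · intro h1
    by_contra hj
    rw [σ.injective (h _ hj)] at hj
    exact hj h1

/-- The trees that are grafted on the leaves of the first factor in an elementary composition. -/
def compSubst (i : ℕ) (σ : Equiv.Perm ℕ) (β : OpTree X) (j : ℕ) : OpTree X :=
  if j < i then leaf (σ j)
  else if j = i then β.relabel fun l => σ (i + l - 1)
  else leaf (σ (j + β.arity - 1))

theorem comp_eq_graft (i : ℕ) (σ : Equiv.Perm ℕ) (α β : OpTree X) :
    comp i σ α β = α.graft (compSubst i σ β) := rfl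

/-- A shuffle permutation fixes all labels up to `i`, and `i` becomes the smallest leaf of the
inserted tree. Everything after it stays above `i` and keeps its order. This is why elementary
compositions preserve canonical planar form. -/
theorem compSubst_strictMonoOn {n m i : ℕ} {σ : Equiv.Perm ℕ} (h : IsShufflePerm n m i σ)
    {β : OpTree X} (hβ : IsTreeOn (Finset.Icc 1 m) β) :
    StrictMonoOn (fun l => (compSubst i σ β l).minLeaf) (Finset.Icc 1 n : Finset ℕ) ∧
      (β.relabel fun l => σ (i + l - 1)).minLeaf = i ∧
      StrictMonoOn (fun l => σ (i + l - 1)) (Finset.Icc 1 m : Finset ℕ) := by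
  have hm : 1 ≤ m := by simpa using one_le_card hβ
  have hψ : StrictMonoOn (fun l => σ (i + l - 1)) (Finset.Icc 1 m : Finset ℕ) := by
    intro a ha b hb hab
    rw [Finset.coe_Icc, Set.mem_Icc] at ha hb
    show σ (i + a - 1) < σ (i + b - 1)
    rcases ha.1.eq_or_lt with rfl | ha'
    · rw [show i + 1 - 1 = i by omega, h.eq_of_le le_rfl]
      exact (h.lt (by omega) (by have := h.2.1; omega)).1
    · exact h.2.2.2.1 (by rw [Set.mem_Ico]; omega) (by rw [Set.mem_Ico]; omega) (by omega)
  have hmin : (β.relabel fun l => σ (i + l - 1)).minLeaf = i := by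
    rw [minLeaf_relabel (by rw [hβ.setOf_eq]; exact hψ.monotoneOn), hβ.minLeaf_Icc,
      show i + 1 - 1 = i by omega, h.eq_of_le le_rfl]
  refine ⟨?_, hmin, hψ⟩
  intro a ha b hb hab
  rw [Finset.coe_Icc, Set.mem_Icc] at ha hb
  simp only [compSubst, hβ.arity]
  rcases lt_trichotomy a i with h1 | h1 | h1
  · rw [if_pos h1]
    rcases lt_trichotomy b i with h2 | h2 | h2
    · rw [if_pos h2]
      simpa only [minLeaf, h.eq_of_le h1.le, h.eq_of_le h2.le] using hab
    · rw [if_neg (by omega), if_pos h2, hmin]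
      simpa only [minLeaf, h.eq_of_le h1.le] using h1
    · rw [if_neg (by omega), if_neg (by omega)]
      simp only [minLeaf, h.eq_of_le h1.le]
      have := (h.lt (j := b + m - 1) (by omega) (by omega)).1
      omega
  · rw [if_neg (by omega), if_pos h1, hmin, if_neg (by omega), if_neg (by omega)]
    exact (h.lt (j := b + m - 1) (by omega) (by omega)).1
  · rw [if_neg (by omega), if_neg (by omega), if_neg (by omega), if_neg (by omega)]
    exact h.2.2.2.2 (by rw [Set.mem_Ico]; omega) (by rw [Set.mem_Ico]; omega) (by omega)

theorem isTreeOn_comp {n m i : ℕ} {σ : Equiv.Perm ℕ} (h : IsShufflePerm n m i σ)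
    {α β : OpTree X} (hα : IsTreeOn (Finset.Icc 1 n) α) (hβ : IsTreeOn (Finset.Icc 1 m) β) :
    IsTreeOn (Finset.Icc 1 (n + m - 1)) (comp i σ α β) := by
  obtain ⟨hmono, hmin, hψ⟩ := compSubst_strictMonoOn h hβ
  have hm : 1 ≤ m := by simpa using one_le_card hβ
  have hi := h.1
  have hin := h.2.1
  have hβ' := isTreeOn_relabel hβ hψ
  have mem : ∀ j ∈ Finset.Icc 1 n, ∀ l, l ∈ (compSubst i σ β j).leaves ↔
      (j < i ∧ l = σ j) ∨ (j = i ∧ ∃ a ∈ Finset.Icc 1 m, σ (i + a - 1) = l) ∨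
        (i < j ∧ l = σ (j + m - 1)) := by
    intro j hj l
    simp only [compSubst, hβ.arity]
    rcases lt_trichotomy j i with h1 | h1 | h1
    · simp [h1, h1.not_gt, h1.ne]
    · simp only [h1, lt_irrefl, if_true, if_false, mem_leaves_relabel, hβ.mem_iff]
      simp
    · simp [h1, h1.not_gt, h1.ne']
  have key := isTreeOn_graft (s := compSubst i σ β) hα hmono ?_ ?_ ?_
  · rw [comp_eq_graft]
    convert key using 1
    ext x
    obtain ⟨y, rfl⟩ := σ.surjective x
    rw [h.isPermOf.mem_iff, Finset.mem_biUnion]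
    constructor
    · intro hy
      rw [Finset.mem_Icc] at hy
      rcases lt_or_ge y i with h1 | h1
      · refine ⟨y, by rw [Finset.mem_Icc]; omega,
          List.mem_toFinset.2 ((mem y ?_ _).2 (Or.inl ⟨h1, rfl⟩))⟩
        rw [Finset.mem_Icc]; omega
      rcases lt_or_ge y (i + m) with h2 | h2
      · refine ⟨i, by rw [Finset.mem_Icc]; omega,
          List.mem_toFinset.2 ((mem i ?_ _).2 (Or.inr (Or.inl ⟨rfl, y + 1 - i, ?_, ?_⟩)))⟩
        · rw [Finset.mem_Icc]; omega
        · rw [Finset.mem_Icc]; omega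
        · congr 1; omega
      · refine ⟨y + 1 - m, by rw [Finset.mem_Icc]; omega,
          List.mem_toFinset.2 ((mem _ ?_ _).2 (Or.inr (Or.inr ⟨by omega, ?_⟩)))⟩
        · rw [Finset.mem_Icc]; omega
        · congr 1; omega
    · rintro ⟨j, hj, hl⟩
      rw [List.mem_toFinset, mem j hj] at hl
      simp only [Finset.mem_Icc] at hj hl ⊢
      rcases hl with ⟨h1, e⟩ | ⟨h1, a, h1', e⟩ | ⟨h1, e⟩ <;> have := σ.injective e <;> omega
  · intro l hl
    unfold compSubst
    split_ifs
    · trivial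
    · exact hβ'.1
    · trivial
  · intro l hl
    unfold compSubst
    split_ifs
    · simp [leaves]
    · exact hβ'.nodup
    · simp [leaves]
  · intro a ha b hb hab x hx hy
    rw [mem a ha] at hx
    rw [mem b hb] at hy
    simp only [Finset.mem_Icc] at ha hb hx hy
    rcases hx with ⟨h1, rfl⟩ | ⟨h1, c, h1', rfl⟩ | ⟨h1, rfl⟩ <;>
      rcases hy with ⟨h2, e⟩ | ⟨h2, d, h2', e⟩ | ⟨h2, e⟩ <;>
      have := σ.injective e <;> omega

end OpTree

/-! ### Grafting at a leaf as an elementary composition -/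

namespace OpTree

variable {X : ℕ → Type*}

/-- A rank counts strictly smaller elements, and no element of `U` is strictly smaller than `l ≤ d`.
-/
theorem rank_union_of_le {A U : Finset ℕ} {d l : ℕ} (hmin : ∀ u ∈ U, d ≤ u) (h : l ≤ d) :
    rank (A ∪ U) l = rank A l := by
  rw [rank, rank, Nat.count_eq_card_filter_range, Nat.count_eq_card_filter_range]
  congr 2
  ext a
  simp only [Finset.mem_filter, Finset.mem_range, Finset.mem_union]
  constructor
  · rintro ⟨h1, h2 | h2⟩
    · exact ⟨h1, h2⟩
    · have := hmin a h2; omega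
  · rintro ⟨h1, h2⟩; exact ⟨h1, Or.inl h2⟩

theorem card_union_of_inter {A U : Finset ℕ} {d : ℕ} (hdA : d ∈ A) (hdU : d ∈ U)
    (hAU : ∀ l ∈ A, l ∈ U → l = d) : (A ∪ U).card = A.card + U.card - 1 := by
  have h1 : A ∩ U = {d} := by
    ext l
    rw [Finset.mem_inter, Finset.mem_singleton]
    exact ⟨fun h => hAU l h.1 h.2, fun h => h ▸ ⟨hdA, hdU⟩⟩
  have := Finset.card_union_add_card_inter A U
  rw [h1, Finset.card_singleton] at this
  omega

theorem exists_perm_of_injOn {N : ℕ} {v : ℕ → ℕ} (hm : ∀ j ∈ Finset.Icc 1 N, v j ∈ Finset.Icc 1 N)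
    (hi : Set.InjOn v (Finset.Icc 1 N : Finset ℕ)) :
    ∃ σ : Equiv.Perm ℕ, IsPermOf N σ ∧ ∀ j ∈ Finset.Icc 1 N, σ j = v j := by
  let f : {j // j ∈ Finset.Icc 1 N} → {j // j ∈ Finset.Icc 1 N} := fun j => ⟨v j, hm _ j.2⟩
  have hf : Function.Injective f := fun a b h =>
    Subtype.ext (hi a.2 b.2 (congrArg Subtype.val h))
  refine ⟨Equiv.Perm.ofSubtype (Equiv.ofBijective f (Finite.injective_iff_bijective.1 hf)), ?_, ?_⟩
  · intro j hj
    exact Equiv.Perm.ofSubtype_apply_of_not_mem _ hj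
  · intro j hj
    rw [Equiv.Perm.ofSubtype_apply_of_mem _ hj]
    rfl

/-- The numbering of leaves in a composition lists the part of `A` below `d`, then `U`, then the
part of `A` above `d`. The permutation sends each position in this list to the rank in `A ∪ U` of
the label found there. -/
theorem exists_isShufflePerm {A U : Finset ℕ} {d : ℕ} (hdA : d ∈ A) (hdU : d ∈ U)
    (hAU : ∀ l ∈ A, l ∈ U → l = d) (hmin : ∀ u ∈ U, d ≤ u) :
    ∃ σ, IsShufflePerm A.card U.card (rank A d) σ ∧
      (∀ l ∈ A, l < d → σ (rank A l) = rank (A ∪ U) l) ∧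
      (∀ l ∈ A, d < l → σ (rank A l + U.card - 1) = rank (A ∪ U) l) ∧
      ∀ u ∈ U, σ (rank A d + rank U u - 1) = rank (A ∪ U) u := by
  have hcard := card_union_of_inter hdA hdU hAU
  have hU1 : 1 ≤ U.card := Finset.card_pos.2 ⟨d, hdU⟩
  have hi := Finset.mem_Icc.1 (rank_mem hdA)
  set i := rank A d with hi_def
  have hdi : unrank A i = d := unrank_rank hdA
  -- The listing of `A ∪ U` just described. The element `d`, number `i` in `A`, is supplied by the
  -- first entry of `U`; so position `i + U.card` holds number `i + 1` of `A`.
  let e : ℕ → ℕ := fun j => if j < i then unrank A j else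
    if j < i + U.card then unrank U (j - i + 1) else unrank A (j - U.card + 1)
  have e1 : ∀ j, j < i → e j = unrank A j := fun j h => if_pos h
  have e2 : ∀ j, i ≤ j → j < i + U.card → e j = unrank U (j - i + 1) := fun j h h' => by
    simp only [e, if_neg h.not_gt, if_pos h']
  have e3 : ∀ j, i + U.card ≤ j → e j = unrank A (j - U.card + 1) := fun j h => by
    simp only [e, if_neg (show ¬ j < i by omega), if_neg h.not_gt]
  have hltA : ∀ {a b}, 1 ≤ a → b ≤ A.card → a < b → unrank A a < unrank A b := fun h1 h2 h =>
    unrank_strictMonoOn A (by rw [Finset.coe_Icc, Set.mem_Icc]; omega)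
      (by rw [Finset.coe_Icc, Set.mem_Icc]; omega) h
  have hltU : ∀ {a b}, 1 ≤ a → b ≤ U.card → a < b → unrank U a < unrank U b := fun h1 h2 h =>
    unrank_strictMonoOn U (by rw [Finset.coe_Icc, Set.mem_Icc]; omega)
      (by rw [Finset.coe_Icc, Set.mem_Icc]; omega) h
  have hA : ∀ {a}, 1 ≤ a → a ≤ A.card → unrank A a ∈ A := fun h1 h2 =>
    unrank_mem (Finset.mem_Icc.2 ⟨h1, h2⟩)
  have hU : ∀ {a}, 1 ≤ a → a ≤ U.card → unrank U a ∈ U := fun h1 h2 =>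
    unrank_mem (Finset.mem_Icc.2 ⟨h1, h2⟩)
  have emem : ∀ j ∈ Finset.Icc 1 (A.card + U.card - 1), e j ∈ A ∪ U := by
    intro j hj
    rw [Finset.mem_Icc] at hj
    rw [Finset.mem_union]
    rcases lt_or_ge j i with h1 | h1
    · left; rw [e1 j h1]; exact hA (by omega) (by omega)
    rcases lt_or_ge j (i + U.card) with h2 | h2
    · right; rw [e2 j h1 h2]; exact hU (by omega) (by omega)
    · left; rw [e3 j h2]; exact hA (by omega) (by omega)
  have einj : ∀ a ∈ Finset.Icc 1 (A.card + U.card - 1), ∀ b ∈ Finset.Icc 1 (A.card + U.card - 1),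
      a < b → e a ≠ e b := by
    intro a ha b hb hab
    rw [Finset.mem_Icc] at ha hb
    rcases lt_or_ge b i with h1 | h1
    · rw [e1 b h1, e1 a (by omega)]
      exact (hltA (by omega) (by omega) hab).ne
    rcases lt_or_ge b (i + U.card) with h2 | h2
    · rw [e2 b h1 h2]
      rcases lt_or_ge a i with h3 | h3
      · rw [e1 a h3]
        have h4 := hltA (by omega) (by omega) h3
        rw [hdi] at h4
        exact (h4.trans_le (hmin _ (hU (by omega) (by omega)))).ne
      · rw [e2 a h3 (by omega)]
        exact (hltU (by omega) (by omega) (by omega)).ne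
    · rw [e3 b h2]
      rcases lt_or_ge a i with h3 | h3
      · rw [e1 a h3]
        exact (hltA (by omega) (by omega) (by omega)).ne
      rcases lt_or_ge a (i + U.card) with h4 | h4
      · rw [e2 a h3 h4]
        intro h5
        -- A coincidence between `U` and the last block could only occur at `d`, but the last block
        -- lies above `d`.
        have h6 := hAU _ (hA (a := b - U.card + 1) (by omega) (by omega))
          (h5 ▸ hU (by omega) (by omega))
        have h7 := hltA (a := i) (b := b - U.card + 1) (by omega) (by omega) (by omega)
        omega
      · rw [e3 a h4]
        exact (hltA (by omega) (by omega) (by omega)).ne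
  have rmono := rank_strictMonoOn (A ∪ U)
  obtain ⟨σ, hσ, hσv⟩ := exists_perm_of_injOn (N := A.card + U.card - 1)
    (v := fun j => rank (A ∪ U) (e j)) (fun j hj => hcard ▸ rank_mem (emem j hj)) (by
      intro a ha b hb hab
      have h := rmono.injOn (emem a ha) (emem b hb) hab
      by_contra hne
      rcases Nat.lt_or_gt_of_ne hne with h1 | h1
      · exact einj a ha b hb h1 h
      · exact einj b hb a ha h1 h.symm)
  have hIcc : ∀ {j}, 1 ≤ j → j < A.card + U.card → j ∈ Finset.Icc 1 (A.card + U.card - 1) :=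
    fun h1 h2 => Finset.mem_Icc.2 ⟨h1, by omega⟩
  have hU1' : unrank U 1 = d := le_antisymm (by
    have h1 := rank_mem hdU
    rw [Finset.mem_Icc] at h1
    have h2 := unrank_rank hdU
    rcases h1.1.eq_or_lt with h3 | h3
    · rw [h3, h2]
    · exact (hltU le_rfl h1.2 h3).le.trans h2.le) (hmin _ (hU le_rfl hU1))
  refine ⟨σ, ⟨hi.1, hi.2, ?_, ?_, ?_⟩, ?_, ?_, ?_⟩
  · intro j hj
    rw [Finset.mem_Ico] at hj
    by_cases hj' : j ∈ Finset.Icc 1 (A.card + U.card - 1)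
    · rw [hσv j hj']
      rw [Finset.mem_Icc] at hj'
      have hji : j ≤ i := by omega
      have h1 : e j = unrank A j := by
        rcases hji.eq_or_lt with h2 | h2
        · rw [e2 j (by omega) (by omega), h2, hdi, Nat.sub_self, hU1']
        · exact e1 j h2
      have h2 : unrank A j ≤ d := by
        rcases hji.eq_or_lt with h2 | h2
        · rw [h2, hdi]
        · rw [← hdi]; exact (hltA (by omega) hi.2 h2).le
      show rank (A ∪ U) (e j) = j
      rw [h1, rank_union_of_le hmin h2]
      exact rank_unrank (Finset.mem_Icc.2 ⟨hj'.1, by omega⟩)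
    · exact hσ j hj'
  · intro a ha b hb hab
    rw [Set.mem_Ico] at ha hb
    have ha' := hIcc (j := a) (by omega) (by omega)
    have hb' := hIcc (j := b) (by omega) (by omega)
    rw [hσv a ha', hσv b hb']
    refine rmono (emem a ha') (emem b hb') ?_
    rw [e2 a (by omega) (by omega), e2 b (by omega) (by omega)]
    exact hltU (by omega) (by omega) (by omega)
  · intro a ha b hb hab
    rw [Set.mem_Ico] at ha hb
    have ha' := hIcc (j := a) (by omega) (by omega)
    have hb' := hIcc (j := b) (by omega) (by omega)
    rw [hσv a ha', hσv b hb']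
    refine rmono (emem a ha') (emem b hb') ?_
    rw [e3 a (by omega), e3 b (by omega)]
    exact hltA (by omega) (by omega) (by omega)
  · intro l hl hld
    have h1 := rank_strictMonoOn A hl hdA hld
    have h2 := Finset.mem_Icc.1 (rank_mem hl)
    rw [hσv _ (hIcc (by omega) (by omega))]
    show rank (A ∪ U) (e _) = _
    rw [e1 _ h1, unrank_rank hl]
  · intro l hl hld
    have h1 := rank_strictMonoOn A hdA hl hld
    have h2 := Finset.mem_Icc.1 (rank_mem hl)
    rw [hσv _ (hIcc (by omega) (by omega))]
    show rank (A ∪ U) (e _) = _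
    rw [e3 _ (by omega), show rank A l + U.card - 1 - U.card + 1 = rank A l by omega,
      unrank_rank hl]
  · intro u hu
    have h2 := Finset.mem_Icc.1 (rank_mem hu)
    rw [hσv _ (hIcc (by omega) (by omega))]
    show rank (A ∪ U) (e _) = _
    rw [e2 _ (by omega) (by omega), show i + rank U u - 1 - i + 1 = rank U u by omega,
      unrank_rank hu]

/-- Substitution of the tree `u` for the leaf `d`. -/
def graftAt (d : ℕ) (u t : OpTree X) : OpTree X := t.graft fun l => if l = d then u else leaf l

/-- The point is the order of quantifiers: `i` and `σ` depend on the sets of labels only, so that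
either factor can vary while the composition stays the same. -/
theorem exists_comp {A U : Finset ℕ} {d : ℕ} (hdA : d ∈ A) (hdU : d ∈ U)
    (hAU : ∀ l ∈ A, l ∈ U → l = d) (hmin : ∀ u ∈ U, d ≤ u) :
    ∃ i σ, IsShufflePerm A.card U.card i σ ∧ ∀ a u : OpTree X, IsTreeOn A a → IsTreeOn U u →
      (graftAt d u a).relabel (rank (A ∪ U)) =
        comp i σ (a.relabel (rank A)) (u.relabel (rank U)) := by
  obtain ⟨σ, hσ, h1, h2, h3⟩ := exists_isShufflePerm hdA hdU hAU hmin
  refine ⟨_, σ, hσ, fun a u ha hu => ?_⟩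
  rw [comp_eq_graft, graftAt, relabel, relabel, graft_graft, graft_graft]
  refine graft_congr fun l hl => ?_
  rw [ha.mem_iff] at hl
  simp only [graft, compSubst]
  rcases lt_trichotomy l d with h | h | h
  · rw [if_neg h.ne, if_pos (rank_strictMonoOn A hl hdA h), h1 l hl h]
    rfl
  · subst h
    rw [if_pos rfl, if_neg (lt_irrefl _), if_pos rfl, relabel_relabel]
    exact relabel_congr fun v hv => (h3 v (hu.mem_iff.1 hv)).symm
  · have h' := rank_strictMonoOn A hdA hl h
    rw [if_neg h.ne', if_neg h'.not_gt, if_neg h'.ne', (isTreeOn_relabel_rank hu).arity, h2 l hl h]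
    rfl

end OpTree

/-! ### Operations built from elementary compositions -/

namespace ShuffleOperad

open OpTree

variable {k : Type*} [Field k] {X : ℕ → Type*}

/-- `F` acts on tree monomials like an operation built from elementary compositions with fixed
monomials. -/
structure IsOperation (k : Type*) [Field k] (lt : OpTree X → OpTree X → Prop) (n N : ℕ)
    (F : OpTree X → OpTree X) : Prop where
  maps : ∀ t, IsTreeOn (Finset.Icc 1 n) t → IsTreeOn (Finset.Icc 1 N) (F t)
  le : ∀ t t', IsTreeOn (Finset.Icc 1 n) t → IsTreeOn (Finset.Icc 1 n) t' →
    (lt t t' ∨ t = t') → (lt (F t) (F t') ∨ F t = F t')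
  ideal : ∀ M : ℕ → Submodule k (OpTree X →₀ k), IsShuffleIdeal M →
    ∀ f ∈ M n, Finsupp.mapDomain F f ∈ M N

theorem mem_free_iff {n : ℕ} {f : OpTree X →₀ k} :
    f ∈ free k X n ↔ ∀ t ∈ f.support, IsTreeOn (Finset.Icc 1 n) t := by
  rw [free, Finsupp.mem_supported]
  simp only [isMonomial_and_arity_iff]
  exact Iff.rfl

theorem mapDomain_congr_of_mem_free {n : ℕ} {f : OpTree X →₀ k} (hf : f ∈ free k X n)
    {F F' : OpTree X → OpTree X} (h : ∀ t, IsTreeOn (Finset.Icc 1 n) t → F t = F' t) :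
    Finsupp.mapDomain F f = Finsupp.mapDomain F' f :=
  Finsupp.mapDomain_congr fun t ht => h t (mem_free_iff.1 hf t ht)

theorem compLin_single_right (i : ℕ) (σ : Equiv.Perm ℕ) (f : OpTree X →₀ k) (β : OpTree X) :
    compLin i σ f (Finsupp.single β 1) = Finsupp.mapDomain (fun t => OpTree.comp i σ t β) f := by
  unfold compLin Finsupp.mapDomain
  refine Finsupp.sum_congr fun t _ => ?_
  rw [Finsupp.sum_single_index (by rw [mul_zero, Finsupp.single_zero]), mul_one]

theorem compLin_single_left (i : ℕ) (σ : Equiv.Perm ℕ) (f : OpTree X →₀ k) (α : OpTree X) :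
    compLin i σ (Finsupp.single α 1) f = Finsupp.mapDomain (fun t => OpTree.comp i σ α t) f := by
  unfold compLin Finsupp.mapDomain
  rw [Finsupp.sum_single_index (by
    simp only [zero_mul, Finsupp.single_zero]; exact Finset.sum_const_zero)]
  simp only [one_mul]

namespace IsOperation

variable {lt : OpTree X → OpTree X → Prop}

theorem id (n : ℕ) : IsOperation k lt n n fun t => t where
  maps _ h := h
  le _ _ _ _ h := h
  ideal M hM f hf := by rwa [show (fun t : OpTree X => t) = _root_.id from rfl, Finsupp.mapDomain_id]

theorem comp {n m N : ℕ} {F F' : OpTree X → OpTree X} (h' : IsOperation k lt m N F')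
    (h : IsOperation k lt n m F) : IsOperation k lt n N fun t => F' (F t) where
  maps t ht := h'.maps _ (h.maps t ht)
  le t t' ht ht' hle := h'.le _ _ (h.maps t ht) (h.maps t' ht') (h.le t t' ht ht' hle)
  ideal M hM f hf := by
    have := h'.ideal M hM _ (h.ideal M hM f hf)
    rwa [← Finsupp.mapDomain_comp] at this

theorem congr {n N : ℕ} {F F' : OpTree X → OpTree X} (h : IsOperation k lt n N F)
    (e : ∀ t, IsTreeOn (Finset.Icc 1 n) t → F t = F' t) : IsOperation k lt n N F' where
  maps t ht := e t ht ▸ h.maps t ht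
  le t t' ht ht' hle := by rw [← e t ht, ← e t' ht']; exact h.le t t' ht ht' hle
  ideal M hM f hf := by
    rw [← mapDomain_congr_of_mem_free (hM.le_free _ hf) e]
    exact h.ideal M hM f hf

theorem comp_left (hlt : IsAdmissible lt) {n m i : ℕ} {σ : Equiv.Perm ℕ}
    (hσ : IsShufflePerm n m i σ) {β : OpTree X} (hβ : IsTreeOn (Finset.Icc 1 m) β) :
    IsOperation k lt n (n + m - 1) fun t => OpTree.comp i σ t β where
  maps t ht := isTreeOn_comp hσ ht hβ
  le t t' ht ht' hle := hlt.comp t t' β β ht.isMonomial ht'.isMonomial hβ.isMonomial hβ.isMonomial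
    (ht.arity.trans ht'.arity.symm) rfl hle (Or.inr rfl) i σ (by rwa [ht.arity, hβ.arity])
  ideal M hM f hf := by
    have := hM.comp_left n m i σ hσ f hf (Finsupp.single β 1) (mem_free_iff.2 fun t ht => by
      rw [Finset.mem_singleton.1 (Finsupp.support_single_subset ht)]; exact hβ)
    rwa [compLin_single_right] at this

theorem comp_right (hlt : IsAdmissible lt) {n m i : ℕ} {σ : Equiv.Perm ℕ}
    (hσ : IsShufflePerm n m i σ) {α : OpTree X} (hα : IsTreeOn (Finset.Icc 1 n) α) :
    IsOperation k lt m (n + m - 1) fun t => OpTree.comp i σ α t where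
  maps t ht := isTreeOn_comp hσ hα ht
  le t t' ht ht' hle := hlt.comp α α t t' hα.isMonomial hα.isMonomial ht.isMonomial ht'.isMonomial
    rfl (ht.arity.trans ht'.arity.symm) (Or.inr rfl) hle i σ (by rwa [hα.arity, ht.arity])
  ideal M hM f hf := by
    have := hM.comp_right n m i σ hσ (Finsupp.single α 1) (mem_free_iff.2 fun t ht => by
      rw [Finset.mem_singleton.1 (Finsupp.support_single_subset ht)]; exact hα) f hf
    rwa [compLin_single_left] at this

end IsOperation

/-- The version of `IsOperation` for trees with leaves labelled by arbitrary finite sets. -/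
def IsOperationOn (k : Type*) [Field k] (lt : OpTree X → OpTree X → Prop) (B A : Finset ℕ)
    (F : OpTree X → OpTree X) : Prop :=
  (∀ t, IsTreeOn B t → IsTreeOn A (F t)) ∧
    ∃ F', IsOperation k lt B.card A.card F' ∧
      ∀ t, IsTreeOn B t → (F t).relabel (rank A) = F' (t.relabel (rank B))

namespace IsOperationOn

variable {lt : OpTree X → OpTree X → Prop}

theorem comp {B A A' : Finset ℕ} {F F' : OpTree X → OpTree X} (h' : IsOperationOn k lt A A' F')
    (h : IsOperationOn k lt B A F) : IsOperationOn k lt B A' fun t => F' (F t) := by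
  obtain ⟨h1, F1, h2, h3⟩ := h
  obtain ⟨h1', F1', h2', h3'⟩ := h'
  refine ⟨fun t ht => h1' _ (h1 t ht), _, h2'.comp h2, fun t ht => ?_⟩
  rw [h3' _ (h1 t ht), h3 t ht]

theorem congr {B A : Finset ℕ} {F F' : OpTree X → OpTree X} (h : IsOperationOn k lt B A F)
    (e : ∀ t, IsTreeOn B t → F t = F' t) : IsOperationOn k lt B A F' := by
  obtain ⟨h1, F1, h2, h3⟩ := h
  exact ⟨fun t ht => e t ht ▸ h1 t ht, F1, h2, fun t ht => e t ht ▸ h3 t ht⟩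

theorem isOperation {n N : ℕ} {F : OpTree X → OpTree X}
    (h : IsOperationOn k lt (Finset.Icc 1 n) (Finset.Icc 1 N) F) : IsOperation k lt n N F := by
  obtain ⟨h1, F', h2, h3⟩ := h
  rw [Nat.card_Icc, Nat.card_Icc, Nat.add_sub_cancel, Nat.add_sub_cancel] at h2
  refine h2.congr fun t ht => ?_
  rw [← relabel_rank_Icc (h1 t ht), h3 t ht, relabel_rank_Icc ht]

/-- An increasing renaming preserves ranks, hence becomes the identity after standardisation. -/
theorem relabel {B : Finset ℕ} {φ : ℕ → ℕ} (hφ : StrictMonoOn φ B) :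
    IsOperationOn k lt B (B.image φ) fun t => t.relabel φ := by
  refine ⟨fun t ht => isTreeOn_relabel ht hφ, fun t => t, ?_, ?_⟩
  · rw [Finset.card_image_of_injOn hφ.injOn]
    exact IsOperation.id _
  · intro t ht
    rw [relabel_relabel]
    refine relabel_congr fun l hl => ?_
    rw [ht.mem_iff] at hl
    simp only [rank, Function.comp, Nat.count_eq_card_filter_range, add_left_inj]
    refine (Finset.card_bij (fun a _ => φ a) ?_ ?_ ?_).symm
    · intro a ha
      rw [Finset.mem_filter, Finset.mem_range] at ha ⊢
      exact ⟨hφ ha.2 hl ha.1, Finset.mem_image_of_mem _ ha.2⟩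
    · intro a ha b hb hab
      exact hφ.injOn (Finset.mem_filter.1 ha).2 (Finset.mem_filter.1 hb).2 hab
    · intro b hb
      rw [Finset.mem_filter, Finset.mem_range, Finset.mem_image] at hb
      obtain ⟨hb1, a, ha, rfl⟩ := hb
      exact ⟨a, Finset.mem_filter.2 ⟨Finset.mem_range.2 ((hφ.lt_iff_lt ha hl).1 hb1), ha⟩, rfl⟩

theorem isTreeOn_graftAt {A U : Finset ℕ} {d : ℕ} (hdA : d ∈ A)
    (hAU : ∀ l ∈ A, l ∈ U → l = d) {a u : OpTree X} (hu : IsTreeOn U u) (hd : u.minLeaf = d)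
    (ha : IsTreeOn A a) : IsTreeOn (A ∪ U) (graftAt d u a) := by
  have hm : ∀ l, (if l = d then u else leaf l).minLeaf = l := by
    intro l; split_ifs with h
    · rw [h, hd]
    · rfl
  have key := isTreeOn_graft (s := fun l => if l = d then u else leaf l) ha ?_ ?_ ?_ ?_
  · rw [graftAt]
    convert key using 1
    ext l
    rw [Finset.mem_union, Finset.mem_biUnion]
    constructor
    · rintro (h | h)
      · refine ⟨l, h, ?_⟩
        split_ifs with h'
        · rw [List.mem_toFinset, h', ← hd]; exact minLeaf_mem u
        · simp
      · exact ⟨d, hdA, by rw [if_pos rfl, List.mem_toFinset]; exact hu.mem_iff.2 h⟩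
    · rintro ⟨m, hm, hl⟩
      rw [List.mem_toFinset] at hl
      split_ifs at hl
      · exact Or.inr (hu.mem_iff.1 hl)
      · rw [mem_leaves_leaf] at hl; exact Or.inl (hl ▸ hm)
  · simp only [hm]; exact strictMonoOn_id
  · intro l _; split_ifs
    · exact hu.1
    · trivial
  · intro l _; split_ifs
    · exact hu.nodup
    · simp [leaves]
  · intro l hl l' hl' hne x hx hx'
    have hcase : ∀ l ∈ A, x ∈ (if l = d then u else leaf l).leaves → x = l ∨ (x ∈ U ∧ l = d) := by
      intro l hl hx
      split_ifs at hx with h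
      · exact Or.inr ⟨hu.mem_iff.1 hx, h⟩
      · exact Or.inl (mem_leaves_leaf.1 hx)
    rcases hcase l hl hx with h | ⟨h, h'⟩ <;> rcases hcase l' hl' hx' with h1 | ⟨h1, h1'⟩
    · exact hne (h.symm.trans h1)
    · subst h; exact hne ((hAU x hl h1).trans h1'.symm)
    · subst h1; exact hne (h'.trans (hAU x hl' h).symm)
    · exact hne (h'.trans h1'.symm)

theorem graftAt_left (hlt : IsAdmissible lt) {A U : Finset ℕ} {d : ℕ} (hdA : d ∈ A)
    (hAU : ∀ l ∈ A, l ∈ U → l = d) {u : OpTree X} (hu : IsTreeOn U u) (hd : u.minLeaf = d) :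
    IsOperationOn k lt A (A ∪ U) (graftAt d u) := by
  have hdU : d ∈ U := hu.mem_iff.1 (hd ▸ minLeaf_mem u)
  obtain ⟨i, σ, hσ, h⟩ := exists_comp (X := X) hdA hdU hAU fun v hv =>
    hd ▸ minLeaf_le (hu.mem_iff.2 hv)
  refine ⟨fun t ht => isTreeOn_graftAt hdA hAU hu hd ht,
    fun t => OpTree.comp i σ t (u.relabel (rank U)), ?_, fun t ht => h t u ht hu⟩
  rw [card_union_of_inter hdA hdU hAU]
  exact IsOperation.comp_left hlt hσ (isTreeOn_relabel_rank hu)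

theorem graftAt_right (hlt : IsAdmissible lt) {A U : Finset ℕ} {d : ℕ} (hdA : d ∈ A) (hdU : d ∈ U)
    (hAU : ∀ l ∈ A, l ∈ U → l = d) (hmin : ∀ u ∈ U, d ≤ u) {a : OpTree X} (ha : IsTreeOn A a) :
    IsOperationOn k lt U (A ∪ U) fun u => graftAt d u a := by
  obtain ⟨i, σ, hσ, h⟩ := exists_comp (X := X) hdA hdU hAU hmin
  refine ⟨fun t ht => isTreeOn_graftAt hdA hAU ht ?_ ha,
    fun t => OpTree.comp i σ (a.relabel (rank A)) t, ?_, fun t ht => h a t ha ht⟩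
  · exact (minLeaf_isLeast t).unique ⟨ht.mem_iff.2 hdU, fun l hl => hmin l (ht.mem_iff.1 hl)⟩
  rw [card_union_of_inter hdA hdU hAU]
  exact IsOperation.comp_right hlt hσ (isTreeOn_relabel_rank ha)

end IsOperationOn

end ShuffleOperad

/-! ### Replacement in a context is an operation -/

namespace OpTree

variable {X : ℕ → Type*}

theorem IsTreeOn.unique {A A' : Finset ℕ} {t : OpTree X} (h : IsTreeOn A t)
    (h' : IsTreeOn A' t) : A = A' := Finset.val_injective (h.2.symm.trans h'.2)

theorem leaves_graft (t : OpTree X) (s : ℕ → OpTree X) :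
    (t.graft s).leaves.Perm (t.leaves.flatMap fun l => (s l).leaves) := by
  rw [← Multiset.coe_eq_coe, coe_leaves_graft, Multiset.coe_bind]

theorem nodup_of_nodup_graft {t : OpTree X} {s : ℕ → OpTree X} (h : (t.graft s).leaves.Nodup) :
    (∀ l ∈ t.leaves, (s l).leaves.Nodup) ∧
      (∀ l ∈ t.leaves, ∀ l' ∈ t.leaves, l ≠ l' → List.Disjoint (s l).leaves (s l').leaves) ∧
      (t.relabel fun l => (s l).minLeaf).leaves.Nodup := by
  rw [(leaves_graft t s).nodup_iff, List.nodup_flatMap] at h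
  refine ⟨h.1, fun l hl l' hl' hne => ?_, ?_⟩
  · have : Std.Symm fun a b => List.Disjoint (s a).leaves (s b).leaves := ⟨fun _ _ h => h.symm⟩
    exact List.Pairwise.forall (R := fun a b => List.Disjoint (s a).leaves (s b).leaves) h.2 hl hl' hne
  · rw [← Multiset.coe_nodup, coe_leaves_relabel, Multiset.map_coe, Multiset.coe_nodup]
    refine List.pairwise_map.2 (h.2.imp fun {a b} hab e => hab (minLeaf_mem _) ?_)
    rw [e]
    exact minLeaf_mem _

theorem plug_eq (C : OpTree X) (s : ℕ → OpTree X) (γ : OpTree X) :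
    plug C s γ = graftAt 0 (γ.graft s) C := rfl

theorem mem_of_count_eq_one {C : OpTree X} (h : C.leaves.count 0 = 1) : 0 ∈ C.leaves :=
  List.count_pos_iff.1 (by omega)

/-- The positions of the hole and of the other leaves of a context. -/
theorem mem_leaves_graftAt {C T : OpTree X} (h : 0 ∈ C.leaves) {l : ℕ} :
    l ∈ (graftAt 0 T C).leaves ↔ l ∈ T.leaves ∨ (l ≠ 0 ∧ l ∈ C.leaves) := by
  rw [graftAt, mem_leaves_graft]
  constructor
  · rintro ⟨m, hm, hl⟩
    split_ifs at hl with h0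
    · exact Or.inl hl
    · rw [mem_leaves_leaf] at hl; subst hl; exact Or.inr ⟨h0, hm⟩
  · rintro (hl | ⟨h0, hl⟩)
    · exact ⟨0, h, by simpa using hl⟩
    · exact ⟨l, hl, by simp [h0]⟩

end OpTree

namespace ShuffleOperad

open OpTree

variable {k : Type*} [Field k] {X : ℕ → Type*} {lt : OpTree X → OpTree X → Prop}

/-- The trees are grafted one leaf at a time. Since the smallest leaf of `s l` is `l`, each single
grafting is an elementary composition up to standardisation. -/
theorem isOperationOn_graft (hlt : IsAdmissible lt) {B : Finset ℕ} {s : ℕ → OpTree X}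
    (hs : ∀ l ∈ B, (s l).IsShuffle) (hn : ∀ l ∈ B, (s l).leaves.Nodup)
    (hmin : ∀ l ∈ B, (s l).minLeaf = l)
    (hd : ∀ l ∈ B, ∀ l' ∈ B, l ≠ l' → List.Disjoint (s l).leaves (s l').leaves) :
    IsOperationOn k lt B (B.biUnion fun l => (s l).leaves.toFinset) fun t => t.graft s := by
  -- Here `D` is the set of leaves on which the grafting has already been performed.
  have key : ∀ D ⊆ B, IsOperationOn k lt B
      (B.biUnion fun l => if l ∈ D then (s l).leaves.toFinset else {l})
      fun t => t.graft fun l => if l ∈ D then s l else leaf l := by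
    intro D
    induction D using Finset.induction_on with
    | empty =>
      intro _
      have := IsOperationOn.relabel (k := k) (lt := lt) (B := B) strictMonoOn_id
      simpa [relabel, Finset.biUnion_singleton] using this
    | insert d D hdD ih =>
      intro hD
      have hdB : d ∈ B := hD (Finset.mem_insert_self _ _)
      have hDB : D ⊆ B := (Finset.subset_insert _ _).trans hD
      have hmem : ∀ l ∈ B, l ∈ (s l).leaves := fun l hl => by
        have := minLeaf_mem (s l)
        rwa [hmin l hl] at this
      have hds := hmem d hdB
      have hd' : ∀ l ∈ B, l ≠ d → ∀ x, x ∈ (if l ∈ D then (s l).leaves.toFinset else {l}) →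
          x ∉ (s d).leaves := by
        intro l hl hne x hx hx'
        refine hd l hl d hdB hne ?_ hx'
        split_ifs at hx
        · exact List.mem_toFinset.1 hx
        · rw [Finset.mem_singleton.1 hx]; exact hmem l hl
      have h := IsOperationOn.graftAt_left (k := k) hlt
        (A := B.biUnion fun l => if l ∈ D then (s l).leaves.toFinset else {l})
        (U := (s d).leaves.toFinset) (d := d) (u := s d)
        (Finset.mem_biUnion.2 ⟨d, hdB, by simp [hdD]⟩) (by
          intro x hx hx'
          rw [List.mem_toFinset] at hx'
          obtain ⟨l, hl, hxl⟩ := Finset.mem_biUnion.1 hx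
          by_cases hne : l = d
          · subst hne; simpa [hdD] using hxl
          · exact absurd hx' (hd' l hl hne x hxl)) (isTreeOn_toFinset (hs d hdB) (hn d hdB))
        (hmin d hdB)
      convert (h.comp (ih hDB)).congr (F' := fun t => t.graft fun l =>
        if l ∈ insert d D then s l else leaf l) ?_ using 1
      · ext x
        simp only [Finset.mem_biUnion, Finset.mem_union, Finset.mem_insert]
        constructor
        · rintro ⟨l, hl, hx⟩
          by_cases hne : l = d
          · subst hne; right; simpa using hx
          · left; refine ⟨l, hl, by simpa [hne] using hx⟩
        · rintro (⟨l, hl, hx⟩ | hx)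
          · by_cases hne : l = d
            · subst hne
              refine ⟨l, hl, ?_⟩
              rw [if_neg hdD, Finset.mem_singleton] at hx
              subst hx
              simpa using hds
            · exact ⟨l, hl, by simpa [hne] using hx⟩
          · exact ⟨d, hdB, by simpa using hx⟩
      · intro t ht
        show graftAt d (s d) _ = _
        rw [graftAt, graft_graft]
        refine graft_congr fun l hl => ?_
        rw [ht.mem_iff] at hl
        by_cases hne : l = d
        · subst hne; simp [hdD, graft]
        · by_cases hlD : l ∈ D
          · simp only [hlD, if_true, Finset.mem_insert, or_true]
            -- A tree grafted earlier does not contain the label `d`, by disjointness, so the next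
            -- grafting leaves it alone.
            conv_rhs => rw [← graft_leaf (s l)]
            refine graft_congr fun x hx => if_neg ?_
            rintro rfl
            exact hd l hl x hdB hne hx hds
          · simp [hlD, hne, graft]
  have h := key B subset_rfl
  refine IsOperationOn.congr (F := fun t => t.graft fun l => if l ∈ B then s l else leaf l) ?_ ?_
  · convert h using 1
    refine Finset.biUnion_congr rfl fun l hl => (if_pos hl).symm
  · intro t ht
    exact graft_congr fun l hl => if_pos (ht.mem_iff.1 hl)

/-- A replacement decomposes into an increasing renaming of leaves, grafting the trees below the
occurrence, and inserting the result into the part above it. -/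
theorem isOperation_plug (hlt : IsAdmissible lt) {α β C : OpTree X} {s : ℕ → OpTree X}
    (h : IsOccurrence β α C s) : IsOperation k lt β.arity α.arity (plug C s) := by
  have hβ := h.left.isTreeOn
  have hα := h.right.isTreeOn
  have hm := h.mono
  generalize β.arity = n at *
  generalize α.arity = N at *
  have hmono : StrictMonoOn (fun j => (s j).minLeaf) (Finset.Icc 1 n : Finset ℕ) := by
    rw [Finset.coe_Icc]; exact hm
  have heq := h.eq
  have h0 := mem_of_count_eq_one h.hole
  set T := β.graft s with hT
  have heq' : graftAt 0 T C = α := heq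
  set φ : ℕ → ℕ := fun j => (s j).minLeaf with hφ
  obtain ⟨hC1, hC2, hC3⟩ := nodup_of_nodup_graft (t := C) (s := fun l => if l = 0 then T else leaf l)
    (by rw [← graftAt, heq']; exact hα.nodup)
  have hsh := hα.1
  rw [← heq', graftAt, isShuffle_graft] at hsh
  have hTn : T.leaves.Nodup := by simpa using hC1 0 h0
  have hTs : T.IsShuffle := by simpa using hsh.2 0 h0
  obtain ⟨hs1, hs2, -⟩ := nodup_of_nodup_graft (t := β) (s := s) hTn
  have hs3 := (isShuffle_graft.1 hTs).2
  simp only [hβ.mem_iff] at hs1 hs2 hs3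
  -- Grafting leaf by leaf requires the tree at a leaf `l` to have smallest leaf `l`. So leaf `j` is
  -- first renamed to the minimum `φ j` of `s j`, and `inv` recovers `j`.
  set inv := Function.invFunOn φ (Finset.Icc 1 n : Finset ℕ) with hinv
  have hinvφ : ∀ j ∈ Finset.Icc 1 n, inv (φ j) = j := fun j hj => hmono.injOn.leftInvOn_invFunOn hj
  have op1 : IsOperationOn k lt (Finset.Icc 1 n) ((Finset.Icc 1 n).image φ) fun t => t.relabel φ :=
    IsOperationOn.relabel hmono
  have op2 := isOperationOn_graft (k := k) hlt (B := (Finset.Icc 1 n).image φ) (s := fun l => s (inv l))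
    (by simp only [Finset.forall_mem_image]; intro j hj; rw [hinvφ j hj]; exact hs3 j hj)
    (by simp only [Finset.forall_mem_image]; intro j hj; rw [hinvφ j hj]; exact hs1 j hj)
    (by simp only [Finset.forall_mem_image]; intro j hj; rw [hinvφ j hj])
    (by
      simp only [Finset.forall_mem_image]
      intro j hj j' hj' hne
      rw [hinvφ j hj, hinvφ j' hj']
      exact hs2 j hj j' hj' fun e => hne (e ▸ rfl))
  set U := ((Finset.Icc 1 n).image φ).biUnion fun l => (s (inv l)).leaves.toFinset with hU
  have op3 : IsOperationOn k lt (Finset.Icc 1 n) U fun t => t.graft s := by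
    refine (op2.comp op1).congr fun t ht => ?_
    rw [relabel, graft_graft]
    refine graft_congr fun l hl => ?_
    simp only [graft]
    rw [hinvφ l (ht.mem_iff.1 hl)]
  have hTU : IsTreeOn U T := op3.1 β hβ
  set d := T.minLeaf with hd
  -- The hole is renamed from `0` to the smallest leaf `d` of the subtree, which makes the context a
  -- shuffle tree. All replacements have the same label set `U`, so `d` suits them all.
  set C' := C.relabel fun l => ((fun l => if l = 0 then T else leaf l) l).minLeaf with hC'
  have hC'T : IsTreeOn C'.leaves.toFinset C' := isTreeOn_toFinset hsh.1 hC3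
  have hmemC' : ∀ l ∈ C'.leaves, l = d ∨ l ∈ C.leaves ∧ l ≠ 0 := by
    intro l hl
    obtain ⟨m, hm, rfl⟩ := mem_leaves_relabel.1 hl
    by_cases hm0 : m = 0
    · left; simp [hm0, hd]
    · right; simpa [hm0, minLeaf] using hm
  have hnot : ∀ l ∈ C.leaves, l ≠ 0 → l ∉ T.leaves := by
    intro l hl hl0 hlT
    have := hC2 l hl 0 h0 hl0
    simp only [hl0, if_false, if_true] at this
    exact this (by simp) hlT
  have op4 := IsOperationOn.graftAt_right (k := k) hlt (A := C'.leaves.toFinset) (U := U) (d := d)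
    (List.mem_toFinset.2 (mem_leaves_relabel.2 ⟨0, h0, by simp [hd]⟩))
    (hTU.mem_iff.1 (minLeaf_mem T)) (by
      intro l hl hl'
      rw [List.mem_toFinset] at hl
      rcases hmemC' l hl with e | ⟨h1, h2⟩
      · exact e
      · exact absurd (hTU.mem_iff.2 hl') (hnot l h1 h2))
    (fun u hu => minLeaf_le (hTU.mem_iff.2 hu)) hC'T
  have op5 := (op4.comp op3).congr (F' := plug C s) fun t ht => by
    rw [plug_eq, graftAt, graftAt, hC', relabel, graft_graft]
    refine graft_congr fun l hl => ?_
    by_cases hl0 : l = 0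
    · simp [hl0, graft, hd]
    · have : l ≠ d := fun e => hnot l hl hl0 (e ▸ minLeaf_mem T)
      simp [hl0, graft, minLeaf, this]
  have hA : C'.leaves.toFinset ∪ U = Finset.Icc 1 N := by
    have := op5.1 β hβ
    rw [heq] at this
    exact this.unique hα
  rw [hA] at op5
  exact op5.isOperation

end ShuffleOperad

/-! ### Occurrences of tree monomials -/

namespace OpTree

open ShuffleOperad

variable {X : ℕ → Type*} {lt : OpTree X → OpTree X → Prop}

theorem count_graft {C : OpTree X} {s : ℕ → OpTree X} {a d : ℕ} (h : C.leaves.count d = 1)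
    (hs : ∀ l ∈ C.leaves, l ≠ d → a ∉ (s l).leaves) :
    (C.graft s).leaves.count a = (s d).leaves.count a := by
  rw [← Multiset.coe_count, coe_leaves_graft, Multiset.count_bind, Finset.sum_multiset_map_count,
    Finset.sum_eq_single d]
  · simp [h]
  · intro l hl hl0
    rw [Multiset.mem_toFinset, Multiset.mem_coe] at hl
    simp [List.count_eq_zero.2 (hs l hl hl0)]
  · intro h0
    exact absurd (by simpa using List.count_pos_iff.1 (by omega : 0 < C.leaves.count d)) h0

theorem IsOccurrence.isTreeOn_plug (hlt : IsAdmissible lt) {α β β' C : OpTree X}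
    {s : ℕ → OpTree X} (h : IsOccurrence β α C s) (hβ' : IsTreeOn (Finset.Icc 1 β.arity) β') :
    IsTreeOn (Finset.Icc 1 α.arity) (plug C s β') :=
  -- The field only enters the closure property of ideals, so any field, such as `ℚ`, serves here.
  (isOperation_plug (k := ℚ) hlt h).maps β' hβ'

theorem IsOccurrence.replace (hlt : IsAdmissible lt) {α β β' C : OpTree X} {s : ℕ → OpTree X}
    (h : IsOccurrence β α C s) (hβ' : IsTreeOn (Finset.Icc 1 β.arity) β') :
    IsOccurrence β' (plug C s β') C s where
  left := hβ'.isMonomial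
  right := (h.isTreeOn_plug hlt hβ').isMonomial
  hole := h.hole
  mono := by rw [hβ'.arity]; exact h.mono
  eq := rfl

theorem IsOccurrence.isTreeOn_right {α β C : OpTree X} {s : ℕ → OpTree X}
    (h : IsOccurrence β α C s) {l : ℕ} (hl : l ∈ (β.graft s).leaves) : l ∈ α.leaves := by
  rw [← h.eq, plug_eq, mem_leaves_graftAt (mem_of_count_eq_one h.hole)]
  exact Or.inl hl

theorem IsOccurrence.nodup_graft {α β C : OpTree X} {s : ℕ → OpTree X}
    (h : IsOccurrence β α C s) : (β.graft s).leaves.Nodup := by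
  have h1 := h.right.isTreeOn.nodup
  rw [← h.eq, plug_eq, graftAt] at h1
  simpa using (nodup_of_nodup_graft h1).1 0 (mem_of_count_eq_one h.hole)

theorem IsOccurrence.zero_notMem {α β C : OpTree X} {s : ℕ → OpTree X}
    (h : IsOccurrence β α C s) {l : ℕ} (hl : l ∈ β.leaves) : 0 ∉ (s l).leaves := by
  intro h0
  have h1 := h.isTreeOn_right (mem_leaves_graft.2 ⟨l, hl, h0⟩)
  rw [h.right.isTreeOn.mem_iff, Finset.mem_Icc] at h1
  omega

theorem IsOccurrence.plug_injOn {α β C : OpTree X} {s : ℕ → OpTree X}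
    (h : IsOccurrence β α C s) {t t' : OpTree X} (ht : IsTreeOn (Finset.Icc 1 β.arity) t)
    (ht' : IsTreeOn (Finset.Icc 1 β.arity) t') (he : plug C s t = plug C s t') : t = t' := by
  have h1 := graft_inj_on he 0 (mem_of_count_eq_one h.hole)
  simp only [if_true] at h1
  have hd := (nodup_of_nodup_graft h.nodup_graft).2.1
  simp only [h.left.isTreeOn.mem_iff] at hd
  refine graft_left_injective ?_ h1
  simpa only [ht.mem_iff, ht'.mem_iff] using hd

/-- Admissibility gives only a weak inequality; injectivity of the replacement excludes equality. -/
theorem IsOccurrence.plug_lt (hlt : IsAdmissible lt) {α β C : OpTree X} {s : ℕ → OpTree X}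
    (h : IsOccurrence β α C s) {t t' : OpTree X} (ht : IsTreeOn (Finset.Icc 1 β.arity) t)
    (ht' : IsTreeOn (Finset.Icc 1 β.arity) t') (hl : lt t t') : lt (plug C s t) (plug C s t') := by
  rcases (isOperation_plug (k := ℚ) hlt h).le t t' ht ht' (Or.inl hl) with h1 | h1
  · exact h1
  · have := h.plug_injOn ht ht' h1
    subst this
    exact absurd hl (hlt.irrefl _ ht.isMonomial)

theorem isOccurrence_refl {β : OpTree X} (h : IsMonomial β) : IsOccurrence β β (leaf 0) leaf where
  left := h
  right := h
  hole := by simp [leaves]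
  mono := strictMonoOn_id
  eq := by simp [plug, graft]

theorem plug_leaf_leaf (t : OpTree X) : plug (leaf 0) leaf t = t := by simp [plug, graft]

/-- The degenerate tree divides everything; this settles the case of a leading term without
vertices. -/
theorem isOccurrence_leaf {α : OpTree X} (h : IsMonomial α) :
    IsOccurrence (leaf 1) α (leaf 0) fun _ => α where
  left := by simp [IsMonomial, IsShuffle, leaves, arity]
  right := h
  hole := by simp [leaves]
  mono := by
    intro a ha b hb hab
    simp only [arity, leaves, List.length_singleton, Set.mem_Icc] at ha hb
    omega
  eq := by simp [plug, graft]

/-- Contexts compose. The hypothesis keeps the trees grafted on `D` from creating labels `0`, which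
would be taken for further holes. -/
theorem plug_plug {C D : OpTree X} {s w : ℕ → OpTree X} (t : OpTree X)
    (hs : ∀ l ∈ D.leaves, l ≠ 0 → 0 ∉ (s l).leaves) :
    plug C s (plug D w t) = plug (graftAt 0 (D.graft fun l => if l = 0 then leaf 0 else s l) C)
      (fun l => (w l).graft s) t := by
  rw [plug, plug, plug, graftAt, graft_graft, graft_graft]
  refine graft_congr fun l _ => ?_
  by_cases hl : l = 0
  · simp only [hl, if_true]
    rw [graft_graft]
    refine graft_congr fun m hm => ?_
    by_cases hm0 : m = 0
    · simp only [hm0, if_true, graft, graft_graft]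
    · simp only [hm0, if_false, graft]
      conv_lhs => rw [← graft_leaf (s m)]
      refine graft_congr fun x hx => (if_neg ?_).symm
      rintro rfl
      exact hs m hm hm0 hx
  · simp [hl, graft]

theorem IsOccurrence.trans {α β γ C D : OpTree X} {s w : ℕ → OpTree X}
    (h : IsOccurrence β α D w) (h' : IsOccurrence α γ C s) :
    ∃ E v, IsOccurrence β γ E v ∧ ∀ t, plug E v t = plug C s (plug D w t) := by
  have h0D := mem_of_count_eq_one h.hole
  have hDα : ∀ l ∈ D.leaves, l ≠ 0 → l ∈ α.leaves := by
    intro l hl hl0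
    rw [← h.eq, plug_eq, mem_leaves_graftAt h0D]
    exact Or.inr ⟨hl0, hl⟩
  have hwα : ∀ j ∈ Finset.Icc 1 β.arity, ∀ l ∈ (w j).leaves, l ∈ Finset.Icc 1 α.arity := by
    intro j hj l hl
    rw [← h'.left.isTreeOn.mem_iff]
    exact h.isTreeOn_right (mem_leaves_graft.2 ⟨j, h.left.isTreeOn.mem_iff.2 hj, hl⟩)
  have hs : ∀ l ∈ D.leaves, l ≠ 0 → 0 ∉ (s l).leaves := fun l hl hl0 =>
    h'.zero_notMem (hDα l hl hl0)
  refine ⟨_, _, ⟨h.left, h'.right, ?_, ?_, ?_⟩, fun t => (plug_plug t hs).symm⟩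
  · rw [graftAt, count_graft h'.hole, if_pos rfl, count_graft h.hole, if_pos rfl]
    · simp [leaves]
    · intro l hl hl0
      rw [if_neg hl0]; exact hs l hl hl0
    · intro l hl hl0
      rw [if_neg hl0, mem_leaves_leaf]; exact hl0.symm
  · have e : ∀ j ∈ Set.Icc 1 β.arity, ((w j).graft s).minLeaf = (s (w j).minLeaf).minLeaf := by
      intro j hj
      refine minLeaf_graft_of_monotoneOn (h'.mono.monotoneOn.mono fun l hl => ?_)
      have := hwα j (by rwa [Finset.mem_Icc]) l hl
      rwa [Finset.mem_Icc] at this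
    intro a ha b hb hab
    show ((w a).graft s).minLeaf < ((w b).graft s).minLeaf
    rw [e a ha, e b hb]
    have hmem : ∀ j ∈ Set.Icc 1 β.arity, (w j).minLeaf ∈ Set.Icc 1 α.arity := fun j hj => by
      have := hwα j (by rwa [Finset.mem_Icc]) _ (minLeaf_mem _)
      rwa [Finset.mem_Icc] at this
    exact h'.mono (hmem a ha) (hmem b hb) (h.mono ha hb hab)
  · rw [← plug_plug β hs, h.eq, h'.eq]

/-- The left factor sits at the root, with nothing above it. With its counterpart for the right
factor, this makes composition with a monomial carry multiples to multiples. -/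
theorem isOccurrence_comp_left {n m i : ℕ} {σ : Equiv.Perm ℕ} (hσ : IsShufflePerm n m i σ)
    {α β : OpTree X} (hα : IsTreeOn (Finset.Icc 1 n) α) (hβ : IsTreeOn (Finset.Icc 1 m) β) :
    IsOccurrence α (comp i σ α β) (leaf 0) (compSubst i σ β) where
  left := hα.isMonomial
  right := (isTreeOn_comp hσ hα hβ).isMonomial
  hole := by simp [leaves]
  mono := by
    have := (compSubst_strictMonoOn hσ hβ).1
    rwa [Finset.coe_Icc, ← hα.arity] at this
  eq := by simp [plug, graft, comp_eq_graft]

theorem isOccurrence_comp_right {n m i : ℕ} {σ : Equiv.Perm ℕ} (hσ : IsShufflePerm n m i σ)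
    {α β : OpTree X} (hα : IsTreeOn (Finset.Icc 1 n) α) (hβ : IsTreeOn (Finset.Icc 1 m) β) :
    ∃ C s, IsOccurrence β (comp i σ α β) C s ∧
      ∀ t, IsTreeOn (Finset.Icc 1 m) t → plug C s t = comp i σ α t := by
  have hi := hσ.1
  have hin := hσ.2.1
  have hm : 1 ≤ m := by simpa using one_le_card hβ
  -- The context is `α` with its final labels, except that the leaf `i`, where `β` is inserted,
  -- becomes the hole.
  set f : ℕ → ℕ := fun j => if j < i then σ j else if j = i then 0 else σ (j + m - 1) with hf
  have hf0 : ∀ j ∈ Finset.Icc 1 n, (0 = f j ↔ j = i) := by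
    intro j hj
    rw [Finset.mem_Icc] at hj
    simp only [hf]
    rcases lt_trichotomy j i with h | h | h
    · rw [if_pos h, hσ.eq_of_le h.le]; omega
    · simp [h]
    · rw [if_neg (by omega), if_neg (by omega)]
      have := (hσ.lt (j := j + m - 1) (by omega) (by omega)).1
      omega
  have hplug : ∀ t, IsTreeOn (Finset.Icc 1 m) t →
      plug (α.relabel f) (fun l => leaf (σ (i + l - 1))) t = comp i σ α t := by
    intro t ht
    rw [plug, comp_eq_graft, relabel, graft_graft]
    refine graft_congr fun j hj => ?_
    rw [hα.mem_iff] at hj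
    simp only [graft]
    by_cases h : j = i
    · rw [if_pos ((hf0 j hj).2 h).symm, compSubst, if_neg (by omega), if_pos h]
      rfl
    · rw [if_neg fun e => h ((hf0 j hj).1 e.symm), compSubst, ht.arity]
      simp only [hf, h, if_false]
      split_ifs <;> rfl
  refine ⟨α.relabel f, fun l => leaf (σ (i + l - 1)), ⟨hβ.isMonomial,
    (isTreeOn_comp hσ hα hβ).isMonomial, ?_, ?_, hplug β hβ⟩, hplug⟩
  · rw [← Multiset.coe_count, coe_leaves_relabel, Multiset.count_map, hα.2]
    have : (Finset.Icc 1 n).filter (fun j => 0 = f j) = {i} := by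
      ext j
      rw [Finset.mem_filter, Finset.mem_singleton]
      refine ⟨fun h => (hf0 j h.1).1 h.2, fun h => ?_⟩
      have hj : j ∈ Finset.Icc 1 n := by rw [Finset.mem_Icc]; omega
      exact ⟨hj, (hf0 j hj).2 h⟩
    exact (congrArg Finset.card this).trans (Finset.card_singleton i)
  · have := (compSubst_strictMonoOn hσ hβ).2.2
    rwa [Finset.coe_Icc, ← hβ.arity] at this

end OpTree

/-! ### Relative position of two subtrees -/

namespace OpTree

variable {X : ℕ → Type*}

instance : Nonempty (OpTree X) := ⟨leaf 0⟩

theorem graftAt_of_notMem {d : ℕ} {u t : OpTree X} (h : d ∉ t.leaves) : graftAt d u t = t := by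
  conv_rhs => rw [← graft_leaf t]
  refine graft_congr fun l hl => if_neg ?_
  rintro rfl
  exact h hl

theorem graftAt_node {n : ℕ} (d : ℕ) (u : OpTree X) (x : X (n + 1)) (c : Fin (n + 1) → OpTree X) :
    graftAt d u (node x c) = node x fun j => graftAt d u (c j) := rfl

theorem graftAt_leaf_self (d : ℕ) (u : OpTree X) : graftAt d u (leaf d) = u := if_pos rfl

theorem graftAt_graftAt {d : ℕ} (T Q C : OpTree X) :
    graftAt d T (graftAt d Q C) = graftAt d (graftAt d T Q) C := by
  rw [graftAt, graftAt, graft_graft]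
  refine graft_congr fun l _ => ?_
  by_cases h : l = d
  · simp only [h, if_true]; rfl
  · simp [h, graft]

theorem graftAt_eq_graft {d : ℕ} (T Q : OpTree X) (s : ℕ → OpTree X) {t : OpTree X}
    {j : ℕ} (hs : ∀ l ∈ t.leaves, l ≠ j → d ∉ (s l).leaves) :
    graftAt d T (t.graft (Function.update s j Q)) =
      t.graft (Function.update s j (graftAt d T Q)) := by
  rw [graftAt, graft_graft]
  refine graft_congr fun l hl => ?_
  by_cases h : l = j
  · subst h; simp [graftAt]
  · simp only [Function.update_of_ne h]
    exact graftAt_of_notMem (hs l hl h)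

theorem count_node_eq_one_iff {n : ℕ} {x : X (n + 1)} {c : Fin (n + 1) → OpTree X} {a : ℕ} :
    (node x c).leaves.count a = 1 ↔
      ∃ j, (c j).leaves.count a = 1 ∧ ∀ i, i ≠ j → a ∉ (c i).leaves := by
  simp only [count_leaves_node, ← List.count_eq_zero]
  constructor
  · intro h
    obtain ⟨j, -, hj⟩ := Finset.exists_ne_zero_of_sum_ne_zero (h.trans_ne one_ne_zero)
    rw [← Finset.add_sum_erase _ _ (Finset.mem_univ j)] at h
    have h0 : ∑ i ∈ Finset.univ.erase j, (c i).leaves.count a = 0 := by omega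
    rw [Finset.sum_eq_zero_iff] at h0
    exact ⟨j, by omega, fun i hi => h0 i (Finset.mem_erase.2 ⟨hi, Finset.mem_univ i⟩)⟩
  · rintro ⟨j, hj, h⟩
    rw [Finset.sum_eq_single j (fun i _ hi => h i hi) (fun h => absurd (Finset.mem_univ j) h), hj]

/-- The paths to the two holes in the common tree run together until one of them ends or they
separate. In the first case one subtree contains the other. In the second case there is a context
with two holes, and `D₁` and `D₂` are obtained from it by filling one of them. A filling without
label `0` leaves exactly one hole. -/
theorem compare_holes {C₁ C₂ T₁ T₂ : OpTree X} (h₁ : C₁.leaves.count 0 = 1)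
    (h₂ : C₂.leaves.count 0 = 1) (he : graftAt 0 T₁ C₁ = graftAt 0 T₂ C₂) :
    (∃ Q, Q.leaves.count 0 = 1 ∧ C₂ = graftAt 0 Q C₁ ∧ T₁ = graftAt 0 T₂ Q) ∨
      (∃ Q, Q.leaves.count 0 = 1 ∧ C₁ = graftAt 0 Q C₂ ∧ T₂ = graftAt 0 T₁ Q) ∨
      ∃ D₁ D₂ : OpTree X → OpTree X,
        (∀ T, 0 ∉ T.leaves → (D₁ T).leaves.count 0 = 1 ∧ (D₂ T).leaves.count 0 = 1) ∧
        (∀ T T', 0 ∉ T.leaves → 0 ∉ T'.leaves → graftAt 0 T (D₁ T') = graftAt 0 T' (D₂ T)) ∧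
        D₁ T₂ = C₁ ∧ D₂ T₁ = C₂ := by
  induction C₁ generalizing C₂ with
  | leaf l =>
    have := mem_leaves_leaf.1 (mem_of_count_eq_one h₁)
    subst this
    rw [graftAt_leaf_self] at he
    exact Or.inl ⟨C₂, h₂, (graftAt_leaf_self _ _).symm, he⟩
  | @node n x c₁ ih =>
    cases C₂ with
    | leaf l =>
      have := mem_leaves_leaf.1 (mem_of_count_eq_one h₂)
      subst this
      rw [graftAt_leaf_self] at he
      exact Or.inr (Or.inl ⟨_, h₁, (graftAt_leaf_self _ _).symm, he.symm⟩)
    | @node n' x' c₂ =>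
      simp only [graftAt_node, node.injEq] at he
      obtain ⟨hn, hx, hc⟩ := he
      obtain rfl : n = n' := by omega
      simp only [heq_eq_eq] at hx hc
      subst hx
      have hc' := fun i => congrFun hc i
      obtain ⟨j₁, hj₁, hne₁⟩ := count_node_eq_one_iff.1 h₁
      obtain ⟨j₂, hj₂, hne₂⟩ := count_node_eq_one_iff.1 h₂
      by_cases hj : j₁ = j₂
      · subst hj
        have hc0 : ∀ i, i ≠ j₁ → c₁ i = c₂ i := by
          intro i hi
          have := hc' i
          rwa [graftAt_of_notMem (hne₁ i hi), graftAt_of_notMem (hne₂ i hi)] at this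
        rcases ih j₁ hj₁ hj₂ (hc' j₁) with ⟨Q, hQ, e1, e2⟩ | ⟨Q, hQ, e1, e2⟩ |
          ⟨D₁, D₂, hD, hDD, e1, e2⟩
        · refine Or.inl ⟨Q, hQ, ?_, e2⟩
          rw [graftAt_node]
          congr 1
          funext i
          by_cases hi : i = j₁
          · subst hi; exact e1
          · rw [graftAt_of_notMem (hne₁ i hi), hc0 i hi]
        · refine Or.inr (Or.inl ⟨Q, hQ, ?_, e2⟩)
          rw [graftAt_node]
          congr 1
          funext i
          by_cases hi : i = j₁
          · subst hi; exact e1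
          · rw [graftAt_of_notMem (hne₂ i hi), hc0 i hi]
        · refine Or.inr (Or.inr ⟨fun T => node x (Function.update c₁ j₁ (D₁ T)),
            fun T => node x (Function.update c₂ j₁ (D₂ T)), ?_, ?_, ?_, ?_⟩)
          · intro T hT
            refine ⟨count_node_eq_one_iff.2 ⟨j₁, by simpa using (hD T hT).1, fun i hi => ?_⟩,
              count_node_eq_one_iff.2 ⟨j₁, by simpa using (hD T hT).2, fun i hi => ?_⟩⟩
            · rw [Function.update_of_ne hi]; exact hne₁ i hi
            · rw [Function.update_of_ne hi]; exact hne₂ i hi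
          · intro T T' hT hT'
            simp only [graftAt_node]
            congr 1
            funext i
            by_cases hi : i = j₁
            · subst hi; simpa using hDD T T' hT hT'
            · rw [Function.update_of_ne hi, Function.update_of_ne hi,
                graftAt_of_notMem (hne₁ i hi), graftAt_of_notMem (hne₂ i hi), hc0 i hi]
          · simp only [e1, Function.update_eq_self]
          · simp only [e2, Function.update_eq_self]
      -- The holes separate at this vertex. `D₁ T` keeps the first hole, in child `j₁`, and fills
      -- the second one, in child `j₂`, with `T`; `D₂ T` does the converse.
      · refine Or.inr (Or.inr ⟨fun T => node x (Function.update c₁ j₂ (graftAt 0 T (c₂ j₂))),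
            fun T => node x (Function.update c₂ j₁ (graftAt 0 T (c₁ j₁))), ?_, ?_, ?_, ?_⟩)
        · intro T hT
          have hz : ∀ u : OpTree X, 0 ∉ (graftAt 0 T u).leaves := by
            intro u h0
            obtain ⟨m, -, hm⟩ := mem_leaves_graft.1 h0
            split_ifs at hm with h
            · exact hT hm
            · exact h (mem_leaves_leaf.1 hm).symm
          refine ⟨count_node_eq_one_iff.2 ⟨j₁, by rwa [Function.update_of_ne hj], fun i hi => ?_⟩,
              count_node_eq_one_iff.2 ⟨j₂, by rwa [Function.update_of_ne (Ne.symm hj)],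
                fun i hi => ?_⟩⟩
          · by_cases h : i = j₂
            · subst h; rw [Function.update_self]; exact hz _
            · rw [Function.update_of_ne h]; exact hne₁ i hi
          · by_cases h : i = j₁
            · subst h; rw [Function.update_self]; exact hz _
            · rw [Function.update_of_ne h]; exact hne₂ i hi
        · intro T T' hT hT'
          have hz : ∀ (T u : OpTree X), 0 ∉ T.leaves → 0 ∉ (graftAt 0 T u).leaves := by
            intro T u hT h0
            obtain ⟨m, -, hm⟩ := mem_leaves_graft.1 h0
            split_ifs at hm with h
            · exact hT hm
            · exact h (mem_leaves_leaf.1 hm).symm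
          simp only [graftAt_node]
          congr 1
          funext i
          by_cases h1 : i = j₁
          · subst h1
            rw [Function.update_of_ne hj, Function.update_self, graftAt_of_notMem (hz _ _ hT)]
          · by_cases h2 : i = j₂
            · subst h2
              rw [Function.update_self, Function.update_of_ne h1, graftAt_of_notMem (hz _ _ hT')]
            · rw [Function.update_of_ne h1, Function.update_of_ne h2,
                graftAt_of_notMem (hne₁ i h1), graftAt_of_notMem (hne₂ i h2)]
              have := hc' i
              rwa [graftAt_of_notMem (hne₁ i h1), graftAt_of_notMem (hne₂ i h2)] at this
        · have := hc' j₂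
          rw [graftAt_of_notMem (hne₁ j₂ (Ne.symm hj))] at this
          simp only [← this, Function.update_eq_self]
        · have := hc' j₁
          rw [graftAt_of_notMem (hne₂ j₁ hj)] at this
          simp only [this, Function.update_eq_self]

theorem nodup_child {n : ℕ} {x : X (n + 1)} {c : Fin (n + 1) → OpTree X}
    (h : (node x c).leaves.Nodup) :
    (∀ j, (c j).leaves.Nodup) ∧ ∀ i j l, l ∈ (c i).leaves → l ∈ (c j).leaves → i = j := by
  rw [leaves, List.nodup_flatten] at h
  refine ⟨fun j => h.1 _ (List.mem_ofFn.2 ⟨j, rfl⟩), ?_⟩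
  have h2 := List.pairwise_ofFn.1 h.2
  intro i j l hi hj
  rcases lt_trichotomy i j with h3 | h3 | h3
  · exact absurd hj (h2 h3 hi)
  · exact h3
  · exact absurd hi (h2 h3 hj)

/-- Substitutions constructed for the children separately glue to one, since distinct children have
no common leaves. -/
theorem exists_merge {n : ℕ} {α : Type*} (L : Fin n → List ℕ) (s : Fin n → ℕ → α) [Nonempty α]
    (h : ∀ i j l, l ∈ L i → l ∈ L j → i = j) : ∃ w : ℕ → α, ∀ i, ∀ l ∈ L i, w l = s i l := by
  classical
  refine ⟨fun l => if hl : ∃ i, l ∈ L i then s hl.choose l else Classical.arbitrary α, ?_⟩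
  intro i l hl
  have hex : ∃ i, l ∈ L i := ⟨i, hl⟩
  show dite _ _ _ = _
  rw [dif_pos hex, h _ i l hex.choose_spec hl]

/-- When the trees `t l` are cut off, each cut end can be named by the smallest leaf of the removed
tree. These names are distinct, so `w` can restore the trees. -/
theorem exists_cut {e : OpTree X} {t : ℕ → OpTree X} (h : (e.graft t).leaves.Nodup) :
    ∃ w : ℕ → OpTree X, ∀ l ∈ e.leaves, w (t l).minLeaf = t l := by
  have hi : Set.InjOn (fun l => (t l).minLeaf) {l | l ∈ e.leaves} := by
    intro a ha b hb hab
    by_contra hne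
    refine (nodup_of_nodup_graft h).2.1 a ha b hb hne (minLeaf_mem _) ?_
    rw [show (t a).minLeaf = (t b).minLeaf from hab]
    exact minLeaf_mem _
  refine ⟨fun m => t (Function.invFunOn (fun l => (t l).minLeaf) {l | l ∈ e.leaves} m), ?_⟩
  intro l hl
  exact congrArg t (hi.leftInvOn_invFunOn hl)

/-- Two trees that are both top parts of a third one have a common refinement. -/
theorem exists_join {b e : OpTree X} {s t : ℕ → OpTree X} (h : b.graft s = e.graft t)
    (hb : b.leaves.Nodup) (he : e.leaves.Nodup) (hn : (b.graft s).leaves.Nodup) :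
    ∃ u s' t' w, u = b.graft s' ∧ u = e.graft t' ∧ (∀ l ∈ b.leaves, s l = (s' l).graft w) ∧
      (∀ l ∈ e.leaves, t l = (t' l).graft w) ∧ (∀ l ∈ u.leaves, (w l).minLeaf = l) ∧
      u.size ≤ b.size + e.size ∧ (0 < b.size → 0 < e.size → u.size < b.size + e.size) := by
  induction b generalizing e with
  | leaf m =>
    obtain ⟨w, hw⟩ := exists_cut (e := e) (t := t) (h ▸ hn)
    refine ⟨e.relabel fun l => (t l).minLeaf, fun _ => e.relabel fun l => (t l).minLeaf,
      fun l => leaf (t l).minLeaf, w, rfl, rfl, ?_, fun l hl => (hw l hl).symm, ?_, ?_, ?_⟩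
    · intro l hl
      rw [mem_leaves_leaf] at hl
      subst hl
      rw [show s l = e.graft t from h, relabel, graft_graft]
      exact graft_congr fun l hl => (hw l hl).symm
    · intro l hl
      obtain ⟨m, hm, rfl⟩ := mem_leaves_relabel.1 hl
      rw [hw m hm]
    · rw [size_relabel]; exact Nat.le_add_left _ _
    · intro h0; simp [size] at h0
  | @node n x c ih =>
    cases e with
    | leaf m =>
      obtain ⟨w, hw⟩ := exists_cut (e := node x c) (t := s) hn
      refine ⟨(node x c).relabel fun l => (s l).minLeaf, fun l => leaf (s l).minLeaf,
        fun _ => (node x c).relabel fun l => (s l).minLeaf, w, rfl, rfl,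
        fun l hl => (hw l hl).symm, ?_, ?_, ?_, ?_⟩
      · intro l hl
        rw [mem_leaves_leaf] at hl
        subst hl
        rw [show t l = (node x c).graft s from h.symm, relabel, graft_graft]
        exact graft_congr fun l hl => (hw l hl).symm
      · intro l hl
        obtain ⟨m, hm, rfl⟩ := mem_leaves_relabel.1 hl
        rw [hw m hm]
      · rw [size_relabel]; exact Nat.le_add_right _ _
      · intro _ h0; simp [size] at h0
    | @node n' x' c' =>
      simp only [graft, node.injEq] at h
      obtain ⟨hnn, hx, hc⟩ := h
      obtain rfl : n = n' := by omega
      simp only [heq_eq_eq] at hx hc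
      subst hx
      have hb' := nodup_child hb
      have he' := nodup_child he
      have hn' := nodup_child (x := x) (c := fun j => (c j).graft s) hn
      choose u s' t' w h1 h2 h3 h4 h5 h6 h7 using fun i =>
        ih i (congrFun hc i) (hb'.1 i) (he'.1 i) (hn'.1 i)
      obtain ⟨S, hS⟩ := exists_merge (fun i => (c i).leaves) s' hb'.2
      obtain ⟨T, hT⟩ := exists_merge (fun i => (c' i).leaves) t' he'.2
      have hu : ∀ i, ∀ l ∈ (u i).leaves, l ∈ ((c i).graft s).leaves := by
        intro i l hl
        have : (c i).graft s = (u i).graft (w i) := by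
          rw [h1 i, graft_graft]; exact graft_congr (h3 i)
        rw [this, mem_leaves_graft]
        refine ⟨l, hl, ?_⟩
        have := minLeaf_mem (w i l)
        rwa [h5 i l hl] at this
      obtain ⟨W, hW⟩ := exists_merge (fun i => (u i).leaves) w
        fun i j l hi hj => hn'.2 i j l (hu i l hi) (hu j l hj)
      -- The common root is counted once on the left and twice on the right, which makes the
      -- inequality strict.
      have hsz : (node x u).size < (node x c).size + (node x c').size := by
        simp only [size]
        have := Finset.sum_le_sum fun i (_ : i ∈ Finset.univ) => h6 i
        rw [Finset.sum_add_distrib] at this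
        omega
      refine ⟨node x u, S, T, W, ?_, ?_, ?_, ?_, ?_, hsz.le, fun _ _ => hsz⟩
      · simp only [graft]
        congr 1
        funext i
        rw [h1 i]
        exact graft_congr fun l hl => (hS i l hl).symm
      · simp only [graft]
        congr 1
        funext i
        rw [h2 i]
        exact graft_congr fun l hl => (hT i l hl).symm
      · intro l hl
        obtain ⟨i, hi⟩ := mem_leaves_node.1 hl
        rw [hS i l hi, h3 i l hi]
        refine graft_congr fun m hm => (hW i m ?_).symm
        rw [h1 i]
        exact mem_leaves_graft.2 ⟨l, hi, hm⟩
      · intro l hl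
        obtain ⟨i, hi⟩ := mem_leaves_node.1 hl
        rw [hT i l hi, h4 i l hi]
        refine graft_congr fun m hm => (hW i m ?_).symm
        rw [h2 i]
        exact mem_leaves_graft.2 ⟨l, hi, hm⟩
      · intro l hl
        obtain ⟨i, hi⟩ := mem_leaves_node.1 hl
        rw [hW i l hi, h5 i l hi]

/-- If a subtree of `b.graft s` is `e.graft t`, then `e` lies below a leaf of `b`, or `b` and `e`
have a common vertex and lie in a top part `v` with less than `b.size + e.size` vertices. -/
theorem nested_cases {b e Q : OpTree X} {s t : ℕ → OpTree X} (hQ : Q.leaves.count 0 = 1)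
    (h : b.graft s = graftAt 0 (e.graft t) Q) (hb : b.leaves.Nodup) (he : e.leaves.Nodup)
    (hn : (b.graft s).leaves.Nodup) (h0 : 0 ∉ (b.graft s).leaves) (hes : 0 < e.size) :
    (∃ j ∈ b.leaves, ∃ Q', Q'.leaves.count 0 = 1 ∧ s j = graftAt 0 (e.graft t) Q' ∧
        Q = b.graft (Function.update s j Q')) ∨
      ∃ v s' Q' t' w, v = b.graft s' ∧ v = graftAt 0 (e.graft t') Q' ∧
        (∀ l ∈ b.leaves, s l = (s' l).graft w) ∧ (∀ l ∈ e.leaves, t l = (t' l).graft w) ∧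
        Q = Q'.graft (fun l => if l = 0 then leaf 0 else w l) ∧ Q'.leaves.count 0 = 1 ∧
        (∀ l ∈ v.leaves, (w l).minLeaf = l) ∧ v.size < b.size + e.size := by
  induction b generalizing Q with
  | leaf m =>
    refine Or.inl ⟨m, by simp, Q, hQ, h, ?_⟩
    simp [graft]
  | @node n x c ih =>
    cases Q with
    | leaf l =>
      have := mem_leaves_leaf.1 (mem_of_count_eq_one hQ)
      subst this
      -- The root of `e` is the root of what remains of `b`; both have vertices, so their common
      -- refinement is small enough.
      rw [graftAt_leaf_self] at h
      obtain ⟨u, s', t', w, h1, h2, h3, h4, h5, -, h7⟩ := exists_join h hb he hn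
      refine Or.inr ⟨u, s', leaf 0, t', w, h1, ?_, h3, h4, ?_, hQ, h5, h7 (by simp [size]) hes⟩
      · rw [graftAt_leaf_self]; exact h2
      · simp [graft]
    | @node n' x' q =>
      simp only [graft, graftAt_node, node.injEq] at h
      obtain ⟨hnn, hx, hc⟩ := h
      obtain rfl : n = n' := by omega
      simp only [heq_eq_eq] at hx hc
      subst hx
      obtain ⟨j₀, hj₀, hne⟩ := count_node_eq_one_iff.1 hQ
      have hb' := nodup_child hb
      have hn' := nodup_child (x := x) (c := fun j => (c j).graft s) hn
      have h0' : ∀ i, 0 ∉ ((c i).graft s).leaves := fun i hi =>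
        h0 (mem_leaves_node (x := x) (c := fun j => (c j).graft s).2 ⟨i, hi⟩)
      have hq : ∀ i, i ≠ j₀ → (c i).graft s = q i := by
        intro i hi
        have := congrFun hc i
        rwa [graftAt_of_notMem (hne i hi)] at this
      rcases ih j₀ hj₀ (congrFun hc j₀) (hb'.1 j₀) (hn'.1 j₀) (h0' j₀) with
        ⟨j, hj, Q', hQ', e1, e2⟩ | ⟨v₀, s₀, Q₀, t₀, w₀, g1, g2, g3, g4, g5, g6, g7, g8⟩
      · refine Or.inl ⟨j, mem_leaves_node.2 ⟨j₀, hj⟩, Q', hQ', e1, ?_⟩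
        simp only [graft]
        congr 1
        funext i
        by_cases hi : i = j₀
        · subst hi; exact e2
        · rw [← hq i hi]
          refine graft_congr fun l hl => ?_
          rw [Function.update_of_ne]
          rintro rfl
          exact hi (hb'.2 _ _ _ hl hj)
      -- `V i` is the child `i` of the top part `v`. In the child containing the hole it comes from
      -- the induction; the other children end where `b` ends and contribute no further vertices.
      · have fam : ∀ i, ∃ V S W, V = (c i).graft S ∧ (∀ l ∈ (c i).leaves, s l = (S l).graft W) ∧
            (∀ l ∈ V.leaves, (W l).minLeaf = l) ∧ (i ≠ j₀ → V.size = (c i).size) ∧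
            (i = j₀ → V = v₀ ∧ W = w₀) := by
          intro i
          by_cases hi : i = j₀
          · subst hi
            exact ⟨v₀, s₀, w₀, g1, g3, g7, fun h => absurd rfl h, fun _ => ⟨rfl, rfl⟩⟩
          · obtain ⟨w, hw⟩ := exists_cut (hn'.1 i)
            refine ⟨(c i).relabel fun l => (s l).minLeaf, fun l => leaf (s l).minLeaf, w, rfl,
              fun l hl => (hw l hl).symm, ?_, fun _ => size_relabel _ _, fun h => absurd h hi⟩
            intro l hl
            obtain ⟨m, hm, rfl⟩ := mem_leaves_relabel.1 hl
            rw [hw m hm]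
        choose V S W f1 f2 f3 f4 f5 using fam
        obtain ⟨hV₀, hW₀⟩ := f5 j₀ rfl
        have fg : ∀ i, (c i).graft s = (V i).graft (W i) := fun i => by
          rw [f1 i, graft_graft]; exact graft_congr (f2 i)
        have hu : ∀ i, ∀ l ∈ (V i).leaves, l ∈ ((c i).graft s).leaves := by
          intro i l hl
          rw [fg, mem_leaves_graft]
          refine ⟨l, hl, ?_⟩
          have := minLeaf_mem (W i l)
          rwa [f3 i l hl] at this
        obtain ⟨s', hs'⟩ := exists_merge (fun i => (c i).leaves) S hb'.2
        obtain ⟨w, hw⟩ := exists_merge (fun i => (V i).leaves) W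
          fun i j l hi hj => hn'.2 i j l (hu i l hi) (hu j l hj)
        have hw₀ : ∀ l ∈ v₀.leaves, w l = w₀ l := fun l hl => by
          rw [hw j₀ l (hV₀ ▸ hl), hW₀]
        refine Or.inr ⟨node x V, s', node x (Function.update V j₀ Q₀), t₀, w, ?_, ?_, ?_, ?_, ?_, ?_,
          ?_, ?_⟩
        · simp only [graft]
          congr 1
          funext i
          rw [f1 i]
          exact graft_congr fun l hl => (hs' i l hl).symm
        · rw [graftAt_node]
          congr 1
          funext i
          by_cases hi : i = j₀
          · subst hi; rw [Function.update_self, hV₀]; exact g2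
          · rw [Function.update_of_ne hi, graftAt_of_notMem fun h => h0' i (hu i 0 h)]
        · intro l hl
          obtain ⟨i, hi⟩ := mem_leaves_node.1 hl
          rw [hs' i l hi, f2 i l hi]
          refine graft_congr fun m hm => (hw i m ?_).symm
          rw [f1 i]
          exact mem_leaves_graft.2 ⟨l, hi, hm⟩
        · intro l hl
          rw [g4 l hl]
          refine graft_congr fun m hm => (hw₀ m ?_).symm
          rw [g2, mem_leaves_graftAt (mem_of_count_eq_one g6)]
          exact Or.inl (mem_leaves_graft.2 ⟨l, hl, hm⟩)
        · simp only [graft]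
          congr 1
          funext i
          by_cases hi : i = j₀
          · subst hi
            rw [Function.update_self, g5]
            refine graft_congr fun l hl => ?_
            split_ifs with hl0
            · rfl
            · rw [hw₀ l]
              rw [g2, mem_leaves_graftAt (mem_of_count_eq_one g6)]
              exact Or.inr ⟨hl0, hl⟩
          · rw [Function.update_of_ne hi, ← hq i hi, fg]
            refine graft_congr fun l hl => ?_
            rw [if_neg, hw i l hl]
            rintro rfl
            exact h0' i (hu i 0 hl)
        · refine count_node_eq_one_iff.2 ⟨j₀, by rwa [Function.update_self], fun i hi => ?_⟩
          rw [Function.update_of_ne hi]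
          exact fun h => h0' i (hu i 0 h)
        · intro l hl
          obtain ⟨i, hi⟩ := mem_leaves_node.1 hl
          rw [hw i l hi, f3 i l hi]
        · simp only [size]
          rw [← Finset.add_sum_erase _ _ (Finset.mem_univ j₀),
            ← Finset.add_sum_erase _ (fun i => (c i).size) (Finset.mem_univ j₀),
            Finset.sum_congr rfl fun i hi => f4 i (Finset.ne_of_mem_erase hi), hV₀]
          omega

end OpTree

/-! ### Overlapping and independent occurrences -/

namespace OpTree

variable {X : ℕ → Type*} {lt : OpTree X → OpTree X → Prop}

/-- The two occurrences come from occurrences in a tree monomial with few vertices. -/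
def Overlap (γ β₁ C₁ : OpTree X) (s₁ : ℕ → OpTree X) (β₂ C₂ : OpTree X) (s₂ : ℕ → OpTree X) :
    Prop :=
  ∃ γ₀ D w E₁ v₁ E₂ v₂, IsOccurrence γ₀ γ D w ∧ IsOccurrence β₁ γ₀ E₁ v₁ ∧
    IsOccurrence β₂ γ₀ E₂ v₂ ∧ γ₀.size < β₁.size + β₂.size ∧
    (∀ x, IsTreeOn (Finset.Icc 1 β₁.arity) x → plug D w (plug E₁ v₁ x) = plug C₁ s₁ x) ∧
    ∀ y, IsTreeOn (Finset.Icc 1 β₂.arity) y → plug D w (plug E₂ v₂ y) = plug C₂ s₂ y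

/-- The two occurrences can be replaced independently of each other. -/
def Independent (β₁ C₁ : OpTree X) (s₁ : ℕ → OpTree X) (β₂ C₂ : OpTree X) (s₂ : ℕ → OpTree X) :
    Prop :=
  ∃ E : OpTree X → OpTree X → OpTree X,
    (∀ y, IsTreeOn (Finset.Icc 1 β₂.arity) y → ∃ C s, IsOccurrence β₁ (E β₁ y) C s ∧
      ∀ x, IsTreeOn (Finset.Icc 1 β₁.arity) x → plug C s x = E x y) ∧
    (∀ x, IsTreeOn (Finset.Icc 1 β₁.arity) x → ∃ C s, IsOccurrence β₂ (E x β₂) C s ∧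
      ∀ y, IsTreeOn (Finset.Icc 1 β₂.arity) y → plug C s y = E x y) ∧
    (∀ x, IsTreeOn (Finset.Icc 1 β₁.arity) x → E x β₂ = plug C₁ s₁ x) ∧
    ∀ y, IsTreeOn (Finset.Icc 1 β₂.arity) y → E β₁ y = plug C₂ s₂ y

theorem Overlap.symm {γ β₁ C₁ β₂ C₂ : OpTree X} {s₁ s₂ : ℕ → OpTree X}
    (h : Overlap γ β₁ C₁ s₁ β₂ C₂ s₂) : Overlap γ β₂ C₂ s₂ β₁ C₁ s₁ := by
  obtain ⟨γ₀, D, w, E₁, v₁, E₂, v₂, h1, h2, h3, h4, h5, h6⟩ := h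
  exact ⟨γ₀, D, w, E₂, v₂, E₁, v₁, h1, h3, h2, by omega, h6, h5⟩

theorem Independent.symm {β₁ C₁ β₂ C₂ : OpTree X} {s₁ s₂ : ℕ → OpTree X}
    (h : Independent β₁ C₁ s₁ β₂ C₂ s₂) : Independent β₂ C₂ s₂ β₁ C₁ s₁ := by
  obtain ⟨E, h1, h2, h3, h4⟩ := h
  exact ⟨fun y x => E x y, h2, h1, h4, h3⟩

theorem IsOccurrence.zero_notMem_graft (hlt : IsAdmissible lt) {α β C : OpTree X}
    {s : ℕ → OpTree X} (h : IsOccurrence β α C s) {x : OpTree X}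
    (hx : IsTreeOn (Finset.Icc 1 β.arity) x) : 0 ∉ (x.graft s).leaves := by
  intro h0
  have h' := h.replace hlt hx
  have := h'.isTreeOn_right h0
  rw [h'.right.isTreeOn.mem_iff, Finset.mem_Icc] at this
  omega

/-- The small common multiple is `v` with its leaves replaced by their ranks. The leaves of `v` are
named by the smallest leaves of the trees below them, so standardisation respects all the orders of
minima required of an occurrence. -/
theorem overlap_of_join {γ β₁ C₁ β₂ C₂ Q v Q' : OpTree X} {s₁ s₂ s' t' w : ℕ → OpTree X}
    (h₁ : IsOccurrence β₁ γ C₁ s₁) (h₂ : IsOccurrence β₂ γ C₂ s₂)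
    (hC : C₂ = graftAt 0 Q C₁) (g1 : v = β₁.graft s') (g2 : v = graftAt 0 (β₂.graft t') Q')
    (g3 : ∀ l ∈ β₁.leaves, s₁ l = (s' l).graft w) (g4 : ∀ l ∈ β₂.leaves, s₂ l = (t' l).graft w)
    (g5 : Q = Q'.graft (fun l => if l = 0 then leaf 0 else w l)) (g6 : Q'.leaves.count 0 = 1)
    (g7 : ∀ l ∈ v.leaves, (w l).minLeaf = l) (g8 : v.size < β₁.size + β₂.size) :
    Overlap γ β₁ C₁ s₁ β₂ C₂ s₂ := by
  have e₁ : β₁.graft s₁ = v.graft w := by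
    rw [g1, graft_graft]; exact graft_congr g3
  have hvw : v.relabel (fun l => (w l).minLeaf) = v := relabel_eq_self g7
  have hsh : (v.graft w).IsShuffle := by
    have := h₁.right.1
    rw [← h₁.eq, plug_eq, graftAt, isShuffle_graft] at this
    rw [← e₁]
    simpa using this.2 0 (mem_of_count_eq_one h₁.hole)
  have hv1 : v.IsShuffle := by
    have := (isShuffle_graft.1 hsh).1
    rwa [hvw] at this
  have hv2 : v.leaves.Nodup := by
    have := (nodup_of_nodup_graft (e₁ ▸ h₁.nodup_graft)).2.2
    rwa [hvw] at this
  have hV := isTreeOn_toFinset hv1 hv2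
  set V := v.leaves.toFinset
  have hρ := isTreeOn_relabel_rank hV
  have hmemV : ∀ {l}, l ∈ v.leaves ↔ l ∈ V := hV.mem_iff
  have hw' : ∀ l ∈ V, w (unrank V (rank V l)) = w l := fun l hl => by rw [unrank_rank hl]
  have hs'V : ∀ l ∈ β₁.leaves, ∀ m ∈ (s' l).leaves, m ∈ V := fun l hl m hm => by
    rw [← hmemV, g1]; exact mem_leaves_graft.2 ⟨l, hl, hm⟩
  have ht'V : ∀ l ∈ β₂.leaves, ∀ m ∈ (t' l).leaves, m ∈ V := fun l hl m hm => by
    rw [← hmemV, g2, mem_leaves_graftAt (mem_of_count_eq_one g6)]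
    exact Or.inl (mem_leaves_graft.2 ⟨l, hl, hm⟩)
  have hQ'V : ∀ l ∈ Q'.leaves, l ≠ 0 → l ∈ V := fun l hl hl0 => by
    rw [← hmemV, g2, mem_leaves_graftAt (mem_of_count_eq_one g6)]
    exact Or.inr ⟨hl0, hl⟩
  -- Since `v` has the same root as the occurrence of `β₁`, the part of `γ` above it is still `C₁`.
  have hocc : IsOccurrence (v.relabel (rank V)) γ C₁ fun j => w (unrank V j) := by
    refine ⟨hρ.isMonomial, h₁.right, h₁.hole, ?_, ?_⟩
    · intro a ha b hb hab
      rw [hρ.arity, ← Finset.coe_Icc] at ha hb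
      show (w _).minLeaf < (w _).minLeaf
      rw [g7 _ (hmemV.2 (unrank_mem ha)), g7 _ (hmemV.2 (unrank_mem hb))]
      exact unrank_strictMonoOn V ha hb hab
    · rw [← h₁.eq, plug_eq, plug_eq, e₁, relabel, graft_graft]
      congr 1
      exact graft_congr fun l hl => hw' l (hmemV.1 hl)
  have hmin : ∀ u : OpTree X, (∀ m ∈ u.leaves, m ∈ V) →
      (u.relabel (rank V)).minLeaf = rank V u.minLeaf ∧ (u.graft w).minLeaf = u.minLeaf := by
    intro u hu
    refine ⟨minLeaf_relabel ((rank_strictMonoOn V).monotoneOn.mono hu),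
      minLeaf_graft_of_eq fun l hl => g7 l (hmemV.2 (hu l hl))⟩
  have hback : ∀ u : OpTree X, (∀ m ∈ u.leaves, m ∈ V) →
      (u.relabel (rank V)).graft (fun j => w (unrank V j)) = u.graft w := by
    intro u hu
    rw [relabel, graft_graft]
    exact graft_congr fun l hl => hw' l (hu l hl)
  have hmono : ∀ (β : OpTree X) (s r : ℕ → OpTree X), IsMonomial β →
      StrictMonoOn (fun j => (s j).minLeaf) (Set.Icc 1 β.arity) →
      (∀ l ∈ β.leaves, ∀ m ∈ (r l).leaves, m ∈ V) → (∀ l ∈ β.leaves, s l = (r l).graft w) →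
      StrictMonoOn (fun j => ((r j).relabel (rank V)).minLeaf) (Set.Icc 1 β.arity) := by
    intro β s r hβ hs hr hsr a ha b hb hab
    have ha' : a ∈ β.leaves := by rw [hβ.isTreeOn.mem_iff, Finset.mem_Icc]; exact ha
    have hb' : b ∈ β.leaves := by rw [hβ.isTreeOn.mem_iff, Finset.mem_Icc]; exact hb
    show ((r a).relabel _).minLeaf < ((r b).relabel _).minLeaf
    rw [(hmin _ (hr a ha')).1, (hmin _ (hr b hb')).1]
    refine rank_strictMonoOn V (hr a ha' _ (minLeaf_mem _)) (hr b hb' _ (minLeaf_mem _)) ?_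
    rw [← (hmin _ (hr a ha')).2, ← (hmin _ (hr b hb')).2, ← hsr a ha', ← hsr b hb']
    exact hs ha hb hab
  -- Ranks start from `1`, so after standardisation the label `0` still means the hole only.
  have hrank0 : ∀ l, rank V l ≠ 0 := fun l => by simp [rank]
  refine ⟨v.relabel (rank V), C₁, fun j => w (unrank V j), leaf 0, fun l => (s' l).relabel (rank V),
    Q'.relabel fun l => if l = 0 then 0 else rank V l, fun l => (t' l).relabel (rank V),
    hocc, ⟨h₁.left, hρ.isMonomial, by simp [leaves], hmono _ _ _ h₁.left h₁.mono hs'V g3, ?_⟩,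
    ⟨h₂.left, hρ.isMonomial, ?_, hmono _ _ _ h₂.left h₂.mono ht'V g4, ?_⟩, ?_, ?_, ?_⟩
  · rw [plug_eq, graftAt_leaf_self, g1, relabel, graft_graft]; rfl
  · rw [relabel, count_graft g6]
    · simp [leaves]
    · intro l hl hl0
      rw [if_neg hl0, mem_leaves_leaf]; exact (hrank0 l).symm
  · rw [plug_eq, graftAt, g2, relabel, relabel, graftAt, graft_graft, graft_graft]
    refine graft_congr fun l hl => ?_
    by_cases h : l = 0
    · simp only [h, graft, if_true, graft_graft, relabel]
    · simp [h, graft, hrank0]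
  · rwa [size_relabel]
  · intro x hx
    rw [plug_eq C₁, plug_eq C₁, plug_eq, graftAt_leaf_self, graft_graft]
    congr 1
    refine graft_congr fun l hl => ?_
    have hl' : l ∈ β₁.leaves := by rw [h₁.left.isTreeOn.mem_iff, ← hx.mem_iff]; exact hl
    rw [hback _ (hs'V l hl'), g3 l hl']
  · intro y hy
    rw [plug_plug]
    · rw [hC, plug_eq, plug_eq]
      have eQ : ((Q'.relabel fun l => if l = 0 then 0 else rank V l).graft fun l =>
          if l = 0 then leaf 0 else w (unrank V l)) = Q := by
        rw [g5, relabel, graft_graft]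
        refine graft_congr fun l hl => ?_
        by_cases h : l = 0
        · simp [h, graft]
        · simp only [h, if_false, graft, hrank0]
          exact hw' l (hQ'V l hl h)
      rw [eQ]
      congr 1
      refine graft_congr fun l hl => ?_
      have hl' : l ∈ β₂.leaves := by rw [h₂.left.isTreeOn.mem_iff, ← hy.mem_iff]; exact hl
      rw [hback _ (ht'V l hl'), g4 l hl']
    · intro l hl hl0
      obtain ⟨m, hm, rfl⟩ := mem_leaves_relabel.1 hl
      have hm0 : m ≠ 0 := fun h => hl0 (by simp [h])
      simp only [hm0, if_false]
      refine hocc.zero_notMem ?_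
      rw [hρ.mem_iff]
      exact rank_mem (hQ'V m hm hm0)

/-- The occurrence of `β₂` lies inside the tree grafted on the single leaf `j` of `β₁`. Replacing it
changes that grafted tree only, while replacing `β₁` changes the part above `β₂` only. -/
theorem independent_of_below (hlt : IsAdmissible lt) {γ β₁ C₁ β₂ C₂ Q Q' : OpTree X}
    {s₁ s₂ : ℕ → OpTree X} {j : ℕ}
    (h₁ : IsOccurrence β₁ γ C₁ s₁) (h₂ : IsOccurrence β₂ γ C₂ s₂) (hC : C₂ = graftAt 0 Q C₁)
    (hj : j ∈ β₁.leaves) (hQ' : Q'.leaves.count 0 = 1) (hs : s₁ j = graftAt 0 (β₂.graft s₂) Q')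
    (hQ : Q = β₁.graft (Function.update s₁ j Q')) : Independent β₁ C₁ s₁ β₂ C₂ s₂ := by
  have hz : ∀ x : OpTree X, IsTreeOn (Finset.Icc 1 β₁.arity) x → ∀ l ∈ x.leaves, l ≠ j →
      0 ∉ (s₁ l).leaves := fun x hx l hl _ => by
    refine h₁.zero_notMem ?_
    rwa [h₁.left.isTreeOn.mem_iff, ← hx.mem_iff]
  have hE2 : ∀ y, IsTreeOn (Finset.Icc 1 β₂.arity) y →
      graftAt 0 (β₁.graft (Function.update s₁ j (graftAt 0 (y.graft s₂) Q'))) C₁ =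
        plug C₂ s₂ y := fun y hy => by
    rw [plug_eq, hC, graftAt_graftAt, hQ, graftAt_eq_graft _ _ _ (hz β₁ h₁.left.isTreeOn)]
  have hE1 : ∀ x, IsTreeOn (Finset.Icc 1 β₁.arity) x →
      graftAt 0 (x.graft (Function.update s₁ j (graftAt 0 (β₂.graft s₂) Q'))) C₁ =
        plug C₁ s₁ x := fun x _ => by
    rw [← hs, Function.update_eq_self, plug_eq]
  refine ⟨fun x y => graftAt 0 (x.graft (Function.update s₁ j (graftAt 0 (y.graft s₂) Q'))) C₁,
    fun y hy => ⟨C₁, Function.update s₁ j (graftAt 0 (y.graft s₂) Q'), ⟨h₁.left, ?_, h₁.hole, ?_, rfl⟩,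
      fun x hx => rfl⟩,
    fun x hx => ⟨graftAt 0 (x.graft (Function.update s₁ j Q')) C₁, s₂,
      ⟨h₂.left, ?_, ?_, h₂.mono, ?_⟩, fun y hy => ?_⟩, hE1, hE2⟩
  · refine (congrArg IsMonomial (hE2 y hy)).mpr (h₂.replace hlt hy).right
  -- A replacement keeps the set of leaves, hence the smallest leaf of the tree grafted on `j`.
  · have : ∀ l, (Function.update s₁ j (graftAt 0 (y.graft s₂) Q') l).minLeaf = (s₁ l).minLeaf := by
      intro l
      by_cases hl : l = j
      · subst hl
        have hm : (y.graft s₂).minLeaf = (β₂.graft s₂).minLeaf := by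
          refine minLeaf_congr ?_
          rw [coe_leaves_graft, coe_leaves_graft, hy.2, h₂.left.isTreeOn.2]
        rw [Function.update_self, hs, graftAt, graftAt, minLeaf_graft, minLeaf_graft Q']
        congr 1
        refine relabel_congr fun l _ => ?_
        split_ifs
        · exact hm
        · rfl
      · rw [Function.update_of_ne hl]
    simp only [this]
    exact h₁.mono
  · refine (congrArg IsMonomial (hE1 x hx)).mpr (h₁.replace hlt hx).right
  · rw [graftAt, count_graft h₁.hole, if_pos rfl, count_graft (d := j), Function.update_self, hQ']
    · exact List.count_eq_one_of_mem hx.nodup (by rwa [hx.mem_iff, ← h₁.left.isTreeOn.mem_iff])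
    · intro l hl hlj
      rw [Function.update_of_ne hlj]
      exact hz x hx l hl hlj
    · intro l _ hl0
      rw [if_neg hl0, mem_leaves_leaf]; exact hl0.symm
  · rw [plug_eq, graftAt_graftAt, graftAt_eq_graft _ _ _ (hz x hx)]
  · rw [plug_eq, graftAt_graftAt, graftAt_eq_graft _ _ _ (hz x hx)]

/-- Two occurrences of nontrivial tree monomials in a tree monomial overlap or are independent. -/
theorem overlap_or_independent (hlt : IsAdmissible lt) {γ β₁ C₁ β₂ C₂ : OpTree X}
    {s₁ s₂ : ℕ → OpTree X} (h₁ : IsOccurrence β₁ γ C₁ s₁) (h₂ : IsOccurrence β₂ γ C₂ s₂)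
    (hs₁ : 0 < β₁.size) (hs₂ : 0 < β₂.size) :
    Overlap γ β₁ C₁ s₁ β₂ C₂ s₂ ∨ Independent β₁ C₁ s₁ β₂ C₂ s₂ := by
  -- The case in which the root of the second occurrence is at or below the root of the first one;
  -- it is used for both orders of the two.
  have nested : ∀ {β₁ C₁ β₂ C₂ Q : OpTree X} {s₁ s₂ : ℕ → OpTree X}, IsOccurrence β₁ γ C₁ s₁ →
      IsOccurrence β₂ γ C₂ s₂ → 0 < β₂.size → Q.leaves.count 0 = 1 → C₂ = graftAt 0 Q C₁ →
      β₁.graft s₁ = graftAt 0 (β₂.graft s₂) Q →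
      Overlap γ β₁ C₁ s₁ β₂ C₂ s₂ ∨ Independent β₁ C₁ s₁ β₂ C₂ s₂ := by
    intro β₁ C₁ β₂ C₂ Q s₁ s₂ h₁ h₂ hs₂ hQ hC he
    rcases nested_cases hQ he h₁.left.isTreeOn.nodup h₂.left.isTreeOn.nodup h₁.nodup_graft
      (h₁.zero_notMem_graft hlt h₁.left.isTreeOn) hs₂ with
      ⟨j, hj, Q', hQ', e1, e2⟩ | ⟨v, s', Q', t', w, g1, g2, g3, g4, g5, g6, g7, g8⟩
    · exact Or.inr (independent_of_below hlt h₁ h₂ hC hj hQ' e1 e2)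
    · exact Or.inl (overlap_of_join h₁ h₂ hC g1 g2 g3 g4 g5 g6 g7 g8)
  have he : graftAt 0 (β₁.graft s₁) C₁ = graftAt 0 (β₂.graft s₂) C₂ := by
    rw [← plug_eq, ← plug_eq, h₁.eq, h₂.eq]
  rcases compare_holes h₁.hole h₂.hole he with ⟨Q, hQ, hC, hT⟩ | ⟨Q, hQ, hC, hT⟩ |
    ⟨D₁, D₂, hD, hDD, e1, e2⟩
  · exact nested h₁ h₂ hs₂ hQ hC hT
  · exact (nested h₂ h₁ hs₁ hQ hC hT).imp Overlap.symm Independent.symm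
  · right
    have z₁ := fun x hx => h₁.zero_notMem_graft hlt (x := x) hx
    have z₂ := fun x hx => h₂.zero_notMem_graft hlt (x := x) hx
    have E1 : ∀ x, IsTreeOn (Finset.Icc 1 β₁.arity) x →
        graftAt 0 (x.graft s₁) (D₁ (β₂.graft s₂)) = plug C₁ s₁ x := fun x _ => by rw [e1]; rfl
    have E2 : ∀ y, IsTreeOn (Finset.Icc 1 β₂.arity) y →
        graftAt 0 (β₁.graft s₁) (D₁ (y.graft s₂)) = plug C₂ s₂ y := fun y hy => by
      rw [hDD _ _ (z₁ _ h₁.left.isTreeOn) (z₂ y hy), e2]; rfl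
    refine ⟨fun x y => graftAt 0 (x.graft s₁) (D₁ (y.graft s₂)),
      fun y hy => ⟨D₁ (y.graft s₂), s₁, ⟨h₁.left, ?_, (hD _ (z₂ y hy)).1, h₁.mono, rfl⟩,
        fun x hx => rfl⟩,
      fun x hx => ⟨D₂ (x.graft s₁), s₂, ⟨h₂.left, ?_, (hD _ (z₁ x hx)).2, h₂.mono, ?_⟩,
        fun y hy => ?_⟩, E1, E2⟩
    · refine (congrArg IsMonomial (E2 y hy)).mpr (h₂.replace hlt hy).right
    · refine (congrArg IsMonomial (E1 x hx)).mpr (h₁.replace hlt hx).right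
    · exact (hDD _ _ (z₁ x hx) (z₂ _ h₂.left.isTreeOn)).symm
    · exact (hDD _ _ (z₁ x hx) (z₂ y hy)).symm

end OpTree

/-! ### Multiples of a set and Buchberger's criterion -/

namespace ShuffleOperad

open OpTree

variable {k : Type*} [Field k] {X : ℕ → Type*} {lt : OpTree X → OpTree X → Prop}

theorem exists_isLeadingTerm (hlt : IsAdmissible lt) {f : OpTree X →₀ k} (hf : f ≠ 0)
    (hm : ∀ t ∈ f.support, IsMonomial t) : ∃ α, IsLeadingTerm lt f α := by
  have key : ∀ S : Finset (OpTree X), S.Nonempty → (∀ t ∈ S, IsMonomial t) →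
      ∃ α ∈ S, ∀ β ∈ S, β ≠ α → lt β α := by
    intro S hS
    induction hS using Finset.Nonempty.cons_induction with
    | singleton a =>
      intro _
      refine ⟨a, Finset.mem_singleton_self a, fun β hβ hne => ?_⟩
      exact absurd (Finset.mem_singleton.1 hβ) hne
    | cons a S ha hS ih =>
      intro hm
      simp only [Finset.mem_cons, forall_eq_or_imp] at hm
      obtain ⟨α, hα, h⟩ := ih hm.2
      rcases hlt.total a α hm.1 (hm.2 α hα) with h1 | h1 | h1
      · refine ⟨α, Finset.mem_cons_of_mem hα, fun β hβ hne => ?_⟩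
        rcases Finset.mem_cons.1 hβ with rfl | hβ
        · exact h1
        · exact h β hβ hne
      · exact absurd (h1 ▸ hα) ha
      · refine ⟨a, Finset.mem_cons_self _ _, fun β hβ hne => ?_⟩
        rcases Finset.mem_cons.1 hβ with rfl | hβ
        · exact absurd rfl hne
        · by_cases hβα : β = α
          · rwa [hβα]
          · exact hlt.trans β α a (hm.2 β hβ) (hm.2 α hα) hm.1 (h β hβ hβα) h1
  exact key f.support (Finsupp.support_nonempty_iff.2 hf) hm

theorem IsLeadingTerm.apply_ne_zero {f : OpTree X →₀ k} {α : OpTree X}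
    (h : IsLeadingTerm lt f α) : f α ≠ 0 := Finsupp.mem_support_iff.1 h.1

theorem IsLeadingTerm.unique (hlt : IsAdmissible lt) {f : OpTree X →₀ k} {α β : OpTree X}
    (hm : ∀ t ∈ f.support, IsMonomial t) (hα : IsLeadingTerm lt f α)
    (hβ : IsLeadingTerm lt f β) : α = β := by
  by_contra hne
  have h1 := hα.2 β hβ.1 (Ne.symm hne)
  have h2 := hβ.2 α hα.1 hne
  exact hlt.irrefl _ (hm _ hα.1) (hlt.trans _ _ _ (hm _ hα.1) (hm _ hβ.1) (hm _ hα.1) h2 h1)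

theorem isMonomial_of_mem_free {n : ℕ} {f : OpTree X →₀ k} (hf : f ∈ free k X n) :
    ∀ t ∈ f.support, IsMonomial t := fun t ht => (mem_free_iff.1 hf t ht).isMonomial

theorem IsLeadingTerm.arity_eq {n : ℕ} {f : OpTree X →₀ k} {α : OpTree X}
    (h : IsLeadingTerm lt f α) (hf : f ∈ free k X n) : α.arity = n :=
  (mem_free_iff.1 hf α h.1).arity

theorem mapDomain_plug_apply {g : OpTree X →₀ k} {α β C : OpTree X} {s : ℕ → OpTree X}
    (hg : g ∈ free k X β.arity) (h : IsOccurrence β α C s) :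
    Finsupp.mapDomain (plug C s) g α = g β := by
  rw [← h.eq]
  refine Finsupp.mapDomain_apply' {t | IsTreeOn (Finset.Icc 1 β.arity) t} g
    (fun t ht => mem_free_iff.1 hg t ht) ?_ h.left.isTreeOn
  exact fun t ht t' ht' e => h.plug_injOn ht ht' e

theorem mem_support_mapDomain_plug (hlt : IsAdmissible lt) {g : OpTree X →₀ k}
    {α β C : OpTree X} {s : ℕ → OpTree X} (hg : g ∈ free k X β.arity)
    (hβ : IsLeadingTerm lt g β) (h : IsOccurrence β α C s) {t : OpTree X}
    (ht : t ∈ (Finsupp.mapDomain (plug C s) g).support) :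
    IsTreeOn (Finset.Icc 1 α.arity) t ∧ (t = α ∨ lt t α) := by
  classical
  obtain ⟨u, hu, rfl⟩ := Finset.mem_image.1 (Finsupp.mapDomain_support ht)
  have hu' := mem_free_iff.1 hg u hu
  refine ⟨h.isTreeOn_plug hlt hu', ?_⟩
  by_cases hne : u = β
  · left; rw [hne, h.eq]
  · right
    have := h.plug_lt hlt hu' h.left.isTreeOn (hβ.2 u hu hne)
    rwa [h.eq] at this

/-- `p` is a multiple of an element of `G`, with leading term `δ`. -/
def IsMultiple (lt : OpTree X → OpTree X → Prop) (G : Set (OpTree X →₀ k)) (δ : OpTree X)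
    (p : OpTree X →₀ k) : Prop :=
  ∃ g ∈ G, ∃ β C s, g ∈ free k X β.arity ∧ IsLeadingTerm lt g β ∧ IsOccurrence β δ C s ∧
    p = Finsupp.mapDomain (plug C s) g

/-- The span of the multiples of elements of `G` of arity `N` with leading terms satisfying `P`. -/
noncomputable def multSpan (lt : OpTree X → OpTree X → Prop) (G : Set (OpTree X →₀ k)) (N : ℕ)
    (P : OpTree X → Prop) : Submodule k (OpTree X →₀ k) :=
  Submodule.span k {p | ∃ δ, δ.arity = N ∧ P δ ∧ IsMultiple lt G δ p}

variable {G : Set (OpTree X →₀ k)}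

theorem IsMultiple.isMonomial {δ : OpTree X} {p : OpTree X →₀ k} (h : IsMultiple lt G δ p) :
    IsMonomial δ := by
  obtain ⟨g, hg, β, C, s, h1, h2, h3, h4⟩ := h
  exact h3.right

theorem IsMultiple.mem_support (hlt : IsAdmissible lt) {δ : OpTree X} {p : OpTree X →₀ k}
    (h : IsMultiple lt G δ p) {t : OpTree X} (ht : t ∈ p.support) :
    IsTreeOn (Finset.Icc 1 δ.arity) t ∧ (t = δ ∨ lt t δ) := by
  obtain ⟨g, hg, β, C, s, h1, h2, h3, rfl⟩ := h
  exact mem_support_mapDomain_plug hlt h1 h2 h3 ht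

theorem IsMultiple.apply_ne_zero {δ : OpTree X} {p : OpTree X →₀ k}
    (h : IsMultiple lt G δ p) : p δ ≠ 0 := by
  obtain ⟨g, hg, β, C, s, h1, h2, h3, rfl⟩ := h
  rw [mapDomain_plug_apply h1 h3]
  exact h2.apply_ne_zero

theorem IsMultiple.mapDomain_plug {δ γ D : OpTree X} {w : ℕ → OpTree X} {p : OpTree X →₀ k}
    (h : IsMultiple lt G δ p) (h' : IsOccurrence δ γ D w) :
    IsMultiple lt G γ (Finsupp.mapDomain (plug D w) p) := by
  obtain ⟨g, hg, β, C, s, h1, h2, h3, rfl⟩ := h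
  obtain ⟨E, v, h4, h5⟩ := h3.trans h'
  refine ⟨g, hg, β, E, v, h1, h2, h4, ?_⟩
  rw [← Finsupp.mapDomain_comp]
  exact Finsupp.mapDomain_congr fun t _ => (h5 t).symm

theorem isMultiple_self {n : ℕ} {g : OpTree X →₀ k} (hg : g ∈ G) (hn : g ∈ free k X n)
    {β : OpTree X} (hβ : IsLeadingTerm lt g β) : IsMultiple lt G β g := by
  refine ⟨g, hg, β, leaf 0, leaf, by rwa [hβ.arity_eq hn], hβ,
    isOccurrence_refl (isMonomial_of_mem_free hn β hβ.1), ?_⟩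
  conv_lhs => rw [← Finsupp.mapDomain_id (v := g)]
  exact Finsupp.mapDomain_congr fun t _ => (plug_leaf_leaf t).symm

theorem multSpan_mono {N : ℕ} {P P' : OpTree X → Prop}
    (h : ∀ δ, IsMonomial δ → P δ → P' δ) : multSpan lt G N P ≤ multSpan lt G N P' := by
  refine Submodule.span_mono ?_
  rintro p ⟨δ, h1, h2, h3⟩
  exact ⟨δ, h1, h δ h3.isMonomial h2, h3⟩

theorem IsMultiple.mem_multSpan {P : OpTree X → Prop} {δ : OpTree X} {p : OpTree X →₀ k}
    (h : IsMultiple lt G δ p) (hP : P δ) : p ∈ multSpan lt G δ.arity P :=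
  Submodule.subset_span ⟨δ, rfl, hP, h⟩

theorem multSpan_support (hlt : IsAdmissible lt) {N : ℕ} {P : OpTree X → Prop}
    {f : OpTree X →₀ k} (hf : f ∈ multSpan lt G N P) :
    ∀ t ∈ f.support, IsTreeOn (Finset.Icc 1 N) t ∧ ∃ δ, IsMonomial δ ∧ P δ ∧ (t = δ ∨ lt t δ) := by
  have : multSpan lt G N P ≤ Finsupp.supported k k {t | IsTreeOn (Finset.Icc 1 N) t ∧
      ∃ δ, IsMonomial δ ∧ P δ ∧ (t = δ ∨ lt t δ)} := by
    refine Submodule.span_le.2 ?_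
    rintro p ⟨δ, rfl, h2, h3⟩
    refine (Finsupp.mem_supported k p).2 fun t ht => ?_
    obtain ⟨h4, h5⟩ := h3.mem_support hlt ht
    exact ⟨h4, δ, h3.isMonomial, h2, h5⟩
  exact fun t ht => (Finsupp.mem_supported k f).1 (this hf) ht

theorem lt_of_eq_or_lt_of_lt (hlt : IsAdmissible lt) {α β γ : OpTree X} (hα : IsMonomial α)
    (hβ : IsMonomial β) (hγ : IsMonomial γ) (h : α = β ∨ lt α β) (h' : lt β γ) : lt α γ := by
  rcases h with rfl | h
  · exact h'
  · exact hlt.trans α β γ hα hβ hγ h h'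

/-- Contexts compose and replacement is strictly increasing. This transports a representation of an
S-polynomial from a small common multiple to any monomial containing it. -/
theorem mapDomain_plug_mem_multSpan (hlt : IsAdmissible lt) {γ γ' D : OpTree X}
    {w : ℕ → OpTree X} (h : IsOccurrence γ γ' D w) {p : OpTree X →₀ k}
    (hp : p ∈ multSpan lt G γ.arity (lt · γ)) :
    Finsupp.mapDomain (plug D w) p ∈ multSpan lt G γ'.arity (lt · γ') := by
  have : multSpan lt G γ.arity (lt · γ) ≤
      (multSpan lt G γ'.arity (lt · γ')).comap (Finsupp.lmapDomain k k (plug D w)) := by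
    refine Submodule.span_le.2 ?_
    rintro p ⟨δ, h1, h2, h3⟩
    have hδ := h3.isMonomial.isTreeOn
    rw [h1] at hδ
    have h4 := h.replace hlt hδ
    refine Submodule.subset_span ⟨_, (h.isTreeOn_plug hlt hδ).arity, ?_, h3.mapDomain_plug h4⟩
    have := h.plug_lt hlt hδ h.left.isTreeOn h2
    rwa [h.eq] at this
  exact this hp

/-- All `S`-polynomials of `G` are combinations of multiples of elements of `G` with smaller leading
terms. -/
def SClosed (lt : OpTree X → OpTree X → Prop) (G : Set (OpTree X →₀ k)) : Prop :=
  ∀ f ∈ G, ∀ g ∈ G, ∀ α β γ, IsLeadingTerm lt f α → IsLeadingTerm lt g β →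
    γ.size < α.size + β.size → ∀ C s D t, IsOccurrence α γ C s → IsOccurrence β γ D t →
    Finsupp.mapDomain (plug C s) f - (f α / g β) • Finsupp.mapDomain (plug D t) g ∈
      multSpan lt G γ.arity (lt · γ)

/-- Let `E` also denote its bilinear extension. Expanding `E(f, g)` along `g` or along `f` gives `∑
g_y E(f, y) = ∑ f_x E(x, g)`. Isolating `y = β` and `x = α` expresses `g_β E(f, β) - f_α E(α, g)`
through multiples with leading monomials `E(x, β)` and `E(α, y)`, where `x ≠ α` and `y ≠ β`; these
are below `γ = E(α, β)`. -/
theorem independent_sub_mem (hlt : IsAdmissible lt) {f g : OpTree X →₀ k} (hf : f ∈ G)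
    (hg : g ∈ G) {α β γ C D : OpTree X} {s t : ℕ → OpTree X} (hfα : f ∈ free k X α.arity)
    (hgβ : g ∈ free k X β.arity) (hα : IsLeadingTerm lt f α) (hβ : IsLeadingTerm lt g β)
    (h₁ : IsOccurrence α γ C s) (h₂ : IsOccurrence β γ D t) (h : Independent α C s β D t) :
    Finsupp.mapDomain (plug C s) f - (f α / g β) • Finsupp.mapDomain (plug D t) g ∈
      multSpan lt G γ.arity (lt · γ) := by
  classical
  obtain ⟨E, hE₁, hE₂, hE₃, hE₄⟩ := h
  set W := multSpan lt G γ.arity (lt · γ)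
  have hfT := mem_free_iff.1 hfα
  have hgT := mem_free_iff.1 hgβ
  have e₁ : Finsupp.mapDomain (plug C s) f = Finsupp.mapDomain (fun x => E x β) f :=
    mapDomain_congr_of_mem_free hfα fun x hx => (hE₃ x hx).symm
  have e₂ : Finsupp.mapDomain (plug D t) g = Finsupp.mapDomain (fun y => E α y) g :=
    mapDomain_congr_of_mem_free hgβ fun y hy => (hE₄ y hy).symm
  have m₁ : ∀ y ∈ g.support.erase β, Finsupp.mapDomain (fun x => E x y) f ∈ W := by
    intro y hy
    have hy' := hgT y (Finset.mem_of_mem_erase hy)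
    obtain ⟨C', s', h1, h2⟩ := hE₁ y hy'
    have ha : (E α y).arity = γ.arity := by
      rw [hE₄ y hy', (h₂.isTreeOn_plug hlt hy').arity]
    have hm : IsMultiple lt G (E α y) (Finsupp.mapDomain (fun x => E x y) f) :=
      ⟨f, hf, α, C', s', hfα, hα, h1, mapDomain_congr_of_mem_free hfα fun x hx => (h2 x hx).symm⟩
    have hl : lt (E α y) γ := by
      rw [hE₄ y hy', ← h₂.eq]
      exact h₂.plug_lt hlt hy' h₂.left.isTreeOn
        (hβ.2 y (Finset.mem_of_mem_erase hy) (Finset.ne_of_mem_erase hy))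
    exact Submodule.subset_span ⟨_, ha, hl, hm⟩
  have m₂ : ∀ x ∈ f.support.erase α, Finsupp.mapDomain (fun y => E x y) g ∈ W := by
    intro x hx
    have hx' := hfT x (Finset.mem_of_mem_erase hx)
    obtain ⟨C', s', h1, h2⟩ := hE₂ x hx'
    have ha : (E x β).arity = γ.arity := by
      rw [hE₃ x hx', (h₁.isTreeOn_plug hlt hx').arity]
    have hm : IsMultiple lt G (E x β) (Finsupp.mapDomain (fun y => E x y) g) :=
      ⟨g, hg, β, C', s', hgβ, hβ, h1, mapDomain_congr_of_mem_free hgβ fun y hy => (h2 y hy).symm⟩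
    have hl : lt (E x β) γ := by
      rw [hE₃ x hx', ← h₁.eq]
      exact h₁.plug_lt hlt hx' h₁.left.isTreeOn
        (hα.2 x (Finset.mem_of_mem_erase hx) (Finset.ne_of_mem_erase hx))
    exact Submodule.subset_span ⟨_, ha, hl, hm⟩
  have double : ∑ y ∈ g.support, g y • Finsupp.mapDomain (fun x => E x y) f =
      ∑ x ∈ f.support, f x • Finsupp.mapDomain (fun y => E x y) g := by
    simp only [Finsupp.mapDomain, Finsupp.sum, Finset.smul_sum, Finsupp.smul_single, smul_eq_mul]
    rw [Finset.sum_comm]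
    exact Finset.sum_congr rfl fun x _ => Finset.sum_congr rfl fun y _ => by rw [mul_comm]
  rw [← Finset.add_sum_erase _ _ hβ.1, ← Finset.add_sum_erase _ _ hα.1] at double
  have key : g β • Finsupp.mapDomain (plug C s) f - f α • Finsupp.mapDomain (plug D t) g ∈ W := by
    rw [e₁, e₂]
    have : g β • Finsupp.mapDomain (fun x => E x β) f - f α • Finsupp.mapDomain (fun y => E α y) g =
        ∑ x ∈ f.support.erase α, f x • Finsupp.mapDomain (fun y => E x y) g -
        ∑ y ∈ g.support.erase β, g y • Finsupp.mapDomain (fun x => E x y) f := by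
      rw [sub_eq_sub_iff_add_eq_add, double]
      abel
    rw [this]
    exact W.sub_mem (W.sum_mem fun x hx => W.smul_mem _ (m₂ x hx))
      (W.sum_mem fun y hy => W.smul_mem _ (m₁ y hy))
  have := W.smul_mem (g β)⁻¹ key
  rwa [smul_sub, smul_smul, smul_smul, inv_mul_cancel₀ hβ.apply_ne_zero, one_smul,
    mul_comm, ← div_eq_mul_inv] at this

/-- The two divisors of `γ` overlap or are independent. The former case is the hypothesis on
S-polynomials placed in a context, the latter is `independent_sub_mem`. -/
theorem IsMultiple.sub_mem (hlt : IsAdmissible lt) (hS : SClosed lt G)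
    (hsize : ∀ g ∈ G, ∀ β, IsLeadingTerm lt g β → 0 < β.size) {γ : OpTree X}
    {p q : OpTree X →₀ k} (hp : IsMultiple lt G γ p) (hq : IsMultiple lt G γ q) :
    ∃ c : k, p - c • q ∈ multSpan lt G γ.arity (lt · γ) := by
  obtain ⟨f, hf, α, C, s, hfα, hα, h₁, rfl⟩ := hp
  obtain ⟨g, hg, β, D, t, hgβ, hβ, h₂, rfl⟩ := hq
  refine ⟨f α / g β, ?_⟩
  rcases overlap_or_independent hlt h₁ h₂ (hsize f hf α hα) (hsize g hg β hβ) with h | h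
  · obtain ⟨γ₀, B, w, E₁, v₁, E₂, v₂, g1, g2, g3, g4, g5, g6⟩ := h
    have := mapDomain_plug_mem_multSpan hlt g1 (hS f hf g hg α β γ₀ hα hβ g4 E₁ v₁ E₂ v₂ g2 g3)
    have e : Finsupp.mapDomain (plug B w) (Finsupp.mapDomain (plug E₁ v₁) f -
        (f α / g β) • Finsupp.mapDomain (plug E₂ v₂) g) = Finsupp.mapDomain (plug C s) f -
        (f α / g β) • Finsupp.mapDomain (plug D t) g := by
      have e₁ := mapDomain_congr_of_mem_free hfα g5
      have e₂ := mapDomain_congr_of_mem_free hgβ g6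
      rw [← e₁, ← e₂]
      have := map_sub (Finsupp.lmapDomain k k (plug B w)) (Finsupp.mapDomain (plug E₁ v₁) f)
        ((f α / g β) • Finsupp.mapDomain (plug E₂ v₂) g)
      rw [map_smul] at this
      simp only [Finsupp.lmapDomain_apply, ← Finsupp.mapDomain_comp] at this
      exact this
    rwa [e] at this
  · exact independent_sub_mem hlt hf hg hfα hgβ hα hβ h₁ h₂ h

/-- A combination involves finitely many multiples, and the largest of their leading monomials is a
bound. The empty combination has none, whence `f ≠ 0`. -/
theorem exists_bound_of_mem_multSpan (hlt : IsAdmissible lt) {N : ℕ} {P : OpTree X → Prop}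
    {f : OpTree X →₀ k} (hf : f ∈ multSpan lt G N P) (hf0 : f ≠ 0) :
    ∃ δ, IsMonomial δ ∧ P δ ∧ f ∈ multSpan lt G N fun ε => ε = δ ∨ lt ε δ := by
  have key : f = 0 ∨ ∃ δ, IsMonomial δ ∧ P δ ∧ f ∈ multSpan lt G N fun ε => ε = δ ∨ lt ε δ := by
    clear hf0
    induction hf using Submodule.span_induction with
    | mem p hp =>
      obtain ⟨δ, rfl, h2, h3⟩ := hp
      exact Or.inr ⟨δ, h3.isMonomial, h2, h3.mem_multSpan (Or.inl rfl)⟩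
    | zero => exact Or.inl rfl
    | add p q _ _ hp hq =>
      rcases hp with rfl | ⟨δ, h1, h2, h3⟩
      · rwa [zero_add]
      rcases hq with rfl | ⟨ε, h1', h2', h3'⟩
      · rw [add_zero]; exact Or.inr ⟨δ, h1, h2, h3⟩
      have aux : ∀ {δ ε : OpTree X}, IsMonomial δ → IsMonomial ε → lt δ ε →
          multSpan lt G N (fun η => η = δ ∨ lt η δ) ≤ multSpan lt G N fun η => η = ε ∨ lt η ε :=
        fun hδ hε h => multSpan_mono fun η hη h' =>
          Or.inr (lt_of_eq_or_lt_of_lt hlt hη hδ hε h' h)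
      rcases hlt.total δ ε h1 h1' with h | rfl | h
      · exact Or.inr ⟨ε, h1', h2', Submodule.add_mem _ (aux h1 h1' h h3) h3'⟩
      · exact Or.inr ⟨δ, h1, h2, Submodule.add_mem _ h3 h3'⟩
      · exact Or.inr ⟨δ, h1, h2, Submodule.add_mem _ h3 (aux h1' h1 h h3')⟩
    | smul c p _ hp =>
      rcases hp with rfl | ⟨δ, h1, h2, h3⟩
      · exact Or.inl (smul_zero c)
      · exact Or.inr ⟨δ, h1, h2, Submodule.smul_mem _ c h3⟩
  exact key.resolve_left hf0

/-- Well-founded induction on a bound `γ` for the leading monomials in a representation of `f`. All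
multiples with leading monomial exactly `γ` are merged into a scalar multiple of a single one; if
its coefficient vanishes, the bound drops. -/
theorem exists_multiple_at_leadingTerm (hlt : IsAdmissible lt)
    (hwf : WellFounded fun α β : {t : OpTree X // t.IsMonomial} => lt α.1 β.1)
    (hS : SClosed lt G) (hsize : ∀ g ∈ G, ∀ β, IsLeadingTerm lt g β → 0 < β.size) {N : ℕ}
    {f : OpTree X →₀ k} (hf : f ∈ multSpan lt G N fun _ => True) (hf0 : f ≠ 0) :
    ∃ δ, IsLeadingTerm lt f δ ∧ ∃ p, IsMultiple lt G δ p := by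
  have key : ∀ γ : {t : OpTree X // t.IsMonomial}, ∀ f : OpTree X →₀ k, f ≠ 0 →
      (f ∈ multSpan lt G N fun ε => ε = γ.1 ∨ lt ε γ.1) →
      ∃ δ, IsLeadingTerm lt f δ ∧ ∃ p, IsMultiple lt G δ p := by
    intro γ
    induction γ using hwf.induction with
    | _ γ ih =>
    obtain ⟨γ, hγ⟩ := γ
    intro f hf0 hf
    have lower : f ∈ multSpan lt G N (lt · γ) →
        ∃ δ, IsLeadingTerm lt f δ ∧ ∃ p, IsMultiple lt G δ p := by
      intro hl
      obtain ⟨ε, hε, hεγ, hfε⟩ := exists_bound_of_mem_multSpan hlt hl hf0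
      exact ih ⟨ε, hε⟩ hεγ f hf0 hfε
    -- If no multiple in arity `N` has leading monomial `γ`, the bound is strict from the outset.
    by_cases hex : γ.arity = N ∧ ∃ q, IsMultiple lt G γ q
    · obtain ⟨rfl, q, hq⟩ := hex
      have hc : ∃ c : k, f - c • q ∈ multSpan lt G γ.arity (lt · γ) := by
        clear lower hf0
        induction hf using Submodule.span_induction with
        | mem p hp =>
          obtain ⟨δ, h1, rfl | h2, h3⟩ := hp
          · exact h3.sub_mem hlt hS hsize hq
          · refine ⟨0, ?_⟩
            rw [zero_smul, sub_zero]
            exact Submodule.subset_span ⟨δ, h1, h2, h3⟩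
        | zero => exact ⟨0, by rw [zero_smul, sub_zero]; exact Submodule.zero_mem _⟩
        | add p p' _ _ hp hp' =>
          obtain ⟨c, hc⟩ := hp
          obtain ⟨c', hc'⟩ := hp'
          refine ⟨c + c', ?_⟩
          rw [add_smul, add_sub_add_comm]
          exact Submodule.add_mem _ hc hc'
        | smul a p _ hp =>
          obtain ⟨c, hc⟩ := hp
          refine ⟨a * c, ?_⟩
          rw [mul_smul, ← smul_sub]
          exact Submodule.smul_mem _ a hc
      obtain ⟨c, hc⟩ := hc
      by_cases hc0 : c = 0
      · rw [hc0, zero_smul, sub_zero] at hc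
        exact lower hc
      -- The remainder only has monomials below `γ`, so the coefficient of `f` at `γ` is `c * q γ`,
      -- which is nonzero.
      · refine ⟨γ, ⟨?_, ?_⟩, q, hq⟩
        · rw [Finsupp.mem_support_iff]
          intro hfγ
          have h1 : (f - c • q) γ ≠ 0 := by
            rw [Finsupp.sub_apply, hfγ, zero_sub, Finsupp.smul_apply, smul_eq_mul]
            exact neg_ne_zero.2 (mul_ne_zero hc0 hq.apply_ne_zero)
          obtain ⟨-, δ, hδ, h2, h3⟩ := multSpan_support hlt hc γ (Finsupp.mem_support_iff.2 h1)
          exact hlt.irrefl γ hγ (lt_of_eq_or_lt_of_lt hlt hγ hδ hγ h3 h2)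
        · intro t ht hne
          obtain ⟨h1, δ, hδ, h2, h3⟩ := multSpan_support hlt hf t ht
          rcases h2 with rfl | h2
          · exact h3.resolve_left hne
          · exact lt_of_eq_or_lt_of_lt hlt h1.isMonomial hδ hγ h3 h2
    · refine lower (Submodule.span_mono ?_ hf)
      rintro p ⟨δ, h1, rfl | h2, h3⟩
      · exact absurd ⟨h1, p, h3⟩ hex
      · exact ⟨δ, h1, h2, h3⟩
  obtain ⟨γ, hγ, -, h⟩ := exists_bound_of_mem_multSpan hlt hf hf0
  exact key ⟨γ, hγ⟩ f hf0 h

theorem compLin_eq_sum_right (i : ℕ) (σ : Equiv.Perm ℕ) (f g : OpTree X →₀ k) :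
    compLin i σ f g =
      ∑ β ∈ g.support, g β • Finsupp.mapDomain (fun t => OpTree.comp i σ t β) f := by
  simp only [compLin, Finsupp.sum, Finsupp.mapDomain, Finset.smul_sum, Finsupp.smul_single,
    smul_eq_mul]
  rw [Finset.sum_comm]
  exact Finset.sum_congr rfl fun x _ => Finset.sum_congr rfl fun y _ => by rw [mul_comm]

theorem compLin_eq_sum_left (i : ℕ) (σ : Equiv.Perm ℕ) (f g : OpTree X →₀ k) :
    compLin i σ f g =
      ∑ α ∈ f.support, f α • Finsupp.mapDomain (fun t => OpTree.comp i σ α t) g := by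
  simp only [compLin, Finsupp.sum, Finsupp.mapDomain, Finset.smul_sum, Finsupp.smul_single,
    smul_eq_mul]

/-- Composition with a fixed monomial is insertion into a context, which turns multiples into
multiples. By minimality, the ideal generated by `G` is therefore contained in this span. -/
theorem isShuffleIdeal_multSpan (hlt : IsAdmissible lt) :
    IsShuffleIdeal fun N => multSpan lt G N fun _ => True where
  le_free n f hf := mem_free_iff.2 fun t ht => (multSpan_support hlt hf t ht).1
  comp_left n m i σ hσ f hf g hg := by
    rw [compLin_eq_sum_right]
    refine Submodule.sum_mem _ fun β hβ => Submodule.smul_mem _ _ ?_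
    have hβ' := mem_free_iff.1 hg β hβ
    have : (multSpan lt G n fun _ => True) ≤ (multSpan lt G (n + m - 1) fun _ => True).comap
        (Finsupp.lmapDomain k k fun t => OpTree.comp i σ t β) := by
      refine Submodule.span_le.2 ?_
      rintro p ⟨δ, rfl, -, h3⟩
      have h4 := isOccurrence_comp_left hσ h3.isMonomial.isTreeOn hβ'
      refine Submodule.subset_span
        ⟨_, (isTreeOn_comp hσ h3.isMonomial.isTreeOn hβ').arity, trivial, ?_⟩
      exact h3.mapDomain_plug h4
    exact this hf
  comp_right n m i σ hσ f hf g hg := by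
    rw [compLin_eq_sum_left]
    refine Submodule.sum_mem _ fun α hα => Submodule.smul_mem _ _ ?_
    have hα' := mem_free_iff.1 hf α hα
    have : (multSpan lt G m fun _ => True) ≤ (multSpan lt G (n + m - 1) fun _ => True).comap
        (Finsupp.lmapDomain k k fun t => OpTree.comp i σ α t) := by
      refine Submodule.span_le.2 ?_
      rintro p ⟨δ, rfl, -, h3⟩
      obtain ⟨C, s, h4, h5⟩ := isOccurrence_comp_right hσ hα' h3.isMonomial.isTreeOn
      refine Submodule.subset_span
        ⟨_, (isTreeOn_comp hσ hα' h3.isMonomial.isTreeOn).arity, trivial, ?_⟩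
      have h6 := h3.mapDomain_plug h4
      rwa [Finsupp.mapDomain_congr fun t ht => h5 t (h3.mem_support hlt ht).1] at h6
    exact this hg

theorem containsSet_multSpan (hlt : IsAdmissible lt) :
    ContainsSet (fun N => multSpan lt G N fun _ => True) G := by
  intro n f hf hfn
  by_cases hf0 : f = 0
  · subst hf0; exact Submodule.zero_mem _
  · obtain ⟨α, hα⟩ := exists_isLeadingTerm hlt hf0 (isMonomial_of_mem_free hfn)
    have := (isMultiple_self hf hfn hα).mem_multSpan (P := fun _ => True) trivial
    rwa [hα.arity_eq hfn] at this

theorem filter_arity_mem {M : ℕ → Submodule k (OpTree X →₀ k)} (hM : ∀ n, M n ≤ free k X n)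
    {f : OpTree X →₀ k} (hf : f ∈ ⨆ n, M n) (N : ℕ) :
    f.filter (fun t => t.arity = N) ∈ M N := by
  induction hf using Submodule.iSup_induction' with
  | mem n f hf =>
    by_cases h : n = N
    · subst h
      rwa [(Finsupp.filter_eq_self_iff _ _).2 fun t ht =>
        (mem_free_iff.1 (hM n hf) t (Finsupp.mem_support_iff.2 ht)).arity]
    · rw [(Finsupp.filter_eq_zero_iff _ _).2 fun t ht => ?_]
      · exact Submodule.zero_mem _
      · by_contra h0
        exact h ((mem_free_iff.1 (hM n hf) t (Finsupp.mem_support_iff.2 h0)).arity.symm.trans ht)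
  | zero => rw [Finsupp.filter_zero]; exact Submodule.zero_mem _
  | add f g _ _ hf hg => rw [Finsupp.filter_add]; exact Submodule.add_mem _ hf hg

theorem isMonomial_of_mem_iSup {M : ℕ → Submodule k (OpTree X →₀ k)}
    (hM : ∀ n, M n ≤ free k X n) {f : OpTree X →₀ k} (hf : f ∈ ⨆ n, M n) :
    ∀ t ∈ f.support, IsMonomial t := by
  have : ⨆ n, M n ≤ Finsupp.supported k k {t | IsMonomial t} := iSup_le fun n f hf =>
    (Finsupp.mem_supported k f).2 fun t ht => isMonomial_of_mem_free (hM n hf) t ht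
  exact fun t ht => (Finsupp.mem_supported k f).1 (this hf) ht

/-- Buchberger's criterion. -/
theorem isGroebnerBasis_of_sClosed (hlt : IsAdmissible lt)
    (hwf : WellFounded fun α β : {t : OpTree X // t.IsMonomial} => lt α.1 β.1)
    {M : ℕ → Submodule k (OpTree X →₀ k)} (hG : IsHomogeneousSet G)
    (hM : GeneratesShuffleIdeal G M) (hS : SClosed lt G) : IsGroebnerBasis lt M G where
  homogeneous := hG
  generates := hM
  divides f hf hf0 := by
    have hle := hM.1.1.le_free
    have hmon := isMonomial_of_mem_iSup hle hf
    obtain ⟨α, hα⟩ := exists_isLeadingTerm hlt hf0 hmon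
    refine ⟨α, hα, ?_⟩
    -- A leading term without vertices falls outside the overlap analysis, but then it divides every
    -- monomial.
    by_cases hsize : ∀ g ∈ G, ∀ β, IsLeadingTerm lt g β → 0 < β.size
    -- An element of the sum may mix arities; its component in the arity of its leading term
    -- suffices.
    · have h1 := filter_arity_mem hle hf α.arity
      have hα' : IsLeadingTerm lt (f.filter fun t => t.arity = α.arity) α := by
        refine ⟨?_, fun β hβ hne => ?_⟩
        · rw [Finsupp.support_filter, Finset.mem_filter]
          exact ⟨hα.1, rfl⟩
        · rw [Finsupp.support_filter, Finset.mem_filter] at hβ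
          exact hα.2 β hβ.1 hne
      have h2 := hM.2 ⟨isShuffleIdeal_multSpan hlt, containsSet_multSpan hlt⟩ _ h1
      have h3 : (f.filter fun t => t.arity = α.arity) ≠ 0 := fun h =>
        hα'.apply_ne_zero (by rw [h, Finsupp.zero_apply])
      obtain ⟨δ, hδ, p, g, hg, β, C, s, -, hβ, hocc, -⟩ :=
        exists_multiple_at_leadingTerm hlt hwf hS hsize h2 h3
      obtain rfl := hα'.unique hlt (isMonomial_of_mem_free (hle _ h1)) hδ
      exact ⟨g, hg, β, hβ, C, s, hocc⟩
    · push Not at hsize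
      obtain ⟨g, hg, β, hβ, h0⟩ := hsize
      obtain ⟨n, hn⟩ := hG g hg
      obtain ⟨l, rfl⟩ := size_eq_zero_iff.1 (Nat.le_zero.1 h0)
      have hl := (isMonomial_of_mem_free hn _ hβ.1).isTreeOn.mem_iff.1 (mem_leaves_leaf.2 rfl)
      have hl1 : l = 1 := by simpa [OpTree.arity, leaves] using hl
      subst hl1
      exact ⟨g, hg, leaf 1, hβ, _, _, isOccurrence_leaf (hmon α hα.1)⟩

end ShuffleOperad

/-! ### Buchberger's algorithm -/

namespace ShuffleOperad

open OpTree

variable {k : Type*} [Field k] {X : ℕ → Type*} {lt : OpTree X → OpTree X → Prop}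

theorem compLin_mem_free {n m i : ℕ} {σ : Equiv.Perm ℕ} (hσ : IsShufflePerm n m i σ)
    {f g : OpTree X →₀ k} (hf : f ∈ free k X n) (hg : g ∈ free k X m) :
    compLin i σ f g ∈ free k X (n + m - 1) := by
  refine Submodule.sum_mem _ fun α hα => Submodule.sum_mem _ fun β hβ => mem_free_iff.2 fun t ht => ?_
  rw [Finset.mem_singleton.1 (Finsupp.support_single_subset ht)]
  exact isTreeOn_comp hσ (mem_free_iff.1 hf α hα) (mem_free_iff.1 hg β hβ)

theorem isShuffleIdeal_free : IsShuffleIdeal (free k X) where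
  le_free _ := le_rfl
  comp_left _ _ _ _ hσ _ hf _ hg := compLin_mem_free hσ hf hg
  comp_right _ _ _ _ hσ _ hf _ hg := compLin_mem_free hσ hf hg

section Invariants

variable {M : ℕ → Submodule k (OpTree X →₀ k)}

theorem CancelsAt.mem (hlt : IsAdmissible lt) (hM : IsShuffleIdeal M) {f g h : OpTree X →₀ k}
    {α : OpTree X} {n m : ℕ} (hf : f ∈ M n) (hg : g ∈ M m) (hc : CancelsAt lt g f α h) :
    h ∈ M n := by
  obtain ⟨hα, β, hβ, C, s, hocc, rfl⟩ := hc
  have h1 := (mem_free_iff.1 (hM.le_free n hf) α hα).arity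
  have h2 := (isOperation_plug hlt hocc).ideal M hM g (by
    rwa [hβ.arity_eq (hM.le_free m hg)])
  rw [h1] at h2
  exact Submodule.sub_mem _ hf (Submodule.smul_mem _ _ h2)

theorem exists_mem_of_critical (hlt : IsAdmissible lt) (hM : IsShuffleIdeal M)
    {K : Set (OpTree X →₀ k)} (hK : ∀ f ∈ K, ∃ n, f ∈ M n) {h : OpTree X →₀ k}
    (hh : h ∈ critical lt K) : ∃ n, h ∈ M n := by
  obtain ⟨f, hf, g, hg, ⟨α, -, hc⟩ | ⟨α, β, γ, hα, hβ, -, C, s, D, t, h1, h2, rfl⟩⟩ := hh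
  · obtain ⟨n, hn⟩ := hK f hf
    obtain ⟨m, hm⟩ := hK g hg
    exact ⟨n, hc.mem hlt hM hn hm⟩
  · obtain ⟨n, hn⟩ := hK f hf
    obtain ⟨m, hm⟩ := hK g hg
    refine ⟨γ.arity, Submodule.sub_mem _ ?_ (Submodule.smul_mem _ _ ?_)⟩
    · exact (isOperation_plug hlt h1).ideal M hM f (by rwa [hα.arity_eq (hM.le_free n hn)])
    · exact (isOperation_plug hlt h2).ideal M hM g (by rwa [hβ.arity_eq (hM.le_free m hm)])

theorem mem_of_reflTransGen (hlt : IsAdmissible lt) (hM : IsShuffleIdeal M)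
    {K : Set (OpTree X →₀ k)} (hK : ∀ f ∈ K, ∃ n, f ∈ M n) {p q : OpTree X →₀ k} {n : ℕ}
    (hp : p ∈ M n)
    (h : Relation.ReflTransGen (fun p q => ∃ g ∈ K, ∃ α, CancelsAt lt g p α q) p q) : q ∈ M n := by
  induction h with
  | refl => exact hp
  | tail _ h ih =>
    obtain ⟨g, hg, α, hc⟩ := h
    obtain ⟨m, hm⟩ := hK g hg
    exact hc.mem hlt hM ih hm

/-- Reductions and S-polynomials are formed by replacements, which preserve ideals. This serves
twice: for the given ideal, and for `free k X`, where it says that homogeneity persists. -/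
theorem IsBuchbergerStep.exists_mem (hlt : IsAdmissible lt) (hM : IsShuffleIdeal M)
    {K K' : Set (OpTree X →₀ k)} (hK : ∀ f ∈ K, ∃ n, f ∈ M n) (h : IsBuchbergerStep lt K K') :
    ∀ f ∈ K', ∃ n, f ∈ M n := by
  obtain ⟨R, -, hR, rfl⟩ := h
  rintro f (hf | ⟨hf, -⟩)
  · exact hK f hf
  · obtain ⟨p, hp, hred, -⟩ := hR f hf
    obtain ⟨n, hn⟩ := exists_mem_of_critical hlt hM hK hp
    exact ⟨n, mem_of_reflTransGen hlt hM hK hn hred⟩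

end Invariants

/-- The subtracted multiple has leading monomial `α`, a monomial of `p` and hence below `γ`. It does
not matter whether `α` is the leading one, so reducing other terms is harmless. -/
theorem CancelsAt.sub_mem_multSpan (hlt : IsAdmissible lt) {G : Set (OpTree X →₀ k)}
    {γ : OpTree X} (hγ : IsMonomial γ) {p q g : OpTree X →₀ k} (hg : g ∈ G) {m : ℕ}
    (hgm : g ∈ free k X m)
    (hp : ∀ t ∈ p.support, IsTreeOn (Finset.Icc 1 γ.arity) t ∧ lt t γ) {α : OpTree X}
    (hc : CancelsAt lt g p α q) :
    p - q ∈ multSpan lt G γ.arity (lt · γ) ∧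
      ∀ t ∈ q.support, IsTreeOn (Finset.Icc 1 γ.arity) t ∧ lt t γ := by
  obtain ⟨hα, β, hβ, C, s, hocc, rfl⟩ := hc
  have hgβ : g ∈ free k X β.arity := by rwa [hβ.arity_eq hgm]
  obtain ⟨hα1, hα2⟩ := hp α hα
  have hm : IsMultiple lt G α (Finsupp.mapDomain (plug C s) g) :=
    ⟨g, hg, β, C, s, hgβ, hβ, hocc, rfl⟩
  constructor
  · rw [sub_sub_cancel]
    refine Submodule.smul_mem _ _ ?_
    have := hm.mem_multSpan (P := (lt · γ)) hα2
    rwa [hα1.arity] at this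
  · intro t ht
    classical
    rcases Finset.mem_union.1 (Finsupp.support_sub ht) with h | h
    · exact hp t h
    · obtain ⟨h1, h2⟩ := hm.mem_support hlt (Finsupp.support_smul h)
      rw [hα1.arity] at h1
      exact ⟨h1, lt_of_eq_or_lt_of_lt hlt h1.isMonomial hα1.isMonomial hγ h2 hα2⟩

theorem sub_mem_multSpan_of_reflTransGen (hlt : IsAdmissible lt) {K G : Set (OpTree X →₀ k)}
    (hKG : K ⊆ G) (hK : IsHomogeneousSet K) {γ : OpTree X} (hγ : IsMonomial γ)
    {p q : OpTree X →₀ k} (hp : ∀ t ∈ p.support, IsTreeOn (Finset.Icc 1 γ.arity) t ∧ lt t γ)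
    (h : Relation.ReflTransGen (fun p q => ∃ g ∈ K, ∃ α, CancelsAt lt g p α q) p q) :
    p - q ∈ multSpan lt G γ.arity (lt · γ) ∧
      ∀ t ∈ q.support, IsTreeOn (Finset.Icc 1 γ.arity) t ∧ lt t γ := by
  induction h with
  | refl => rw [sub_self]; exact ⟨Submodule.zero_mem _, hp⟩
  | tail _ h ih =>
    obtain ⟨g, hg, α, hc⟩ := h
    obtain ⟨m, hm⟩ := hK g hg
    obtain ⟨h1, h2⟩ := hc.sub_mem_multSpan hlt hγ (hKG hg) hm ih.2
    refine ⟨?_, h2⟩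
    have := Submodule.add_mem _ ih.1 h1
    rwa [sub_add_sub_cancel] at this

/-- Both parts have leading monomial `γ`, and the quotient of coefficients is chosen to cancel it.
-/
theorem sPolynomial_support (hlt : IsAdmissible lt) {f g : OpTree X →₀ k}
    {α β γ C D : OpTree X} {s t : ℕ → OpTree X} (hfα : f ∈ free k X α.arity)
    (hgβ : g ∈ free k X β.arity) (hα : IsLeadingTerm lt f α) (hβ : IsLeadingTerm lt g β)
    (h₁ : IsOccurrence α γ C s) (h₂ : IsOccurrence β γ D t) :
    ∀ u ∈ (Finsupp.mapDomain (plug C s) f -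
      (f α / g β) • Finsupp.mapDomain (plug D t) g).support,
      IsTreeOn (Finset.Icc 1 γ.arity) u ∧ lt u γ := by
  classical
  intro u hu
  have h : IsTreeOn (Finset.Icc 1 γ.arity) u ∧ (u = γ ∨ lt u γ) := by
    rcases Finset.mem_union.1 (Finsupp.support_sub hu) with h | h
    · exact mem_support_mapDomain_plug hlt hfα hα h₁ h
    · exact mem_support_mapDomain_plug hlt hgβ hβ h₂ (Finsupp.support_smul h)
  refine ⟨h.1, h.2.resolve_left ?_⟩
  rintro rfl
  rw [Finsupp.mem_support_iff, Finsupp.sub_apply, Finsupp.smul_apply, mapDomain_plug_apply hfα h₁,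
    mapDomain_plug_apply hgβ h₂, smul_eq_mul, div_mul_cancel₀ _ hβ.apply_ne_zero, sub_self] at hu
  exact hu rfl

/-- Each reduction of the leading term leaves smaller monomials only, so reducing leading terms
stops by well-foundedness. -/
theorem exists_isReducedForm (hlt : IsAdmissible lt)
    (hwf : WellFounded fun α β : {t : OpTree X // t.IsMonomial} => lt α.1 β.1)
    {K : Set (OpTree X →₀ k)} (hK : IsHomogeneousSet K) {n : ℕ} {p : OpTree X →₀ k}
    (hp : p ∈ free k X n) : ∃ h, IsReducedForm lt K p h := by
  have zero : IsReducedForm lt K 0 0 := by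
    refine ⟨Relation.ReflTransGen.refl, ?_⟩
    rintro ⟨g, -, q, α, hα, -⟩
    exact hα.apply_ne_zero rfl
  have key : ∀ γ : {t : OpTree X // t.IsMonomial}, ∀ p : OpTree X →₀ k, p ∈ free k X n →
      IsLeadingTerm lt p γ.1 → ∃ h, IsReducedForm lt K p h := by
    intro γ
    induction γ using hwf.induction with
    | _ γ ih =>
    obtain ⟨γ, hγ⟩ := γ
    intro p hp hlead
    by_cases hred : ∃ g ∈ K, ∃ q, IsReduction lt g p q
    · obtain ⟨g, hg, q, α, hα, hc⟩ := hred
      obtain ⟨m, hm⟩ := hK g hg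
      obtain rfl := hα.unique hlt (isMonomial_of_mem_free hp) hlead
      have hstep : ∃ g ∈ K, ∃ α, CancelsAt lt g p α q := ⟨g, hg, α, hc⟩
      have hq := hc.mem hlt isShuffleIdeal_free hp hm
      have hqlt : ∀ t ∈ q.support, lt t α := by
        obtain ⟨-, β, hβ, C, s, hocc, rfl⟩ := hc
        have hgβ : g ∈ free k X β.arity := by rwa [hβ.arity_eq hm]
        intro t ht
        have h : t = α ∨ lt t α := by
          classical
          rcases Finset.mem_union.1 (Finsupp.support_sub ht) with h | h
          · exact or_iff_not_imp_left.2 fun hne => hα.2 t h hne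
          · exact (mem_support_mapDomain_plug hlt hgβ hβ hocc (Finsupp.support_smul h)).2
        refine h.resolve_left ?_
        rintro rfl
        rw [Finsupp.mem_support_iff, Finsupp.sub_apply, Finsupp.smul_apply,
          mapDomain_plug_apply hgβ hocc, smul_eq_mul, div_mul_cancel₀ _ hβ.apply_ne_zero,
          sub_self] at ht
        exact ht rfl
      by_cases hq0 : q = 0
      · subst hq0
        exact ⟨0, Relation.ReflTransGen.single hstep, zero.2⟩
      · obtain ⟨δ, hδ⟩ := exists_isLeadingTerm hlt hq0 (isMonomial_of_mem_free hq)
        obtain ⟨h, h1, h2⟩ := ih ⟨δ, isMonomial_of_mem_free hq δ hδ.1⟩ (hqlt δ hδ.1) q hq hδ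
        exact ⟨h, Relation.ReflTransGen.head hstep h1, h2⟩
    · exact ⟨p, Relation.ReflTransGen.refl, hred⟩
  by_cases hp0 : p = 0
  · exact ⟨0, hp0 ▸ zero⟩
  · obtain ⟨α, hα⟩ := exists_isLeadingTerm hlt hp0 (isMonomial_of_mem_free hp)
    exact key ⟨α, isMonomial_of_mem_free hp α hα.1⟩ p hp hα

theorem exists_isBuchbergerStep (hlt : IsAdmissible lt)
    (hwf : WellFounded fun α β : {t : OpTree X // t.IsMonomial} => lt α.1 β.1)
    {K : Set (OpTree X →₀ k)} (hK : IsHomogeneousSet K) : ∃ K', IsBuchbergerStep lt K K' := by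
  -- One may take all reduced forms of all critical elements at once.
  refine ⟨_, {h | ∃ f ∈ critical lt K, IsReducedForm lt K f h}, fun f hf => ?_, fun h hh => hh, rfl⟩
  obtain ⟨n, hn⟩ := exists_mem_of_critical hlt isShuffleIdeal_free hK hf
  obtain ⟨h, hh⟩ := exists_isReducedForm hlt hwf hK hn
  exact ⟨h, ⟨f, hf, hh⟩, hh⟩

theorem exists_isBuchbergerOutput (hlt : IsAdmissible lt)
    (hwf : WellFounded fun α β : {t : OpTree X // t.IsMonomial} => lt α.1 β.1)
    {K : Set (OpTree X →₀ k)} (hK : IsHomogeneousSet K) : ∃ G, IsBuchbergerOutput lt K G := by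
  -- Homogeneity is carried along, because the existence of the next round depends on it.
  have step : ∀ K : {K : Set (OpTree X →₀ k) // IsHomogeneousSet K},
      ∃ K' : {K : Set (OpTree X →₀ k) // IsHomogeneousSet K}, IsBuchbergerStep lt K.1 K'.1 := by
    rintro ⟨K, hK⟩
    obtain ⟨K', hK'⟩ := exists_isBuchbergerStep hlt hwf hK
    exact ⟨⟨K', hK'.exists_mem hlt isShuffleIdeal_free hK⟩, hK'⟩
  choose next hnext using step
  let S : ℕ → {K : Set (OpTree X →₀ k) // IsHomogeneousSet K} := fun i => next^[i] ⟨K, hK⟩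
  refine ⟨_, fun i => (S i).1, rfl, fun i => ?_, rfl⟩
  have : S (i + 1) = next (S i) := Function.iterate_succ_apply' _ _ _
  show IsBuchbergerStep lt (S i).1 (S (i + 1)).1
  rw [this]
  exact hnext _

theorem IsBuchbergerStep.subset {K K' : Set (OpTree X →₀ k)} (h : IsBuchbergerStep lt K K') :
    K ⊆ K' := by
  obtain ⟨R, -, -, rfl⟩ := h
  exact Set.subset_union_left

/-- The ideal generated does not change, so only the criterion is at stake. An S-polynomial differs
from its reduced form by multiples with leading monomials below `γ`, and the reduced form, if
nonzero, is itself a multiple of this kind, being joined in the next round. -/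
theorem IsBuchbergerOutput.isGroebnerBasis (hlt : IsAdmissible lt)
    (hwf : WellFounded fun α β : {t : OpTree X // t.IsMonomial} => lt α.1 β.1)
    {M : ℕ → Submodule k (OpTree X →₀ k)} {K G : Set (OpTree X →₀ k)} (hK : IsHomogeneousSet K)
    (hM : GeneratesShuffleIdeal K M) (h : IsBuchbergerOutput lt K G) : IsGroebnerBasis lt M G := by
  obtain ⟨S, hS0, hS, rfl⟩ := h
  have hmono : Monotone S := monotone_nat_of_le_succ fun i => (hS i).subset
  have inv : ∀ N : ℕ → Submodule k (OpTree X →₀ k), IsShuffleIdeal N →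
      (∀ f ∈ K, ∃ n, f ∈ N n) → ∀ i, ∀ f ∈ S i, ∃ n, f ∈ N n := by
    intro N hN h i
    induction i with
    | zero => rwa [hS0]
    | succ i ih => exact (hS i).exists_mem hlt hN ih
  have hhom : ∀ i, IsHomogeneousSet (S i) := inv (free k X) isShuffleIdeal_free hK
  refine isGroebnerBasis_of_sClosed hlt hwf ?_ ⟨⟨hM.1.1, ?_⟩, ?_⟩ ?_
  · intro f hf
    obtain ⟨i, hi⟩ := Set.mem_iUnion.1 hf
    exact hhom i f hi
  · intro n f hf hfn
    obtain ⟨i, hi⟩ := Set.mem_iUnion.1 hf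
    obtain ⟨m, hm⟩ := inv M hM.1.1 (fun f hf => by
      obtain ⟨n, hn⟩ := hK f hf
      exact ⟨n, hM.1.2 n f hf hn⟩) i f hi
    -- Membership is known in some arity `m`; for nonzero `f`, any of its monomials shows that `m =
    -- n`.
    by_cases hf0 : f = 0
    · rw [hf0]; exact Submodule.zero_mem _
    · obtain ⟨t, ht⟩ := Finsupp.support_nonempty_iff.2 hf0
      have h1 := (mem_free_iff.1 hfn t ht).arity
      have h2 := (mem_free_iff.1 (hM.1.1.le_free m hm) t ht).arity
      rwa [← h1, h2]
  · intro N hN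
    refine hM.2 ⟨hN.1, fun n f hf hfn => hN.2 n f ?_ hfn⟩
    exact Set.mem_iUnion.2 ⟨0, by rwa [hS0]⟩
  · intro f hf g hg α β γ hα hβ hsize C s D t h₁ h₂
    obtain ⟨i, hi⟩ := Set.mem_iUnion.1 hf
    obtain ⟨j, hj⟩ := Set.mem_iUnion.1 hg
    -- The rounds increase, so both elements lie in a common one.
    replace hi := hmono (le_max_left i j) hi
    replace hj := hmono (le_max_right i j) hj
    generalize max i j = l at hi hj
    obtain ⟨nf, hnf⟩ := hhom l f hi
    obtain ⟨ng, hng⟩ := hhom l g hj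
    have hfα : f ∈ free k X α.arity := by rwa [hα.arity_eq hnf]
    have hgβ : g ∈ free k X β.arity := by rwa [hβ.arity_eq hng]
    have hsupp := sPolynomial_support hlt hfα hgβ hα hβ h₁ h₂
    obtain ⟨R, hR, -, hSl⟩ := hS l
    obtain ⟨r, hr, hred, -⟩ := hR _ ⟨f, hi, g, hj, Or.inr
      ⟨α, β, γ, hα, hβ, hsize, C, s, D, t, h₁, h₂, rfl⟩⟩
    obtain ⟨h3, h4⟩ := sub_mem_multSpan_of_reflTransGen (G := ⋃ i, S i) hlt
      (Set.subset_iUnion S l) (hhom l) h₁.right hsupp hred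
    have h5 : r ∈ multSpan lt (⋃ i, S i) γ.arity (lt · γ) := by
      by_cases hr0 : r = 0
      · rw [hr0]; exact Submodule.zero_mem _
      · have hrG : r ∈ ⋃ i, S i := Set.mem_iUnion.2 ⟨l + 1, by rw [hSl]; exact Or.inr ⟨hr, hr0⟩⟩
        have hrn : r ∈ free k X γ.arity := mem_free_iff.2 fun t ht => (h4 t ht).1
        obtain ⟨δ, hδ⟩ := exists_isLeadingTerm hlt hr0 (isMonomial_of_mem_free hrn)
        have := (isMultiple_self hrG hrn hδ).mem_multSpan (P := (lt · γ)) (h4 δ hδ.1).2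
        rwa [hδ.arity_eq hrn] at this
    have := Submodule.add_mem _ h3 h5
    rwa [sub_add_cancel] at this

end ShuffleOperad

/-! ### Expansion of planar trees through shuffle trees -/

namespace ShuffleOperad

open OpTree

variable {k : Type*} [Field k] {X : ℕ → Type*}

/-- The linear combination of the trees `node y u` with coefficients taken from `v` and `p`. -/
noncomputable def nodeLin {n : ℕ} (v : X (n + 1) →₀ k) (p : Fin (n + 1) → OpTree X →₀ k) :
    OpTree X →₀ k :=
  v.sum fun y a => ∑ u ∈ Fintype.piFinset fun j => (p j).support,
    Finsupp.single (node y u) (a * ∏ j, p j (u j))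

theorem nodeLin_apply_node {n : ℕ} (v : X (n + 1) →₀ k) (p : Fin (n + 1) → OpTree X →₀ k)
    (y : X (n + 1)) (u : Fin (n + 1) → OpTree X) :
    nodeLin v p (node y u) = v y * ∏ j, p j (u j) := by
  classical
  have inner : ∀ (y' : X (n + 1)) (a : k), (∑ u' ∈ Fintype.piFinset fun j => (p j).support,
      Finsupp.single (node y' u') (a * ∏ j, p j (u' j))) (node y u) =
        if y' = y then a * ∏ j, p j (u j) else 0 := by
    intro y' a
    rw [Finsupp.finsetSum_apply]
    by_cases hy : y' = y
    · subst hy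
      rw [if_pos rfl, Finset.sum_eq_single u]
      · rw [Finsupp.single_eq_same]
      · intro u' _ hu'
        refine Finsupp.single_eq_of_ne fun h => hu' ?_
        simpa using h.symm
      · intro hu
        rw [Fintype.mem_piFinset] at hu
        push Not at hu
        obtain ⟨j, hj⟩ := hu
        rw [Finsupp.single_eq_same]
        exact mul_eq_zero_of_right _
          (Finset.prod_eq_zero (Finset.mem_univ j) (Finsupp.notMem_support_iff.1 hj))
    · rw [if_neg hy]
      refine Finset.sum_eq_zero fun u' _ => Finsupp.single_eq_of_ne fun h => hy ?_
      simp only [node.injEq, heq_eq_eq, true_and] at h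
      exact h.1.symm
  rw [nodeLin, Finsupp.sum_apply]
  simp only [inner]
  rw [Finsupp.sum, Finset.sum_eq_single y]
  · rw [if_pos rfl]
  · intro y' _ hy'; rw [if_neg hy']
  · intro hy; rw [if_pos rfl, Finsupp.notMem_support_iff.1 hy, zero_mul]

theorem nodeLin_apply_of_ne {n : ℕ} (v : X (n + 1) →₀ k) (p : Fin (n + 1) → OpTree X →₀ k)
    {t : OpTree X} (ht : ∀ y u, t ≠ @node X n y u) : nodeLin v p t = 0 := by
  rw [nodeLin, Finsupp.sum_apply]
  refine Finset.sum_eq_zero fun y _ => ?_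
  show (∑ u ∈ _, Finsupp.single _ _ : OpTree X →₀ k) t = 0
  rw [Finsupp.finsetSum_apply]
  exact Finset.sum_eq_zero fun u _ => Finsupp.single_eq_of_ne (ht y u)

/-- Coefficients determine `nodeLin`, and they are products; this gives multilinearity without
handling the varying supports. -/
theorem nodeLin_ext {n : ℕ} {q : OpTree X →₀ k} {v : X (n + 1) →₀ k}
    {p : Fin (n + 1) → OpTree X →₀ k} (h₁ : ∀ y u, q (node y u) = v y * ∏ j, p j (u j))
    (h₂ : ∀ t, (∀ y u, t ≠ @node X n y u) → q t = 0) : nodeLin v p = q := by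
  ext t
  by_cases ht : ∃ y u, t = @node X n y u
  · obtain ⟨y, u, rfl⟩ := ht
    rw [nodeLin_apply_node, h₁]
  · push Not at ht
    rw [nodeLin_apply_of_ne v p ht, h₂ t ht]

theorem mem_support_nodeLin {n : ℕ} {v : X (n + 1) →₀ k} {p : Fin (n + 1) → OpTree X →₀ k}
    {t : OpTree X} (ht : t ∈ (nodeLin v p).support) :
    ∃ y u, t = @node X n y u ∧ ∀ j, u j ∈ (p j).support := by
  rw [Finsupp.mem_support_iff] at ht
  by_cases h : ∃ y u, t = @node X n y u
  · obtain ⟨y, u, rfl⟩ := h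
    refine ⟨y, u, rfl, fun j => Finsupp.mem_support_iff.2 fun h0 => ht ?_⟩
    rw [nodeLin_apply_node, Finset.prod_eq_zero (Finset.mem_univ j) h0, mul_zero]
  · push Not at h
    exact absurd (nodeLin_apply_of_ne v p h) ht

theorem prod_update_apply {n : ℕ} (p : Fin (n + 1) → OpTree X →₀ k) (i : Fin (n + 1))
    (q : OpTree X →₀ k) (u : Fin (n + 1) → OpTree X) :
    ∏ j, Function.update p i q j (u j) = q (u i) * ∏ j ∈ Finset.univ.erase i, p j (u j) := by
  rw [← Finset.mul_prod_erase _ _ (Finset.mem_univ i), Function.update_self]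
  congr 1
  exact Finset.prod_congr rfl fun j hj => by rw [Function.update_of_ne (Finset.ne_of_mem_erase hj)]

/-- `nodeLin` as a multilinear map. -/
noncomputable def nodeMultilinear {n : ℕ} (v : X (n + 1) →₀ k) :
    MultilinearMap k (fun _ : Fin (n + 1) => OpTree X →₀ k) (OpTree X →₀ k) where
  toFun := nodeLin v
  map_update_add' := by
    intro inst p i q q'
    -- The field is stated for an arbitrary decidability instance; the computation uses the standard
    -- one.
    obtain rfl : inst = instDecidableEqFin _ := Subsingleton.elim _ _
    refine nodeLin_ext (fun y u => ?_) fun t ht => ?_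
    · simp only [Finsupp.add_apply, nodeLin_apply_node, prod_update_apply]
      ring
    · simp only [Finsupp.add_apply, nodeLin_apply_of_ne _ _ ht, add_zero]
  map_update_smul' := by
    intro inst p i c q
    obtain rfl : inst = instDecidableEqFin _ := Subsingleton.elim _ _
    refine nodeLin_ext (fun y u => ?_) fun t ht => ?_
    · simp only [Finsupp.smul_apply, nodeLin_apply_node, prod_update_apply, smul_eq_mul]
      ring
    · simp only [Finsupp.smul_apply, nodeLin_apply_of_ne _ _ ht, smul_zero]

theorem nodeMultilinear_apply {n : ℕ} (v : X (n + 1) →₀ k) (p : Fin (n + 1) → OpTree X →₀ k) :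
    nodeMultilinear v p = nodeLin v p := rfl

theorem nodeLin_sum_smul {n : ℕ} {ι : Type*} (S : Finset ι) (a : ι → k)
    (v : ι → X (n + 1) →₀ k) (p : Fin (n + 1) → OpTree X →₀ k) :
    nodeLin (∑ i ∈ S, a i • v i) p = ∑ i ∈ S, a i • nodeLin (v i) p := by
  refine nodeLin_ext (fun y u => ?_) fun t ht => ?_
  · simp only [Finsupp.finsetSum_apply, Finsupp.smul_apply, nodeLin_apply_node, smul_eq_mul,
      Finset.sum_mul, mul_assoc]
  · simp only [Finsupp.finsetSum_apply, Finsupp.smul_apply, nodeLin_apply_of_ne _ _ ht, smul_zero,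
      Finset.sum_const_zero]

theorem nodeLin_single {n : ℕ} (y : X (n + 1)) (u : Fin (n + 1) → OpTree X) :
    nodeLin (Finsupp.single y (1 : k)) (fun j => Finsupp.single (u j) 1) =
      Finsupp.single (node y u) 1 := by
  classical
  refine nodeLin_ext (fun y' u' => ?_) fun t ht => Finsupp.single_eq_of_ne (ht y u)
  by_cases hy : y' = y
  · subst hy
    by_cases hu : u' = u
    · subst hu; simp
    · obtain ⟨j, hj⟩ := Function.ne_iff.1 hu
      rw [Finsupp.single_eq_of_ne, Finset.prod_eq_zero (Finset.mem_univ j), mul_zero]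
      · exact Finsupp.single_eq_of_ne hj
      · simpa using hu
  · rw [Finsupp.single_eq_of_ne, Finsupp.single_eq_of_ne hy, zero_mul]
    intro h
    simp only [node.injEq, heq_eq_eq, true_and] at h
    exact hy h.1

/-- Both sides are linear in `v` and multilinear in `p`, so the identity needs checking only on
trees `node y u` that occur. It extends a rule for acting on the decoration and permuting the inputs
from trees to combinations. -/
theorem map_nodeLin {n : ℕ} (v : X (n + 1) →₀ k) (p : Fin (n + 1) → OpTree X →₀ k)
    (Φ Ψ : (OpTree X →₀ k) →ₗ[k] (OpTree X →₀ k)) (L : (X (n + 1) →₀ k) →ₗ[k] (X (n + 1) →₀ k))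
    (π : Equiv.Perm (Fin (n + 1)))
    (h : ∀ y u, (∀ j, u j ∈ (p j).support) → Φ (Finsupp.single (node y u) 1) =
      nodeLin (L (Finsupp.single y 1)) fun j => Ψ (Finsupp.single (u (π j)) 1)) :
    Φ (nodeLin v p) = nodeLin (L v) fun j => Ψ (p (π j)) := by
  have hv : L v = ∑ y ∈ v.support, v y • L (Finsupp.single y 1) := by
    conv_lhs => rw [← Finsupp.sum_single v, Finsupp.sum, map_sum]
    refine Finset.sum_congr rfl fun y _ => ?_
    rw [← map_smul, Finsupp.smul_single, smul_eq_mul, mul_one]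
  rw [hv, nodeLin_sum_smul]
  conv_lhs => rw [nodeLin, Finsupp.sum, map_sum]
  refine Finset.sum_congr rfl fun y _ => ?_
  let F : MultilinearMap k (fun _ : Fin (n + 1) => OpTree X →₀ k) (OpTree X →₀ k) :=
    ((nodeMultilinear (L (Finsupp.single y 1))).compLinearMap fun _ => Ψ).domDomCongr π
  have hF : ∀ q, F q = nodeLin (L (Finsupp.single y 1)) fun j => Ψ (q (π j)) := fun q => rfl
  have hp : p = fun j => ∑ t ∈ (p j).support, p j t • Finsupp.single t (1 : k) := by
    funext j
    conv_lhs => rw [← Finsupp.sum_single (p j), Finsupp.sum]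
    exact Finset.sum_congr rfl fun t _ => by rw [Finsupp.smul_single, smul_eq_mul, mul_one]
  have hFp : F p = ∑ u ∈ Fintype.piFinset fun j => (p j).support,
      (∏ j, p j (u j)) • F fun j => Finsupp.single (u j) 1 := by
    conv_lhs => rw [hp]
    rw [MultilinearMap.map_sum_finset]
    exact Finset.sum_congr rfl fun u _ => MultilinearMap.map_smul_univ _ _ _
  rw [← hF p, hFp, Finset.smul_sum, map_sum]
  refine Finset.sum_congr rfl fun u hu => ?_
  rw [hF, ← h y u (Fintype.mem_piFinset.1 hu), ← map_smul, ← map_smul, Finsupp.smul_single,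
    Finsupp.smul_single, smul_eq_mul, smul_eq_mul, mul_one]

section ShuffleForm

variable (ρ : ∀ n : ℕ, Representation k (Equiv.Perm (Fin (n + 1))) (X (n + 1) →₀ k))

theorem shuffleForm_leaf (l : ℕ) : shuffleForm ρ (leaf l) = Finsupp.single (leaf l) 1 := by
  rw [shuffleForm]

theorem shuffleForm_node {n : ℕ} (x : X (n + 1)) (c : Fin (n + 1) → OpTree X) :
    shuffleForm ρ (node x c) =
      nodeLin (ρ n (Tuple.sort fun j => (c j).minLeaf)⁻¹ (Finsupp.single x 1))
        fun j => shuffleForm ρ (c (Tuple.sort (fun j => (c j).minLeaf) j)) := by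
  rw [shuffleForm]
  rfl

theorem coe_leaves_of_mem_shuffleForm {t a : OpTree X} (ha : a ∈ (shuffleForm ρ t).support) :
    (a.leaves : Multiset ℕ) = t.leaves := by
  induction t generalizing a with
  | leaf l =>
    rw [shuffleForm_leaf] at ha
    rw [Finset.mem_singleton.1 (Finsupp.support_single_subset ha)]
  | node x c ih =>
    rw [shuffleForm_node] at ha
    obtain ⟨y, u, rfl, hu⟩ := mem_support_nodeLin ha
    rw [coe_leaves_node, coe_leaves_node,
      ← Equiv.sum_comp (Tuple.sort fun j => (c j).minLeaf) fun j => ((c j).leaves : Multiset ℕ)]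
    exact Finset.sum_congr rfl fun j _ => ih _ (hu j)

theorem minLeaf_injective {n : ℕ} {x : X (n + 1)} {c : Fin (n + 1) → OpTree X}
    (h : (node x c).leaves.Nodup) : Function.Injective fun j => (c j).minLeaf := by
  intro i j hij
  refine (nodup_child h).2 i j (c i).minLeaf (minLeaf_mem _) ?_
  rw [show (c i).minLeaf = (c j).minLeaf from hij]
  exact minLeaf_mem _

theorem isShuffle_of_mem_shuffleForm {t a : OpTree X} (ht : t.leaves.Nodup)
    (ha : a ∈ (shuffleForm ρ t).support) : a.IsShuffle := by
  induction t generalizing a with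
  | leaf l =>
    rw [shuffleForm_leaf] at ha
    rw [Finset.mem_singleton.1 (Finsupp.support_single_subset ha)]
    trivial
  | node x c ih =>
    rw [shuffleForm_node] at ha
    obtain ⟨y, u, rfl, hu⟩ := mem_support_nodeLin ha
    refine ⟨fun j => ih _ ((nodup_child ht).1 _) (hu j), ?_⟩
    have e : (fun j => (u j).minLeaf) =
        (fun j => (c j).minLeaf) ∘ Tuple.sort fun j => (c j).minLeaf :=
      funext fun j => minLeaf_congr (coe_leaves_of_mem_shuffleForm ρ (hu j))
    rw [e]
    exact (Tuple.monotone_sort _).strictMono_of_injective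
      ((minLeaf_injective ht).comp (Equiv.injective _))

theorem shuffleForm_of_isShuffle {t : OpTree X} (ht : t.IsShuffle) :
    shuffleForm ρ t = Finsupp.single t 1 := by
  induction t with
  | leaf l => exact shuffleForm_leaf ρ l
  | node x c ih =>
    have h1 : Tuple.sort (fun j => (c j).minLeaf) = 1 :=
      Tuple.sort_eq_refl_iff_monotone.2 ht.2.monotone
    rw [shuffleForm_node, h1, inv_one, map_one, ← nodeLin_single]
    congr 1
    funext j
    exact ih j (ht.1 j)

/-- Linear extension of `a ↦ shuffleForm (a.graft s)`. -/
noncomputable def graftForm (s : ℕ → OpTree X) : (OpTree X →₀ k) →ₗ[k] (OpTree X →₀ k) :=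
  Finsupp.linearCombination k fun a => shuffleForm ρ (a.graft s)

theorem graftForm_single (s : ℕ → OpTree X) (a : OpTree X) :
    graftForm ρ s (Finsupp.single a 1) = shuffleForm ρ (a.graft s) := by
  rw [graftForm, Finsupp.linearCombination_single, one_smul]

/-- Sorting may be done in two stages, before and after grafting. At each vertex the two sorting
permutations multiply to the final one, and `ρ` is a representation, so the actions on the
decoration agree. -/
theorem shuffleForm_graft {t : OpTree X} {s : ℕ → OpTree X} (hn : (t.graft s).leaves.Nodup) :
    shuffleForm ρ (t.graft s) = graftForm ρ s (shuffleForm ρ t) := by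
  induction t with
  | leaf l => rw [shuffleForm_leaf, graftForm_single]
  | @node n x c ih =>
    have hn' : (node x fun j => (c j).graft s).leaves.Nodup := hn
    have hinj := minLeaf_injective hn'
    set τ := Tuple.sort fun j => (c j).minLeaf with hτ
    set τ' := Tuple.sort fun j => ((c j).graft s).minLeaf with hτ'
    set π := Tuple.sort ((fun j => ((c j).graft s).minLeaf) ∘ τ) with hπ
    -- The product sorts the minima after grafting. These are distinct, so no other permutation
    -- sorts them.
    have hcomp : τ * π = τ' := by
      rw [hτ', Tuple.eq_sort_iff]
      refine ⟨?_, fun i j hij h => ?_⟩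
      · exact Tuple.monotone_sort ((fun j => ((c j).graft s).minLeaf) ∘ τ)
      · exact absurd ((τ * π).injective (hinj h)) hij.ne
    have key := map_nodeLin (ρ n τ⁻¹ (Finsupp.single x 1)) (fun j => shuffleForm ρ (c (τ j)))
      (graftForm ρ s) (graftForm ρ s) (ρ n π⁻¹) π ?_
    · rw [shuffleForm_node ρ x c, key, graft, shuffleForm_node, ← hτ', ← hcomp, mul_inv_rev,
        map_mul]
      congr 1
      funext j
      exact ih _ ((nodup_child hn').1 _)
    · intro y u hu
      have e : (fun j => ((u j).graft s).minLeaf) = (fun j => ((c j).graft s).minLeaf) ∘ τ := by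
        funext j
        refine minLeaf_congr ?_
        rw [coe_leaves_graft, coe_leaves_graft, coe_leaves_of_mem_shuffleForm ρ (hu j)]
      rw [graftForm_single, graft, shuffleForm_node, e, ← hπ]
      congr 1
      funext j
      rw [graftForm_single]

/-- The expansion is linear in the tree grafted on a leaf occurring once. Trees with the same leaves
as `u` produce the same minima, hence the same sorting permutations, and at each vertex only one
child varies, so multilinearity applies. -/
theorem shuffleForm_graft_update {a u : OpTree X} {s : ℕ → OpTree X} {d : ℕ}
    (ha : a.leaves.count d = 1) (hu : u.leaves.Nodup) :
    shuffleForm ρ (a.graft (Function.update s d u)) =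
      Finsupp.linearCombination k (fun b => shuffleForm ρ (a.graft (Function.update s d b)))
        (shuffleForm ρ u) := by
  induction a with
  | leaf l =>
    have := mem_leaves_leaf.1 (List.count_pos_iff.1 (by omega : 0 < (leaf l : OpTree X).leaves.count d))
    subst this
    simp only [graft, Function.update_self]
    rw [Finsupp.linearCombination_apply]
    conv_lhs => rw [← Finsupp.sum_single (shuffleForm ρ u)]
    refine Finsupp.sum_congr fun b hb => ?_
    rw [shuffleForm_of_isShuffle ρ (isShuffle_of_mem_shuffleForm ρ hu hb), Finsupp.smul_single,
      smul_eq_mul, mul_one]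
  | @node n x c ih =>
    obtain ⟨j₀, hj₀, hne⟩ := count_node_eq_one_iff.1 ha
    have hother : ∀ b i, i ≠ j₀ → (c i).graft (Function.update s d b) = (c i).graft s :=
      fun b i hi => graft_congr fun l hl =>
        Function.update_of_ne (by rintro rfl; exact hne i hi hl) _ _
    set τ := Tuple.sort fun j => ((c j).graft (Function.update s d u)).minLeaf with hτ
    have hform : ∀ b, (b.leaves : Multiset ℕ) = u.leaves →
        shuffleForm ρ ((node x c).graft (Function.update s d b)) =
          (nodeMultilinear (ρ n τ⁻¹ (Finsupp.single x 1))).toLinearMap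
            (fun j => shuffleForm ρ ((c (τ j)).graft s)) (τ⁻¹ j₀)
            (shuffleForm ρ ((c j₀).graft (Function.update s d b))) := by
      intro b hb
      have e : (fun j => ((c j).graft (Function.update s d b)).minLeaf) =
          fun j => ((c j).graft (Function.update s d u)).minLeaf := by
        funext j
        refine minLeaf_congr ?_
        rw [coe_leaves_graft, coe_leaves_graft]
        refine Multiset.bind_congr fun l _ => ?_
        by_cases hl : l = d
        · subst hl; simpa using hb
        · rw [Function.update_of_ne hl, Function.update_of_ne hl]
      rw [graft, shuffleForm_node, e, ← hτ, MultilinearMap.toLinearMap_apply, nodeMultilinear_apply]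
      congr 1
      funext j
      by_cases hj : j = τ⁻¹ j₀
      · subst hj
        rw [Function.update_self, show τ (τ⁻¹ j₀) = j₀ from τ.apply_symm_apply j₀]
      · rw [Function.update_of_ne hj, hother]
        rintro rfl
        exact hj (τ.symm_apply_apply j).symm
    rw [hform u rfl, ih j₀ hj₀, Finsupp.linearCombination_apply, Finsupp.linearCombination_apply,
      Finsupp.sum, Finsupp.sum, map_sum]
    refine Finset.sum_congr rfl fun b hb => ?_
    rw [map_smul, hform b (coe_leaves_of_mem_shuffleForm ρ hb)]

end ShuffleForm

end ShuffleOperad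

/-! ### Symmetric ideals as shuffle ideals -/

namespace ShuffleOperad

open OpTree

variable {k : Type*} [Field k] {X : ℕ → Type*}

/-- `compLin` as a bilinear map. -/
noncomputable def compBilin (k : Type*) [Field k] {X : ℕ → Type*} (i : ℕ) (σ : Equiv.Perm ℕ) :
    (OpTree X →₀ k) →ₗ[k] (OpTree X →₀ k) →ₗ[k] (OpTree X →₀ k) :=
  Finsupp.linearCombination k fun α =>
    Finsupp.linearCombination k fun β => Finsupp.single (OpTree.comp i σ α β) (1 : k)

theorem compBilin_apply (i : ℕ) (σ : Equiv.Perm ℕ) (f g : OpTree X →₀ k) :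
    compBilin k i σ f g = compLin i σ f g := by
  rw [compBilin, Finsupp.linearCombination_apply, Finsupp.sum, LinearMap.sum_apply, compLin,
    Finsupp.sum]
  refine Finset.sum_congr rfl fun α _ => ?_
  rw [LinearMap.smul_apply, Finsupp.linearCombination_apply, Finsupp.sum, Finsupp.sum,
    Finset.smul_sum]
  refine Finset.sum_congr rfl fun β _ => ?_
  rw [smul_smul, Finsupp.smul_single, smul_eq_mul, mul_one]

theorem _root_.OpTree.IsPermOf.mul {n : ℕ} {σ τ : Equiv.Perm ℕ} (hσ : IsPermOf n σ) (hτ : IsPermOf n τ) :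
    IsPermOf n (σ * τ) := fun j hj => by rw [Equiv.Perm.mul_apply, hτ j hj, hσ j hj]

theorem isShufflePerm_one {n m i : ℕ} (h1 : 1 ≤ i) (h2 : i ≤ n) : IsShufflePerm n m i 1 :=
  ⟨h1, h2, fun _ _ => rfl, strictMonoOn_id, strictMonoOn_id⟩

theorem relabel_comp (i : ℕ) (σ τ : Equiv.Perm ℕ) (α β : OpTree X) :
    (OpTree.comp i σ α β).relabel τ = OpTree.comp i (τ * σ) α β := by
  rw [comp_eq_graft, comp_eq_graft, relabel, graft_graft]
  refine graft_congr fun l _ => ?_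
  simp only [compSubst]
  split_ifs
  · rfl
  · exact relabel_relabel _ _ _
  · rfl

theorem coe_leaves_relabel_perm {n : ℕ} {σ : Equiv.Perm ℕ} (hσ : IsPermOf n σ) {t : OpTree X}
    (ht : (t.leaves : Multiset ℕ) = (Finset.Icc 1 n).val) :
    ((t.relabel σ).leaves : Multiset ℕ) = (Finset.Icc 1 n).val := by
  rw [coe_leaves_relabel, ht]
  have : (Finset.Icc 1 n).map σ.toEmbedding = Finset.Icc 1 n := by
    ext l
    obtain ⟨m, rfl⟩ := σ.surjective l
    rw [hσ.mem_iff, Finset.mem_map]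
    constructor
    · rintro ⟨j, hj, e⟩
      rwa [← σ.injective e]
    · intro hm; exact ⟨m, hm, rfl⟩
  exact congrArg Finset.val this

theorem nodup_of_coe_leaves_eq {A : Finset ℕ} {t : OpTree X} (ht : (t.leaves : Multiset ℕ) = A.val) :
    t.leaves.Nodup := by
  rw [← Multiset.coe_nodup, ht]; exact A.nodup

theorem coe_leaves_comp {n m i : ℕ} {σ : Equiv.Perm ℕ} (h1 : 1 ≤ i) (h2 : i ≤ n)
    (hσ : IsPermOf (n + m - 1) σ) {α β : OpTree X} (hα : IsTreeOn (Finset.Icc 1 n) α)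
    (hβ : IsTreeOn (Finset.Icc 1 m) β) :
    ((OpTree.comp i σ α β).leaves : Multiset ℕ) = (Finset.Icc 1 (n + m - 1)).val := by
  -- A composition with `σ` is the one with the identity, which is a shuffle composition, followed
  -- by renaming the leaves.
  rw [← mul_one σ, ← relabel_comp]
  exact coe_leaves_relabel_perm hσ (isTreeOn_comp (isShufflePerm_one h1 h2) hα hβ).2

section

variable (ρ : ∀ n : ℕ, Representation k (Equiv.Perm (Fin (n + 1))) (X (n + 1) →₀ k))

theorem shuffleForm_mem_free {n : ℕ} {t : OpTree X}
    (ht : (t.leaves : Multiset ℕ) = (Finset.Icc 1 n).val) : shuffleForm ρ t ∈ free k X n :=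
  mem_free_iff.2 fun _ ha => ⟨isShuffle_of_mem_shuffleForm ρ (nodup_of_coe_leaves_eq ht) ha,
    (coe_leaves_of_mem_shuffleForm ρ ha).trans ht⟩

theorem symAct_eq_graftForm (σ : Equiv.Perm ℕ) (f : OpTree X →₀ k) :
    symAct ρ σ f = graftForm ρ (fun l => leaf (σ l)) f := rfl

theorem shuffleForm_relabel_perm {n : ℕ} {σ : Equiv.Perm ℕ} (hσ : IsPermOf n σ) {t : OpTree X}
    (ht : (t.leaves : Multiset ℕ) = (Finset.Icc 1 n).val) :
    shuffleForm ρ (t.relabel σ) = symAct ρ σ (shuffleForm ρ t) :=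
  shuffleForm_graft ρ (nodup_of_coe_leaves_eq (coe_leaves_relabel_perm hσ ht))

theorem symAct_mem_free {n : ℕ} {σ : Equiv.Perm ℕ} (hσ : IsPermOf n σ) {f : OpTree X →₀ k}
    (hf : f ∈ free k X n) : symAct ρ σ f ∈ free k X n :=
  Submodule.sum_mem _ fun t ht => Submodule.smul_mem _ _
    (shuffleForm_mem_free ρ (coe_leaves_relabel_perm hσ (mem_free_iff.1 hf t ht).2))

theorem symAct_sum_smul {ι : Type*} (σ : Equiv.Perm ℕ) (S : Finset ι) (a : ι → k)
    (f : ι → OpTree X →₀ k) :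
    symAct ρ σ (∑ i ∈ S, a i • f i) = ∑ i ∈ S, a i • symAct ρ σ (f i) := by
  simp only [symAct_eq_graftForm, map_sum, map_smul]

theorem symAct_symAct {n : ℕ} {σ τ : Equiv.Perm ℕ} (hσ : IsPermOf n σ) (hτ : IsPermOf n τ)
    {f : OpTree X →₀ k} (hf : f ∈ free k X n) :
    symAct ρ τ (symAct ρ σ f) = symAct ρ (τ * σ) f := by
  conv_lhs => rw [symAct.eq_def ρ σ, Finsupp.sum, symAct_sum_smul]
  rw [symAct, Finsupp.sum]
  refine Finset.sum_congr rfl fun t ht => ?_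
  rw [← shuffleForm_relabel_perm ρ hτ (coe_leaves_relabel_perm hσ (mem_free_iff.1 hf t ht).2),
    relabel_relabel]
  rfl

theorem symComp_eq_sum (i : ℕ) (σ : Equiv.Perm ℕ) (f g : OpTree X →₀ k) :
    symComp ρ i σ f g = ∑ α ∈ f.support, f α • ∑ β ∈ g.support, g β •
      shuffleForm ρ (OpTree.comp i σ α β) := by
  simp only [symComp, Finsupp.sum, Finset.smul_sum, smul_smul]

theorem symAct_symComp {n m i : ℕ} {σ τ : Equiv.Perm ℕ} (h1 : 1 ≤ i) (h2 : i ≤ n)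
    (hσ : IsPermOf (n + m - 1) σ) (hτ : IsPermOf (n + m - 1) τ) {f g : OpTree X →₀ k}
    (hf : f ∈ free k X n) (hg : g ∈ free k X m) :
    symAct ρ τ (symComp ρ i σ f g) = symComp ρ i (τ * σ) f g := by
  rw [symComp_eq_sum, symComp_eq_sum, symAct_sum_smul]
  refine Finset.sum_congr rfl fun α hα => ?_
  rw [symAct_sum_smul]
  congr 1
  refine Finset.sum_congr rfl fun β hβ => ?_
  rw [← shuffleForm_relabel_perm ρ hτ (coe_leaves_comp h1 h2 hσ (mem_free_iff.1 hf α hα)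
    (mem_free_iff.1 hg β hβ)), relabel_comp]

theorem symComp_of_isShufflePerm {n m i : ℕ} {σ : Equiv.Perm ℕ} (hσ : IsShufflePerm n m i σ)
    {f g : OpTree X →₀ k} (hf : f ∈ free k X n) (hg : g ∈ free k X m) :
    symComp ρ i σ f g = compLin i σ f g := by
  refine Finset.sum_congr rfl fun α hα => Finset.sum_congr rfl fun β hβ => ?_
  show (f α * g β) • shuffleForm ρ (OpTree.comp i σ α β) = _
  rw [shuffleForm_of_isShuffle ρ
    (isTreeOn_comp hσ (mem_free_iff.1 hf α hα) (mem_free_iff.1 hg β hβ)).1, Finsupp.smul_single,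
    smul_eq_mul, mul_one]

/-- The expansion of an arbitrary symmetric composition of tree monomials through shuffle
compositions. -/
theorem exists_shuffleForm_comp {n m i : ℕ} {σ : Equiv.Perm ℕ} (h1 : 1 ≤ i) (h2 : i ≤ n)
    (hm : 1 ≤ m) (hσ : IsPermOf (n + m - 1) σ) :
    ∃ i' σ' τ₁ τ₂, IsShufflePerm n m i' σ' ∧ IsPermOf n τ₁ ∧ IsPermOf m τ₂ ∧
      ∀ α β : OpTree X, IsTreeOn (Finset.Icc 1 n) α → IsTreeOn (Finset.Icc 1 m) β →
        shuffleForm ρ (OpTree.comp i σ α β) =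
          compLin i' σ' (shuffleForm ρ (α.relabel τ₁)) (shuffleForm ρ (β.relabel τ₂)) := by
  -- `U` will be the set of labels that the leaves of `β` receive in the composite, `d` its least
  -- element, and `r` the leaf of `β` that receives `d`.
  set ψ : ℕ → ℕ := fun l => σ (i + l - 1) with hψ
  set U := (Finset.Icc 1 m).image ψ with hU
  have hUne : U.Nonempty := ⟨ψ 1, Finset.mem_image_of_mem _ (Finset.mem_Icc.2 ⟨le_rfl, hm⟩)⟩
  set d := U.min' hUne with hd
  have hdU : d ∈ U := U.min'_mem hUne
  obtain ⟨r, hr, hrd⟩ := Finset.mem_image.1 hdU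
  rw [Finset.mem_Icc] at hr
  -- The labels of `α` in the composite when the whole of `β` is contracted to a leaf, named by its
  -- smallest label.
  set φ : ℕ → ℕ := fun j => if j < i then σ j else if j = i then d else σ (j + m - 1) with hφ
  -- the position in the composite of the label of a leaf
  set pos : ℕ → ℕ := fun j => if j < i then j else if j = i then i + r - 1 else j + m - 1 with hpos
  have hφpos : ∀ j, φ j = σ (pos j) := by
    intro j
    simp only [hφ, hpos]
    split_ifs
    · rfl
    · exact hrd.symm
    · rfl
  set A := (Finset.Icc 1 n).image φ with hA
  have hψi : Set.InjOn ψ (Finset.Icc 1 m : Finset ℕ) := by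
    intro a ha b hb hab
    have := σ.injective hab
    rw [Finset.coe_Icc, Set.mem_Icc] at ha hb
    omega
  have hφi : Set.InjOn φ (Finset.Icc 1 n : Finset ℕ) := by
    intro a ha b hb hab
    rw [hφpos, hφpos] at hab
    have := σ.injective hab
    simp only [hpos] at this
    rw [Finset.coe_Icc, Set.mem_Icc] at ha hb
    split_ifs at this <;> omega
  have hAc : A.card = n := by rw [hA, Finset.card_image_of_injOn hφi, Nat.card_Icc]; omega
  have hUc : U.card = m := by rw [hU, Finset.card_image_of_injOn hψi, Nat.card_Icc]; omega
  have hφd : φ i = d := by simp [hφ]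
  have hdA : d ∈ A := hφd ▸ Finset.mem_image_of_mem φ (Finset.mem_Icc.2 ⟨h1, h2⟩)
  have hAU : ∀ l ∈ A, l ∈ U → l = d := by
    intro l hl hl'
    obtain ⟨a, ha, rfl⟩ := Finset.mem_image.1 hl
    obtain ⟨b, hb, hab⟩ := Finset.mem_image.1 hl'
    rw [hφpos] at hab
    have := σ.injective hab
    rw [Finset.mem_Icc] at ha hb
    simp only [hpos] at this
    by_cases h : a = i
    · rw [h, hφd]
    · split_ifs at this <;> omega
  have hunion : A ∪ U = Finset.Icc 1 (n + m - 1) := by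
    refine Finset.eq_of_subset_of_card_le ?_ ?_
    · intro l hl
      rcases Finset.mem_union.1 hl with hl | hl
      · obtain ⟨a, ha, rfl⟩ := Finset.mem_image.1 hl
        rw [hφpos, hσ.mem_iff]
        simp only [hpos, Finset.mem_Icc] at ha ⊢
        split_ifs <;> omega
      · obtain ⟨b, hb, rfl⟩ := Finset.mem_image.1 hl
        rw [hψ, hσ.mem_iff]
        rw [Finset.mem_Icc] at hb ⊢
        omega
    · rw [card_union_of_inter hdA hdU hAU, hAc, hUc, Nat.card_Icc]
      omega
  obtain ⟨i', σ', hσ', hcomp⟩ := exists_comp (X := X) hdA hdU hAU fun u hu => U.min'_le u hu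
  rw [hAc, hUc] at hσ'
  -- `τ₁` and `τ₂` are `φ` and `ψ` standardised. They account for the disorder within each factor,
  -- so that `σ'` only has to interleave the two.
  obtain ⟨τ₁, hτ₁, e₁⟩ := exists_perm_of_injOn (N := n) (v := fun j => rank A (φ j))
    (fun j hj => hAc ▸ rank_mem (Finset.mem_image_of_mem φ hj))
    ((rank_strictMonoOn A).injOn.comp hφi fun j hj => Finset.mem_image_of_mem φ hj)
  obtain ⟨τ₂, hτ₂, e₂⟩ := exists_perm_of_injOn (N := m) (v := fun j => rank U (ψ j))
    (fun j hj => hUc ▸ rank_mem (Finset.mem_image_of_mem ψ hj))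
    ((rank_strictMonoOn U).injOn.comp hψi fun j hj => Finset.mem_image_of_mem ψ hj)
  refine ⟨i', σ', τ₁, τ₂, hσ', hτ₁, hτ₂, fun α β hα hβ => ?_⟩
  have hdr := rank_mem hdA
  rw [hAc] at hdr
  -- The leaf of `α.relabel τ₁` on which `β` is grafted; `s` restores the final labels of the other
  -- leaves.
  set e := rank A d with he
  set s : ℕ → OpTree X := fun j => leaf (unrank A j) with hs
  have hun : ∀ j ∈ Finset.Icc 1 n, unrank A (τ₁ j) = φ j := fun j hj => by
    rw [e₁ j hj]; exact unrank_rank (Finset.mem_image_of_mem φ hj)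
  have hu₀ : β.relabel ψ = (β.relabel τ₂).relabel (unrank U) := by
    rw [relabel_relabel]
    refine relabel_congr fun l hl => ?_
    have hl' := hβ.mem_iff.1 hl
    rw [Function.comp, e₂ l hl', unrank_rank (Finset.mem_image_of_mem ψ hl')]
  have hcompeq : OpTree.comp i σ α β =
      (α.relabel τ₁).graft (Function.update s e (β.relabel ψ)) := by
    rw [comp_eq_graft, relabel, graft_graft]
    refine graft_congr fun j hj => ?_
    have hj' := hα.mem_iff.1 hj
    show _ = Function.update s e (β.relabel ψ) (τ₁ j)
    by_cases h : j = i
    · have : τ₁ j = e := by rw [e₁ j hj', h, hφd]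
      rw [this, Function.update_self, compSubst, if_neg (by omega), if_pos h]
    · have : τ₁ j ≠ e := by
        intro h'
        have h3 := hun j hj'
        rw [h', he, unrank_rank hdA, ← hφd] at h3
        exact h (hφi hj' (Finset.mem_coe.2 (Finset.mem_Icc.2 ⟨h1, h2⟩)) h3.symm)
      rw [Function.update_of_ne this, hs, compSubst, hβ.arity]
      simp only [hun j hj', hφ, h, if_false]
      split_ifs <;> rfl
  -- For factors in canonical form the grafting is the shuffle composition itself, and no further
  -- sorting is needed.
  have hsub : ∀ a b : OpTree X, IsTreeOn (Finset.Icc 1 n) a → IsTreeOn (Finset.Icc 1 m) b →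
      shuffleForm ρ (a.graft (Function.update s e (b.relabel (unrank U)))) =
        Finsupp.single (OpTree.comp i' σ' a b) 1 := by
    intro a b ha hb
    have ha' : IsTreeOn A (a.relabel (unrank A)) := isTreeOn_relabel_unrank (by rwa [hAc])
    have hb' : IsTreeOn U (b.relabel (unrank U)) := isTreeOn_relabel_unrank (by rwa [hUc])
    have hmin : (b.relabel (unrank U)).minLeaf = d :=
      (minLeaf_isLeast _).unique ⟨hb'.mem_iff.2 hdU, fun l hl => U.min'_le l (hb'.mem_iff.1 hl)⟩
    have hgr := IsOperationOn.isTreeOn_graftAt hdA hAU hb' hmin ha'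
    have e3 := hcomp _ _ ha' hb'
    have ea : a.relabel (rank A ∘ unrank A) = a :=
      relabel_eq_self fun l hl => rank_unrank (by rw [hAc]; exact ha.mem_iff.1 hl)
    have eb : b.relabel (rank U ∘ unrank U) = b :=
      relabel_eq_self fun l hl => rank_unrank (by rw [hUc]; exact hb.mem_iff.1 hl)
    rw [hunion] at hgr e3
    rw [relabel_rank_Icc hgr, relabel_relabel, relabel_relabel, ea, eb] at e3
    have e4 : a.graft (Function.update s e (b.relabel (unrank U))) =
        graftAt d (b.relabel (unrank U)) (a.relabel (unrank A)) := by
      rw [graftAt, relabel.eq_def (unrank A) a, graft_graft]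
      refine graft_congr fun l hl => ?_
      have hl' := ha.mem_iff.1 hl
      simp only [graft]
      by_cases h : l = e
      · rw [h, Function.update_self, he, unrank_rank hdA, if_pos rfl]
      · rw [Function.update_of_ne h, if_neg]
        intro h'
        exact h (by rw [he, ← h', rank_unrank (by rwa [hAc])])
    rw [e4, e3, shuffleForm_of_isShuffle ρ (isTreeOn_comp hσ' ha hb).1]
  have hατ := coe_leaves_relabel_perm hτ₁ hα.2
  have hβτ := coe_leaves_relabel_perm hτ₂ hβ.2
  have hαf := mem_free_iff.1 (shuffleForm_mem_free ρ hατ)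
  have hβf := mem_free_iff.1 (shuffleForm_mem_free ρ hβτ)
  have hu₀n : (β.relabel ψ).leaves.Nodup := by
    rw [← Multiset.coe_nodup, coe_leaves_relabel, hβ.2]
    exact Multiset.Nodup.map_on (fun a ha b hb h => hψi ha hb h) (Finset.nodup _)
  have hSFu : shuffleForm ρ (β.relabel ψ) = ∑ b ∈ (shuffleForm ρ (β.relabel τ₂)).support,
      shuffleForm ρ (β.relabel τ₂) b • shuffleForm ρ (b.relabel (unrank U)) := by
    rw [hu₀] at hu₀n ⊢
    rw [relabel, shuffleForm_graft ρ hu₀n, graftForm, Finsupp.linearCombination_apply, Finsupp.sum]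
    rfl
  -- First `α.relabel τ₁` is expanded, then, by linearity at the leaf `e`, the grafted tree; `hsub`
  -- evaluates the resulting terms.
  rw [hcompeq, shuffleForm_graft ρ (by
    rw [← hcompeq]; exact nodup_of_coe_leaves_eq (coe_leaves_comp h1 h2 hσ hα hβ))]
  rw [graftForm, Finsupp.linearCombination_apply, compLin]
  refine Finsupp.sum_congr fun a ha => ?_
  have ha' := hαf a ha
  rw [shuffleForm_graft_update ρ (List.count_eq_one_of_mem ha'.nodup (ha'.mem_iff.2 hdr)) hu₀n, hSFu,
    map_sum, Finset.smul_sum]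
  refine Finset.sum_congr rfl fun b hb => ?_
  have hb' := hβf b hb
  have hbs : (b.relabel (unrank U)).IsShuffle :=
    (isTreeOn_relabel_unrank (A := U) (by rwa [hUc])).1
  rw [shuffleForm_of_isShuffle ρ hbs, map_smul, Finsupp.linearCombination_single, one_smul,
    hsub a b ha' hb', smul_smul, Finsupp.smul_single, smul_eq_mul, mul_one]

theorem exists_symComp_eq {n m i : ℕ} {σ : Equiv.Perm ℕ} (h1 : 1 ≤ i) (h2 : i ≤ n)
    (hm : 1 ≤ m) (hσ : IsPermOf (n + m - 1) σ) :
    ∃ i' σ' τ₁ τ₂, IsShufflePerm n m i' σ' ∧ IsPermOf n τ₁ ∧ IsPermOf m τ₂ ∧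
      ∀ f ∈ free k X n, ∀ g ∈ free k X m,
        symComp ρ i σ f g = compLin i' σ' (symAct ρ τ₁ f) (symAct ρ τ₂ g) := by
  obtain ⟨i', σ', τ₁, τ₂, hσ', hτ₁, hτ₂, h⟩ := exists_shuffleForm_comp ρ h1 h2 hm hσ
  refine ⟨i', σ', τ₁, τ₂, hσ', hτ₁, hτ₂, fun f hf g hg => ?_⟩
  rw [symComp_eq_sum, ← compBilin_apply, symAct, symAct, Finsupp.sum, Finsupp.sum,
    map_sum (compBilin k i' σ'), LinearMap.sum_apply]
  refine Finset.sum_congr rfl fun α hα => ?_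
  rw [map_smul, LinearMap.smul_apply, map_sum]
  congr 1
  refine Finset.sum_congr rfl fun β hβ => ?_
  rw [map_smul, compBilin_apply, h α β (mem_free_iff.1 hf α hα) (mem_free_iff.1 hg β hβ)]

variable {ρ}

theorem IsSymmetricIdeal.isShuffleIdeal {M : ℕ → Submodule k (OpTree X →₀ k)}
    (hM : IsSymmetricIdeal ρ M) : IsShuffleIdeal M where
  le_free := hM.le_free
  comp_left n m i σ hσ f hf g hg := by
    rw [← symComp_of_isShufflePerm ρ hσ (hM.le_free n hf) hg]
    exact hM.comp_left n m i σ hσ.1 hσ.2.1 hσ.isPermOf f hf g hg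
  comp_right n m i σ hσ f hf g hg := by
    rw [← symComp_of_isShufflePerm ρ hσ hf (hM.le_free m hg)]
    exact hM.comp_right n m i σ hσ.1 hσ.2.1 hσ.isPermOf f hf g hg

/-- The largest subcollection closed under the symmetric groups. -/
noncomputable def symCore
    (ρ : ∀ n : ℕ, Representation k (Equiv.Perm (Fin (n + 1))) (X (n + 1) →₀ k))
    (N : ℕ → Submodule k (OpTree X →₀ k)) (n : ℕ) : Submodule k (OpTree X →₀ k) :=
  free k X n ⊓ ⨅ (σ : Equiv.Perm ℕ) (_ : IsPermOf n σ),
    (N n).comap (graftForm ρ fun l => leaf (σ l))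

theorem mem_symCore {N : ℕ → Submodule k (OpTree X →₀ k)} {n : ℕ} {f : OpTree X →₀ k} :
    f ∈ symCore ρ N n ↔ f ∈ free k X n ∧ ∀ σ, IsPermOf n σ → symAct ρ σ f ∈ N n := by
  simp only [symCore, Submodule.mem_inf, Submodule.mem_iInf, Submodule.mem_comap,
    symAct_eq_graftForm]

theorem eq_zero_of_mem_free_zero {f : OpTree X →₀ k} (hf : f ∈ free k X 0) : f = 0 := by
  by_contra h
  obtain ⟨t, ht⟩ := Finsupp.support_nonempty_iff.2 h
  simpa using one_le_card (mem_free_iff.1 hf t ht)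

/-- A permutation applied to a symmetric composition gives another one, which is a shuffle
composition of images of the factors. All images of an element of the core lie in `N`, so the
composition does as well. -/
theorem isSymmetricIdeal_symCore {N : ℕ → Submodule k (OpTree X →₀ k)} (hN : IsShuffleIdeal N) :
    IsSymmetricIdeal ρ (symCore ρ N) := by
  have main : ∀ n m i σ, 1 ≤ i → i ≤ n → IsPermOf (n + m - 1) σ → ∀ f ∈ free k X n,
      ∀ g ∈ free k X m, (∀ i' σ' τ₁ τ₂, IsShufflePerm n m i' σ' → IsPermOf n τ₁ → IsPermOf m τ₂ →
        compLin i' σ' (symAct ρ τ₁ f) (symAct ρ τ₂ g) ∈ N (n + m - 1)) →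
      symComp ρ i σ f g ∈ symCore ρ N (n + m - 1) := by
    intro n m i σ h1 h2 hσ f hf g hg h
    -- There are no trees of arity `0`, so `g` vanishes then; the expansion needs `m ≥ 1` for `β` to
    -- have a smallest leaf.
    rcases Nat.eq_zero_or_pos m with rfl | hm
    · rw [eq_zero_of_mem_free_zero hg, symComp_eq_sum]
      simp
    · rw [mem_symCore]
      constructor
      · obtain ⟨i', σ', τ₁, τ₂, h3, h4, h5, h6⟩ := exists_symComp_eq ρ h1 h2 hm hσ
        rw [h6 f hf g hg]
        exact compLin_mem_free h3 (symAct_mem_free ρ h4 hf) (symAct_mem_free ρ h5 hg)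
      · intro τ hτ
        rw [symAct_symComp ρ h1 h2 hσ hτ hf hg]
        obtain ⟨i', σ', τ₁, τ₂, h3, h4, h5, h6⟩ := exists_symComp_eq ρ h1 h2 hm (hτ.mul hσ)
        rw [h6 f hf g hg]
        exact h i' σ' τ₁ τ₂ h3 h4 h5
  refine ⟨fun n => inf_le_left, fun n σ hσ f hf => ?_, fun n m i σ h1 h2 hσ f hf g hg => ?_,
    fun n m i σ h1 h2 hσ f hf g hg => ?_⟩
  · rw [mem_symCore] at hf ⊢
    refine ⟨symAct_mem_free ρ hσ hf.1, fun τ hτ => ?_⟩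
    rw [symAct_symAct ρ hσ hτ hf.1]
    exact hf.2 _ (hτ.mul hσ)
  · rw [mem_symCore] at hf
    exact main n m i σ h1 h2 hσ f hf.1 g hg fun i' σ' τ₁ τ₂ h3 h4 h5 =>
      hN.comp_left n m i' σ' h3 _ (hf.2 τ₁ h4) _ (symAct_mem_free ρ h5 hg)
  · rw [mem_symCore] at hg
    exact main n m i σ h1 h2 hσ f hf g hg.1 fun i' σ' τ₁ τ₂ h3 h4 h5 =>
      hN.comp_right n m i' σ' h3 _ (symAct_mem_free ρ h4 hf) _ (hg.2 τ₂ h5)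

theorem isHomogeneousSet_symExtend {K : Set (OpTree X →₀ k)} (hK : IsHomogeneousSet K) :
    IsHomogeneousSet (symExtend ρ K) := by
  rintro f (hf | ⟨n, g, hg, hgn, σ, hσ, rfl⟩)
  · exact hK f hf
  · exact ⟨n, symAct_mem_free ρ hσ hgn⟩

/-- For minimality, if `N` is a shuffle ideal containing the extended set, its core is a symmetric
ideal containing `K`. Hence `M` lies in the core, and the core lies in `N`. -/
theorem GeneratesSymmetricIdeal.generatesShuffleIdeal {M : ℕ → Submodule k (OpTree X →₀ k)}
    {K : Set (OpTree X →₀ k)} (h : GeneratesSymmetricIdeal ρ K M) :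
    GeneratesShuffleIdeal (symExtend ρ K) M := by
  refine ⟨⟨h.1.1.isShuffleIdeal, ?_⟩, fun N hN => ?_⟩
  · rintro n f (hf | ⟨m, g, hg, hgm, σ, hσ, rfl⟩) hfn
    · exact h.1.2 n f hf hfn
    · have h1 := h.1.1.act m σ hσ g (h.1.2 m g hg hgm)
      by_cases h0 : symAct ρ σ g = 0
      · rw [h0]; exact Submodule.zero_mem _
      · obtain ⟨t, ht⟩ := Finsupp.support_nonempty_iff.2 h0
        have h2 := (mem_free_iff.1 hfn t ht).arity
        have h3 := (mem_free_iff.1 (h.1.1.le_free m h1) t ht).arity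
        rwa [← h2, h3]
  · have hle := h.2 (show symCore ρ N ∈ _ from ⟨isSymmetricIdeal_symCore hN.1, ?_⟩)
    · intro n f hf
      -- The identity permutation acts trivially on shuffle trees, which brings the core into `N`.
      have h1 := (mem_symCore.1 (hle n hf)).2 1 fun j _ => rfl
      have h2 : symAct ρ 1 f = f := by
        conv_rhs => rw [← Finsupp.sum_single f]
        refine Finsupp.sum_congr fun t ht => ?_
        have := mem_free_iff.1 (h.1.1.le_free n hf) t ht
        have h3 : t.relabel ⇑(1 : Equiv.Perm ℕ) = t := relabel_eq_self fun _ _ => rfl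
        rw [h3, shuffleForm_of_isShuffle ρ this.1, Finsupp.smul_single,
          smul_eq_mul, mul_one]
      rwa [h2] at h1
    · intro n f hf hfn
      refine mem_symCore.2 ⟨hfn, fun σ hσ => hN.2 n _ (Or.inr ⟨n, f, hf, hfn, σ, hσ, rfl⟩) ?_⟩
      exact symAct_mem_free ρ hσ hfn

end

end ShuffleOperad

theorem mainTheorem4 {k : Type*} [Field k] {X : ℕ → Type*}
    (lt : OpTree X → OpTree X → Prop) (hlt : OpTree.IsAdmissible lt)
    (hwf : WellFounded fun α β : {t : OpTree X // t.IsMonomial} => lt α.1 β.1) :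
    (∀ (M : ℕ → Submodule k (OpTree X →₀ k)) (K : Set (OpTree X →₀ k)),
      ShuffleOperad.IsHomogeneousSet K → ShuffleOperad.GeneratesShuffleIdeal K M →
      (∃ G, ShuffleOperad.IsBuchbergerOutput lt K G) ∧
        ∀ G, ShuffleOperad.IsBuchbergerOutput lt K G → ShuffleOperad.IsGroebnerBasis lt M G) ∧
    (∀ (ρ : ∀ n : ℕ, Representation k (Equiv.Perm (Fin (n + 1))) (X (n + 1) →₀ k))
      (M : ℕ → Submodule k (OpTree X →₀ k)) (K : Set (OpTree X →₀ k)),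
      ShuffleOperad.IsHomogeneousSet K → ShuffleOperad.GeneratesSymmetricIdeal ρ K M →
      (∃ G, ShuffleOperad.IsBuchbergerOutput lt (ShuffleOperad.symExtend ρ K) G) ∧
        ∀ G, ShuffleOperad.IsBuchbergerOutput lt (ShuffleOperad.symExtend ρ K) G →
          ShuffleOperad.IsGroebnerBasis lt M G) := by
  have main : ∀ (M : ℕ → Submodule k (OpTree X →₀ k)) (K : Set (OpTree X →₀ k)),
      ShuffleOperad.IsHomogeneousSet K → ShuffleOperad.GeneratesShuffleIdeal K M →
      (∃ G, ShuffleOperad.IsBuchbergerOutput lt K G) ∧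
        ∀ G, ShuffleOperad.IsBuchbergerOutput lt K G → ShuffleOperad.IsGroebnerBasis lt M G :=
    fun M K hK hM => ⟨ShuffleOperad.exists_isBuchbergerOutput hlt hwf hK,
      fun G hG => hG.isGroebnerBasis hlt hwf hK hM⟩
  exact ⟨main, fun ρ M K hK hM => main M _ (ShuffleOperad.isHomogeneousSet_symExtend hK)
    hM.generatesShuffleIdeal⟩
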